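/- \textbf{Setting.} Let $n,R,K\ge 1$. For $i\in[n]$ let $\mathcal D_i$ be a probability distribution, $F_i(\cdot\,;\xi)$ differentiable sample losses on $\mathbb R^{d_1\times d_2}$, $f_i(X):=\mathbb E_{\xi\sim\mathcal D_i}F_i(X;\xi)$ differentiable, $f:=\frac1n\sum_{i=1}^n f_i$ bounded below, and $f^\star:=\inf f$. Write $\langle A,B\rangle=\sum_{a,b}A_{ab}B_{ab}$, $\|\cdot\|_F$ for the Frobenius norm, $\|\cdot\|_{\rm sp}$ for the spectral norm, $\|\cdot\|_\star$ for its dual norm, and $\|A\|_p=(\sum_j s_j(A)^p)^{1/p}$ for the Schatten $p$-norm, with $s_j(A)$ the singular values. Suppose that for some $L,\sigma\ge 0$ and all $i,X,Y$: $$\|\nabla f_i(X)-\nabla f_i(Y)\|_\star\le L\|X-Y\|_{\rm sp},\qquad \mathbb E_{\xi\sim\mathcal D_i}\nabla F_i(X;\xi)=\nabla f_i(X),\qquad \mathbb E_{\xi\sim\mathcal D_i}\|\nabla F_i(X;\xi)-\nabla f_i(X)\|_F^2\le\sigma^2 .$$ \textbf{Newton--Schulz oracle.} For an input $G$ put $G^{(0)}=G/\|G\|_F$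 (and $G^{(0)}=0$ if $G=0$) and $$G^{(t+1)}=\tfrac{15}8G^{(t)}-\tfrac54\big(G^{(t)}G^{(t)\top}\big)G^{(t)}+\tfrac38\big(G^{(t)}G^{(t)\top}\big)^2G^{(t)};$$ the output after $T$ steps is $\mathrm{NS}_T(G):=-G^{(T)}$. \textbf{Algorithm (FedMuon, all clients participating).} Start from a deterministic $X^{(0)}$ with $r_0:=f(X^{(0)})-f^\star>0$, from random $M_i^{(0,0)}$ with finite second moments, $C_i^{(0)}=M_i^{(0,0)}$ and $C^{(0)}=\frac1n\sum_i C_i^{(0)}$. In round $r=0,1,\dots,R-1$ put $X_i^{(r,0)}=X^{(r)}$ and $M_i^{(r,0)}=M_i^{(r-1,K)}$ (if $r\ge1$); for $k=0,\dots,K-1$ put $$M_i^{(r,k+1)}=(1-\alpha)M_i^{(r,k)}+\alpha\nabla F_i(X_i^{(r,k)};\xi_i^{(r,k)}),\quad G_i^{(r,k+1)}=M_i^{(r,k+1)}-C_i^{(r)}+C^{(r)},\quad X_i^{(r,k+1)}=X_i^{(r,k)}+\eta\,\mathrm{NS}_T\big(G_i^{(r,k+1)}\big);$$ then $C_i^{(r+1)}=M_i^{(r,K)}$,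 $C^{(r+1)}=C^{(r)}+\frac1n\sum_i(C_i^{(r+1)}-C_i^{(r)})$ and $X^{(r+1)}=\frac1n\sum_iX_i^{(r,K)}$. The samples $\xi_i^{(r,k)}\sim\mathcal D_i$ are mutually independent and independent of $(M_i^{(0,0)})_i$. Put $X^{(r,k)}=\frac1n\sum_iX_i^{(r,k)}$. \textbf{Constants.} Let $\rho=\sqrt{\min\{d_1,d_2\}}$, $\sigma_0^2=\frac1n\sum_i\mathbb E\|M_i^{(0,0)}-\nabla f_i(X^{(0)})\|_F^2$, $\tilde\sigma=\rho\sigma$ and $\tilde\sigma_0=\rho\sigma_0$. Let $$\kappa:=\min_{j,i,r,k}\frac{s_{j,i,r,k}}{\sqrt{\sum_{j'}s_{j',i,r,k}^2}},\qquad p(\kappa,T):=1+\frac{\log\big(1-(1-\kappa)^{1.5^T}\big)}{\log\kappa},$$ where $\{s_{j,i,r,k}\}_j$ are the nonzero singular values of $G_i^{(r,k+1)}$, $0\le r<R$, $0\le k<K$. Here $\kappa$ is taken along each realization; $\kappa=1$ if all $G_i^{(r,k+1)}$ vanish; and $p(1,T)$ is the limit for $\kappa\to1$, i.e. $p(1,0)=2$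 and $p(1,T)=1$ for $T\ge1$. \textbf{Theorem.} For each $\kappa\in(0,1]$, $p(\kappa,0)=2$, and $p(\kappa,T)$ is non-increasing in $T$ (strictly decreasing if $\kappa<1$) and tends to $1$ as $T\to\infty$. Moreover, there is an absolute constant $c>0$ such that in the above setting, for every number $T\ge0$ of Newton--Schulz steps, there exist $\eta>0$ and $\alpha\in(0,1]$ for which always $0<\kappa\le1$ and, with $p=p(\kappa,T)$, $$\frac1{RK}\sum_{r=0}^{R-1}\sum_{k=0}^{K-1}\mathbb E\big\|\nabla f(X^{(r,k)})\big\|_p\le c\left(\Big(\frac{Lr_0\tilde\sigma^2}{nRK}\Big)^{\frac14}+\Big(\frac{Lr_0\tilde\sigma}{R\sqrt K}\Big)^{\frac13}+\Big(\frac{Lr_0}R\Big)^{\frac12}+\tilde\sigma_0\left[\frac1R+\Big(\frac{\tilde\sigma^2K}{Lr_0Rn}\Big)^{\frac12}+\Big(\frac{\tilde\sigma^2K^2}{Lr_0R^2}\Big)^{\frac13}\right]\right).$$ With the same $\eta,\alpha$, the same bound holds for $p=p(\kappa_0,T)$ with any constant $\kappa_0>0$ such that $\kappa\ge\kappa_0$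 almost surely. -/

import Mathlib

open MeasureTheory ProbabilityTheory Filter Topology

noncomputable section

namespace FedMuon

/-- The parameter space of real `d₁ × d₂` matrices. -/
abbrev Mat (d₁ d₂ : ℕ) : Type := Matrix (Fin d₁) (Fin d₂) ℝ

/-- The (entrywise, hence Borel) sigma-algebra on real matrices. -/
instance instMeasurableSpaceMat {d₁ d₂ : ℕ} : MeasurableSpace (Mat d₁ d₂) :=
  inferInstanceAs (MeasurableSpace (Fin d₁ → Fin d₂ → ℝ))

section Norms

variable {d₁ d₂ : ℕ}

/-- The trace inner product `⟨A, B⟩ = ∑ᵢⱼ Aᵢⱼ Bᵢⱼ`. -/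
def innerM (A B : Mat d₁ d₂) : ℝ := ∑ a, ∑ b, A a b * B a b

/-- The Frobenius norm. -/
def frobNorm (A : Mat d₁ d₂) : ℝ := √(∑ a, ∑ b, A a b ^ 2)

/-- The spectral norm: the operator norm of `A` between Euclidean spaces. -/
def spNorm (A : Mat d₁ d₂) : ℝ :=
  ‖LinearMap.toContinuousLinearMap (Matrix.toEuclideanLin A)‖

/-- The dual norm of the spectral norm, `‖A‖_⋆ = sup {⟨A, Y⟩ : ‖Y‖_sp ≤ 1}`. -/
def dualNorm (A : Mat d₁ d₂) : ℝ := sSup {c : ℝ | ∃ Y : Mat d₁ d₂, spNorm Y ≤ 1 ∧ c = innerM A Y}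

/-- The singular values of `A` in decreasing order, with multiplicity, followed by zeros. -/
def singVals (A : Mat d₁ d₂) : ℕ →₀ ℝ := (Matrix.toEuclideanLin A).singularValues

/-- The Schatten `p`-norm `(∑ⱼ sⱼ ^ p) ^ (1 / p)`, the sum being over the nonzero singular values. -/
def schattenNorm (p : ℝ) (A : Mat d₁ d₂) : ℝ := ((singVals A).sum fun _ s => s ^ p) ^ (1 / p)

/-- The gradient of `f` at `X` for the trace inner product: the matrix of partial derivatives. -/
def grad (f : Mat d₁ d₂ → ℝ) (X : Mat d₁ d₂) : Mat d₁ d₂ :=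
  Matrix.of fun a b => fderiv ℝ f X (Matrix.single a b 1)

end Norms

section NewtonSchulz

variable {d₁ d₂ : ℕ}

/-- One Newton-Schulz step `G ↦ a G + b (G Gᵀ) G + c (G Gᵀ)² G`. -/
def nsStep (a b c : ℝ) (G : Mat d₁ d₂) : Mat d₁ d₂ :=
  a • G + b • ((G * G.transpose) * G) + c • ((G * G.transpose) ^ 2 * G)

/-- The output `-G⁽ᵀ⁾` of `T` Newton-Schulz steps started at `G / ‖G‖_F` (it is `0` if `G = 0`). -/
def nsOutput (a b c : ℝ) (T : ℕ) (G : Mat d₁ d₂) : Mat d₁ d₂ :=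
  -((nsStep a b c)^[T] ((frobNorm G)⁻¹ • G))

/-- The exponent `p = 1 + log (1 - (1 - κ) ^ (1.5 ^ T)) / log κ` for `0 < κ < 1`. At `κ = 1`, where
the quotient reads `0 / 0`, it is the limit `κ → 1`, which is `2` if `T = 0` and `1` if `T ≥ 1`. -/
def nsExponent (κ : ℝ) (T : ℕ) : ℝ :=
  if κ = 1 then (if T = 0 then 2 else 1)
  else 1 + Real.log (1 - (1 - κ) ^ ((3 / 2 : ℝ) ^ T)) / Real.log κ

end NewtonSchulz

section Algorithm

variable {n d₁ d₂ : ℕ}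

/-- What is stored at the beginning of a round: the server's parameter `X` and control variate `C`,
the clients' momenta `Mᵢ` and control variates `Cᵢ`. -/
structure FedState (n d₁ d₂ : ℕ) where
  X : Mat d₁ d₂
  C : Mat d₁ d₂
  M : Fin n → Mat d₁ d₂
  Cc : Fin n → Mat d₁ d₂

/-- The pair `(Xᵢ, Mᵢ)` of one client after `k` local steps, started at `(X₀, M₀)`, with (possibly
inexact) linear minimization oracle `lmo`, control variates `Ci`, `C`, and stochastic gradient
`g k X` at the `k`-th step:
`M ← (1 - α) M + α g k X`, then `X ← X + η lmo (M - Ci + C)`. -/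
def clientIter (lmo : Mat d₁ d₂ → Mat d₁ d₂) (η α : ℝ) (g : ℕ → Mat d₁ d₂ → Mat d₁ d₂)
    (Ci C X₀ M₀ : Mat d₁ d₂) : ℕ → Mat d₁ d₂ × Mat d₁ d₂
  | 0 => (X₀, M₀)
  | k + 1 =>
    let s := clientIter lmo η α g Ci C X₀ M₀ k
    let m := (1 - α) • s.2 + α • g k s.1
    (s.1 + η • lmo (m - Ci + C), m)

/-- The local iterates `(Xᵢ, Mᵢ)` of client `i` after `k` local steps of the round that starts in
the state `s`; `g k i` is the stochastic gradient of client `i` at local step `k`. -/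
def localIter (lmo : Mat d₁ d₂ → Mat d₁ d₂) (η α : ℝ) (g : ℕ → Fin n → Mat d₁ d₂ → Mat d₁ d₂)
    (s : FedState n d₁ d₂) (i : Fin n) (k : ℕ) : Mat d₁ d₂ × Mat d₁ d₂ :=
  clientIter lmo η α (fun k' => g k' i) (s.Cc i) s.C s.X (s.M i) k

/-- One round of `K` local steps, with participation of all clients, and the server update. -/
def fedRound (lmo : Mat d₁ d₂ → Mat d₁ d₂) (η α : ℝ) (K : ℕ)
    (g : ℕ → Fin n → Mat d₁ d₂ → Mat d₁ d₂) (s : FedState n d₁ d₂) : FedState n d₁ d₂ where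
  X := (1 / (n : ℝ)) • ∑ i, (localIter lmo η α g s i K).1
  C := s.C + (1 / (n : ℝ)) • ∑ i, ((localIter lmo η α g s i K).2 - s.Cc i)
  M := fun i => (localIter lmo η α g s i K).2
  Cc := fun i => (localIter lmo η α g s i K).2

/-- The state of FedMuon at the beginning of round `r`, initialized at `X⁽⁰⁾ = X₀`, `Mᵢ = Cᵢ = M₀ i`
and `C` the average of the `Cᵢ`. Here `g r k i` is the stochastic gradient of client `i` at local
step `k` of round `r`. -/
def fedState (lmo : Mat d₁ d₂ → Mat d₁ d₂) (η α : ℝ) (K : ℕ)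
    (g : ℕ → ℕ → Fin n → Mat d₁ d₂ → Mat d₁ d₂) (X₀ : Mat d₁ d₂) (M₀ : Fin n → Mat d₁ d₂) :
    ℕ → FedState n d₁ d₂
  | 0 => ⟨X₀, (1 / (n : ℝ)) • ∑ i, M₀ i, M₀, M₀⟩
  | r + 1 => fedRound lmo η α K (g r) (fedState lmo η α K g X₀ M₀ r)

/-- The averaged iterate `X⁽ʳ'ᵏ⁾ = (1 / n) ∑ᵢ Xᵢ⁽ʳ'ᵏ⁾`. -/
def avgIterate (lmo : Mat d₁ d₂ → Mat d₁ d₂) (η α : ℝ) (K : ℕ)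
    (g : ℕ → ℕ → Fin n → Mat d₁ d₂ → Mat d₁ d₂) (X₀ : Mat d₁ d₂) (M₀ : Fin n → Mat d₁ d₂)
    (r k : ℕ) : Mat d₁ d₂ :=
  (1 / (n : ℝ)) • ∑ i, (localIter lmo η α (g r) (fedState lmo η α K g X₀ M₀ r) i k).1

/-- The input `Mᵢ⁽ʳ'ᵏ⁺¹⁾ - Cᵢ⁽ʳ⁾ + C⁽ʳ⁾` of the oracle at local step `k` of round `r`. -/
def lmoInput (lmo : Mat d₁ d₂ → Mat d₁ d₂) (η α : ℝ) (K : ℕ)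
    (g : ℕ → ℕ → Fin n → Mat d₁ d₂ → Mat d₁ d₂) (X₀ : Mat d₁ d₂) (M₀ : Fin n → Mat d₁ d₂)
    (i : Fin n) (r k : ℕ) : Mat d₁ d₂ :=
  let s := fedState lmo η α K g X₀ M₀ r
  (localIter lmo η α (g r) s i (k + 1)).2 - s.Cc i + s.C

/-- The ratios `s / √(∑ⱼ sⱼ²)`, for `s` a nonzero singular value of one of the matrices `G i r k`
with `r < R`, `k < K`. -/
def svRatios (R K : ℕ) (G : Fin n → ℕ → ℕ → Mat d₁ d₂) : Set ℝ :=
  {q | ∃ i : Fin n, ∃ r < R, ∃ k < K, ∃ j : ℕ, singVals (G i r k) j ≠ 0 ∧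
    q = singVals (G i r k) j / √((singVals (G i r k)).sum fun _ s => s ^ 2)}

open Classical in
/-- `κ`, the minimum of the (finite) set of ratios; it is `1` (all ratios are at most `1`) in the
degenerate case that all the matrices vanish. -/
def kappa (R K : ℕ) (G : Fin n → ℕ → ℕ → Mat d₁ d₂) : ℝ :=
  if (svRatios R K G).Nonempty then sInf (svRatios R K G) else 1

end Algorithm

section Problem

variable {n d₁ d₂ : ℕ} {Ξ : Type*} [MeasurableSpace Ξ]

/-- The loss `fᵢ X = 𝔼_{z ∼ 𝒟ᵢ} Fᵢ (X; z)` of client `i`. -/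
def clientLoss (𝒟 : Fin n → Measure Ξ) (F : Fin n → Mat d₁ d₂ → Ξ → ℝ) (i : Fin n)
    (X : Mat d₁ d₂) : ℝ := ∫ z, F i X z ∂(𝒟 i)

/-- The global loss `f = (1 / n) ∑ᵢ fᵢ`. -/
def globalLoss (𝒟 : Fin n → Measure Ξ) (F : Fin n → Mat d₁ d₂ → Ξ → ℝ) (X : Mat d₁ d₂) : ℝ :=
  (1 / (n : ℝ)) * ∑ i, clientLoss 𝒟 F i X

/-- The stochastic gradient `∇Fᵢ (X; z)`. -/
def stochGrad (F : Fin n → Mat d₁ d₂ → Ξ → ℝ) (i : Fin n) (X : Mat d₁ d₂) (z : Ξ) : Mat d₁ d₂ :=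
  grad (fun Y => F i Y z) X

/-- The sample losses are integrable and differentiable, so that the client losses and the stochastic
gradients make sense; the stochastic gradients are jointly measurable, and the client losses are
differentiable. -/
def RegularLoss (𝒟 : Fin n → Measure Ξ) (F : Fin n → Mat d₁ d₂ → Ξ → ℝ) : Prop :=
  ∀ i, (∀ X, Integrable (F i X) (𝒟 i)) ∧
    (∀ᵐ z ∂(𝒟 i), Differentiable ℝ fun X => F i X z) ∧
    Measurable (fun q : Mat d₁ d₂ × Ξ => stochGrad F i q.1 q.2) ∧
    Differentiable ℝ (clientLoss 𝒟 F i)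

/-- Smoothness: `‖∇fᵢ X - ∇fᵢ Y‖_⋆ ≤ L ‖X - Y‖_sp`, with `‖·‖_⋆` the dual of the spectral norm. -/
def SmoothLoss (𝒟 : Fin n → Measure Ξ) (F : Fin n → Mat d₁ d₂ → Ξ → ℝ) (L : ℝ) : Prop :=
  ∀ i X Y, dualNorm (grad (clientLoss 𝒟 F i) X - grad (clientLoss 𝒟 F i) Y) ≤ L * spNorm (X - Y)

/-- The stochastic gradients are unbiased, with variance at most `σ²` in the Frobenius norm. -/
def BoundedNoise (𝒟 : Fin n → Measure Ξ) (F : Fin n → Mat d₁ d₂ → Ξ → ℝ) (σ : ℝ) : Prop :=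
  ∀ i X,
    (∀ a b, Integrable (fun z => stochGrad F i X z a b) (𝒟 i) ∧
      ∫ z, stochGrad F i X z a b ∂(𝒟 i) = grad (clientLoss 𝒟 F i) X a b) ∧
    Integrable (fun z => frobNorm (stochGrad F i X z - grad (clientLoss 𝒟 F i) X) ^ 2) (𝒟 i) ∧
    ∫ z, frobNorm (stochGrad F i X z - grad (clientLoss 𝒟 F i) X) ^ 2 ∂(𝒟 i) ≤ σ ^ 2

/-- The convergence rate, without the absolute constant, as a function of `r₀`, `σ̃` and `σ̃₀`. -/
def convRate (n R K : ℕ) (L r₀ σt σt₀ : ℝ) : ℝ :=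
  (L * r₀ * σt ^ 2 / (n * R * K)) ^ (1 / 4 : ℝ)
    + (L * r₀ * σt / (R * √K)) ^ (1 / 3 : ℝ)
    + (L * r₀ / R) ^ (1 / 2 : ℝ)
    + σt₀ * (1 / R
      + (σt ^ 2 * K / (L * r₀ * R * n)) ^ (1 / 2 : ℝ)
      + (σt ^ 2 * K ^ 2 / (L * r₀ * R ^ 2)) ^ (1 / 3 : ℝ))

end Problem

end FedMuon

end

open FedMuon

/-!
The proof is a descent argument in which Newton-Schulz replaces exact linear minimization over the
spectral norm ball.

*The oracle.* On the singular values, a Newton-Schulz step acts as the polynomial `nsPoly`, which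
raises the defect `1 - x` to at least the power `3 / 2`. So `T` steps turn a singular value `x` of
the normalized input, which lies in `[κ, 1]`, into at least `nsLower T x = 1 - (1 - x) ^ (1.5 ^ T)`,
and this is at least `x ^ (p - 1)` for the exponent `p = p (κ, T)` (`rpow_le_nsPoly_iterate`); the point
is that `nsLower T (x ^ θ) ≤ nsLower T x ^ θ` for `θ ≥ 1`. As `‖G‖_F ≤ ‖G‖ₚ` for `p ≤ 2`,
this yields `⟨G, NS G⟩ ≤ -‖G‖ₚ`. The Schatten norm is Lipschitz for the dual of the spectral norm,
so for every matrix `A` (`innerM_nsOutput_le_add`)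
`⟨A, NS G⟩ ≤ -‖A‖ₚ + 2 ‖A - G‖_⋆`.
With the gradient at the averaged iterate as `A`, and the input of each client as `G`, smoothness
turns this into a bound for the sum of the `‖∇f‖ₚ` by `r₀ / η` and the errors `‖A - G‖_⋆`
(`sum_schattenNorm_le`). It holds along every realization, whence `p` may depend on it.

*The error of the input.* On the time axis `t = r K + k`, a momentum is the gradient at the averaged
iterate, plus a drift of dual norm `O(L η (K + 1 / α))`, plus the accumulated noise, plus the
decaying error of the initialization (`dualNorm_momentum_sub_le`). The control variates of a round
are the momenta and their average at the beginning of the round, so that in the input the gradient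
of a client is replaced by the global one up to drift, and the noise of earlier rounds by its
average over the clients, apart from a small multiple of the noise of the client
(`dualNorm_lmoInput_sub_le`).

*The noise.* Each sample is independent of everything that determines the iterate at which it is
used, so the noises of different times or clients are uncorrelated (`flatNoise_uncorrelated`). The
accumulated noise of a client is thus of size `σ min (√α, α √m)` after `m` steps, and its average
over the clients of size `σ √(α / n)`. The Frobenius norm costs a factor `ρ` against the dual norm.
This leads to the bound
`r₀ / (η R K) + 17 L η (K + 1 / α) + 4 ρ σ α √K + 2 ρ σ √(α / n) + 4 ρ σ₀ (1 / R + 1 / (α R K))`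
(`lintegral_schattenNorm_le`). The step size balances the first two terms, and `α` is the largest
value for which the noise terms are within the rate (`exists_parameters`).
-/

noncomputable section

namespace FedMuon

/-! ### The scalar Newton-Schulz iteration and the exponent -/

/-- The Newton-Schulz polynomial, i.e. the effect of a Newton-Schulz step on a singular value. -/
def nsPoly (x : ℝ) : ℝ := 15 / 8 * x - 5 / 4 * x ^ 3 + 3 / 8 * x ^ 5

/-- The lower bound `1 - (1 - x) ^ (1.5 ^ T)` for `T` iterations of the Newton-Schulz polynomial. -/
def nsLower (T : ℕ) (x : ℝ) : ℝ := 1 - (1 - x) ^ ((3 / 2 : ℝ) ^ T)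

lemma one_sub_nsPoly (x : ℝ) : 1 - nsPoly x = (1 - x) ^ 3 * (8 + 9 * x + 3 * x ^ 2) / 8 := by
  unfold nsPoly; ring

lemma nsPoly_mem {x : ℝ} (h : x ∈ Set.Icc (0 : ℝ) 1) : nsPoly x ∈ Set.Icc (0 : ℝ) 1 := by
  obtain ⟨h0, h1⟩ := h
  constructor
  · unfold nsPoly
    have h2 : x ^ 2 ≤ 1 := by nlinarith
    have : 15 / 8 * x - 5 / 4 * x ^ 3 + 3 / 8 * x ^ 5
      = x * (3 * (1 - x ^ 2) ^ 2 + 4 * (1 - x ^ 2) + 8) / 8 := by ring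
    rw [this]
    have : 0 ≤ 1 - x ^ 2 := by linarith
    positivity
  · have := one_sub_nsPoly x
    have h3 : 0 ≤ 1 - x := by linarith
    have : 0 ≤ 1 - nsPoly x := by rw [this]; positivity
    linarith

/-- A Newton-Schulz step raises the defect `1 - x` at least to the power `3 / 2`. In terms of
`y = √(1 - x)`, the difference of the two sides is `y ^ 3 (1 - y)` times a polynomial that is
nonnegative on `[0, 1]`. -/
lemma one_sub_nsPoly_le {x : ℝ} (h : x ∈ Set.Icc (0 : ℝ) 1) :
    1 - nsPoly x ≤ (1 - x) ^ (3 / 2 : ℝ) := by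
  obtain ⟨h0, h1⟩ := h
  set y := √(1 - x) with hy
  have hy0 : 0 ≤ y := Real.sqrt_nonneg _
  have hyx : y ^ 2 = 1 - x := Real.sq_sqrt (by linarith)
  have hy1 : y ≤ 1 := by nlinarith
  have hr : (1 - x) ^ (3 / 2 : ℝ) = y ^ 3 := by
    rw [← hyx, ← Real.rpow_natCast, ← Real.rpow_mul hy0, ← Real.rpow_natCast]; norm_num
  have hx : x = 1 - y ^ 2 := by linarith
  rw [hr, one_sub_nsPoly, hx]
  have key : 0 ≤ 8 + 8 * y + 8 * y ^ 2 - 12 * y ^ 3 - 12 * y ^ 4 + 3 * y ^ 5 + 3 * y ^ 6 := by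
    have h2 : y ^ 2 ≤ 1 := by nlinarith
    have h3 : y ^ 3 ≤ y ^ 2 := pow_le_pow_of_le_one hy0 hy1 (by norm_num)
    have h4 : y ^ 4 ≤ y ^ 2 := pow_le_pow_of_le_one hy0 hy1 (by norm_num)
    have h31 : y ^ 3 ≤ y := by simpa using pow_le_pow_of_le_one hy0 hy1 (show 1 ≤ 3 by norm_num)
    have h41 : y ^ 4 ≤ y := by simpa using pow_le_pow_of_le_one hy0 hy1 (show 1 ≤ 4 by norm_num)
    have h5 : 0 ≤ y ^ 5 := by positivity
    have h6 : 0 ≤ y ^ 6 := by positivity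
    linarith
  have h3 : 0 ≤ y ^ 3 * (1 - y) := mul_nonneg (by positivity) (by linarith)
  nlinarith [mul_nonneg h3 key]

lemma nsLower_zero (x : ℝ) : nsLower 0 x = x := by simp [nsLower]

lemma nsLower_succ {x : ℝ} (h : x ≤ 1) (T : ℕ) :
    nsLower (T + 1) x = 1 - (1 - nsLower T x) ^ (3 / 2 : ℝ) := by
  unfold nsLower
  rw [sub_sub_cancel, ← Real.rpow_mul (by linarith), pow_succ]

/-- The iterates stay in `[0, 1]`, and dominate the closed form `nsLower`. -/
lemma nsPoly_iterate {x : ℝ} (h : x ∈ Set.Icc (0 : ℝ) 1) (T : ℕ) :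
    nsPoly^[T] x ∈ Set.Icc (0 : ℝ) 1 ∧ nsLower T x ≤ nsPoly^[T] x := by
  induction T with
  | zero => simpa [nsLower_zero] using h
  | succ T ih =>
    rw [Function.iterate_succ_apply', nsLower_succ h.2]
    refine ⟨nsPoly_mem ih.1, ?_⟩
    have h1 := one_sub_nsPoly_le ih.1
    have h2 : (1 - nsPoly^[T] x) ^ (3 / 2 : ℝ) ≤ (1 - nsLower T x) ^ (3 / 2 : ℝ) :=
      Real.rpow_le_rpow (by linarith [ih.1.2]) (by linarith [ih.2]) (by norm_num)
    linarith

lemma nsLower_mem_Ioo {x : ℝ} (h : x ∈ Set.Ioo (0 : ℝ) 1) (T : ℕ) :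
    nsLower T x ∈ Set.Ioo (0 : ℝ) 1 := by
  have h1 : 0 < 1 - x := by linarith [h.2]
  have h2 : (1 - x) ^ ((3 / 2 : ℝ) ^ T) < 1 :=
    Real.rpow_lt_one h1.le (by linarith [h.1]) (by positivity)
  have h3 : 0 < (1 - x) ^ ((3 / 2 : ℝ) ^ T) := Real.rpow_pos_of_pos h1 _
  constructor <;> unfold nsLower <;> linarith

lemma nsLower_strictMono {x : ℝ} (h : x ∈ Set.Ioo (0 : ℝ) 1) :
    StrictMono fun T => nsLower T x := by
  intro S T hST
  have : (1 - x) ^ ((3 / 2 : ℝ) ^ T) < (1 - x) ^ ((3 / 2 : ℝ) ^ S) :=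
    Real.rpow_lt_rpow_of_exponent_gt (by linarith [h.2]) (by linarith [h.1])
      (pow_lt_pow_right₀ (by norm_num) hST)
  simp only [nsLower]; linarith

lemma nsLower_tendsto {x : ℝ} (h : x ∈ Set.Ioo (0 : ℝ) 1) :
    Tendsto (fun T => nsLower T x) atTop (𝓝 1) := by
  have h1 : Tendsto (fun T : ℕ => (3 / 2 : ℝ) ^ T) atTop atTop :=
    tendsto_pow_atTop_atTop_of_one_lt (by norm_num)
  have h2 := (tendsto_rpow_atTop_of_base_lt_one (1 - x) (by linarith [h.2])
    (by linarith [h.1])).comp h1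
  simpa [nsLower] using h2.const_sub 1

lemma nsExponent_eq {κ : ℝ} (h : κ < 1) (T : ℕ) :
    nsExponent κ T = 1 + Real.log (nsLower T κ) / Real.log κ := by
  rw [nsExponent, if_neg h.ne]; rfl

lemma nsExponent_zero {κ : ℝ} (h0 : 0 < κ) (h1 : κ ≤ 1) : nsExponent κ 0 = 2 := by
  rcases h1.eq_or_lt with rfl | h1
  · simp [nsExponent]
  · rw [nsExponent_eq h1, nsLower_zero, div_self (Real.log_neg h0 h1).ne]; norm_num

lemma nsExponent_strictAnti {κ : ℝ} (h0 : 0 < κ) (h1 : κ < 1) : StrictAnti (nsExponent κ) := by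
  intro S T hST
  rw [nsExponent_eq h1, nsExponent_eq h1]
  have := Real.log_lt_log (nsLower_mem_Ioo ⟨h0, h1⟩ S).1 (nsLower_strictMono ⟨h0, h1⟩ hST)
  have := div_lt_div_of_neg_of_lt (Real.log_neg h0 h1) this
  linarith

lemma nsExponent_antitone {κ : ℝ} (h0 : 0 < κ) (h1 : κ ≤ 1) : Antitone (nsExponent κ) := by
  rcases h1.eq_or_lt with rfl | h1
  · refine antitone_nat_of_succ_le fun T => ?_
    rcases T with _ | T <;> simp [nsExponent]
  · exact (nsExponent_strictAnti h0 h1).antitone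

lemma nsExponent_tendsto {κ : ℝ} (h0 : 0 < κ) (h1 : κ ≤ 1) :
    Tendsto (nsExponent κ) atTop (𝓝 1) := by
  rcases h1.eq_or_lt with rfl | h1
  · refine tendsto_const_nhds.congr' ?_
    filter_upwards [eventually_ge_atTop 1] with T hT
    simp [nsExponent, Nat.one_le_iff_ne_zero.mp hT]
  · have h2 : Tendsto (fun T => Real.log (nsLower T κ)) atTop (𝓝 (Real.log 1)) :=
      (Real.continuousAt_log one_ne_zero).tendsto.comp (nsLower_tendsto ⟨h0, h1⟩)
    have := (h2.div_const (Real.log κ)).const_add 1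
    simp only [Real.log_one, zero_div, add_zero] at this
    exact this.congr fun T => (nsExponent_eq h1 T).symm

lemma nsExponent_mem {κ : ℝ} (h0 : 0 < κ) (h1 : κ ≤ 1) (T : ℕ) :
    nsExponent κ T ∈ Set.Icc (1 : ℝ) 2 :=
  ⟨(nsExponent_antitone h0 h1).le_of_tendsto (nsExponent_tendsto h0 h1) T,
    nsExponent_zero h0 h1 ▸ nsExponent_antitone h0 h1 (Nat.zero_le T)⟩

/-- The inequality `h (x ^ θ) ≤ h x ^ θ` for `h x = 1 - (1 - x) ^ (3 / 2)`. With `y = √(1 - x)`, the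
logarithmic derivative `x h' x / h x` is `3 / 2 * (1 - 1 / (1 + y + y ^ 2))`, which decreases in
`x`; so `θ log h x - log h (x ^ θ)` decreases to its value `0` at `x = 1`. -/
lemma one_sub_rpow_le {θ x : ℝ} (hθ : 1 ≤ θ) (hx : x ∈ Set.Ioo (0 : ℝ) 1) :
    1 - (1 - x ^ θ) ^ (3 / 2 : ℝ) ≤ (1 - (1 - x) ^ (3 / 2 : ℝ)) ^ θ := by
  set h : ℝ → ℝ := fun x => 1 - (1 - x) ^ (3 / 2 : ℝ) with hh
  have hpos : ∀ z, 0 < z → z ≤ 1 → 0 < h z := by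
    intro z hz hz1
    have : (1 - z) ^ (3 / 2 : ℝ) < 1 := Real.rpow_lt_one (by linarith) (by linarith) (by norm_num)
    simp only [hh]; linarith
  have hder : ∀ z, 0 < z → z < 1 → HasDerivAt h (3 / 2 * (1 - z) ^ (1 / 2 : ℝ)) z := by
    intro z hz hz1
    have h1 : HasDerivAt (fun z : ℝ => 1 - z) (-1) z := by
      simpa using (hasDerivAt_id z).const_sub 1
    have h2 := (h1.rpow_const (p := (3 / 2 : ℝ)) (Or.inl (by linarith))).const_sub 1
    exact h2.congr_deriv (by norm_num)
  -- the logarithmic derivative, in terms of `y = √(1 - z)`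
  set k : ℝ → ℝ := fun z => z * (3 / 2 * (1 - z) ^ (1 / 2 : ℝ)) / h z with hk
  have hkanti : ∀ z w, 0 < z → z ≤ w → w < 1 → k w ≤ k z := by
    have hform : ∀ z, 0 < z → z < 1 → k z = 3 / 2 * (1 - 1 / (1 + √(1 - z) + √(1 - z) ^ 2)) := by
      intro z hz hz1
      have hy0 : 0 ≤ √(1 - z) := Real.sqrt_nonneg _
      have hyz : √(1 - z) ^ 2 = 1 - z := Real.sq_sqrt (by linarith)
      have hy1 : √(1 - z) < 1 := by nlinarith
      have hhz := (hpos z hz hz1.le).ne'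
      have e1 : (1 - z) ^ (1 / 2 : ℝ) = √(1 - z) := (Real.sqrt_eq_rpow _).symm
      have e2 : (1 - z) ^ (3 / 2 : ℝ) = √(1 - z) ^ 3 := by
        rw [Real.sqrt_eq_rpow, ← Real.rpow_natCast, ← Real.rpow_mul (by linarith)]; norm_num
      have e3 : h z = 1 - √(1 - z) ^ 3 := by simp only [hh, e2]
      simp only [hk]
      rw [e3] at hhz ⊢
      rw [e1]
      generalize √(1 - z) = y at *
      have : z = 1 - y ^ 2 := by linarith
      subst this
      have : (1 + y + y ^ 2) ≠ 0 := by positivity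
      field_simp
      ring
    intro z w hz hzw hw
    rw [hform z hz (by linarith), hform w (by linarith) hw]
    have hle : √(1 - w) ≤ √(1 - z) := Real.sqrt_le_sqrt (by linarith)
    have hy0 : 0 ≤ √(1 - w) := Real.sqrt_nonneg _
    have : 1 / (1 + √(1 - z) + √(1 - z) ^ 2) ≤ 1 / (1 + √(1 - w) + √(1 - w) ^ 2) := by
      gcongr
    linarith
  have hθ0 : 0 < θ := by linarith
  have hhc : Continuous h := by
    have : Continuous fun z : ℝ => (1 - z) ^ (3 / 2 : ℝ) :=
      (continuous_const.sub continuous_id).rpow_const fun _ => Or.inr (by norm_num)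
    exact continuous_const.sub this
  have hpowmem : ∀ z : ℝ, 0 < z → z ≤ 1 → 0 < z ^ θ ∧ z ^ θ ≤ 1 := fun z hz hz1 =>
    ⟨Real.rpow_pos_of_pos hz _, Real.rpow_le_one hz.le hz1 hθ0.le⟩
  have hanti : AntitoneOn (fun z => θ * Real.log (h z) - Real.log (h (z ^ θ))) (Set.Icc x 1) := by
    apply antitoneOn_of_deriv_nonpos (convex_Icc _ _)
    · apply ContinuousOn.sub
      · refine continuousOn_const.mul (hhc.continuousOn.log fun z hz => ?_)
        exact (hpos z (hx.1.trans_le hz.1) hz.2).ne'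
      · have hc : Continuous fun z : ℝ => z ^ θ :=
          continuous_id.rpow_const fun _ => Or.inr hθ0.le
        refine ((hhc.comp hc).continuousOn.log fun z hz => ?_)
        have := hpowmem z (hx.1.trans_le hz.1) hz.2
        exact (hpos _ this.1 this.2).ne'
    all_goals
      intro z hz
      rw [interior_Icc] at hz
      have hz0 : 0 < z := hx.1.trans hz.1
      have hp := hpowmem z hz0 hz.2.le
      have hp1 : z ^ θ < 1 := Real.rpow_lt_one hz0.le hz.2 hθ0
      have d1 := ((hder z hz0 hz.2).log (hpos z hz0 hz.2.le).ne').const_mul θ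
      have d2 := (hder (z ^ θ) hp.1 hp1).comp z
        (Real.hasDerivAt_rpow_const (p := θ) (Or.inl hz0.ne'))
      have d3 := d1.sub (d2.log (hpos _ hp.1 hp.2).ne')
    · exact d3.differentiableAt.differentiableWithinAt
    · have e : θ * (3 / 2 * (1 - z) ^ (1 / 2 : ℝ) / h z) -
          3 / 2 * (1 - z ^ θ) ^ (1 / 2 : ℝ) * (θ * z ^ (θ - 1)) / h (z ^ θ)
          = θ / z * (k z - k (z ^ θ)) := by
        have hh1 := (hpos z hz0 hz.2.le).ne'
        have hh2 := (hpos _ hp.1 hp.2).ne'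
        simp only [hk]
        rw [Real.rpow_sub_one hz0.ne']
        field_simp
      rw [show deriv (fun z => θ * Real.log (h z) - Real.log (h (z ^ θ))) z = _ from d3.deriv]
      have hle : z ^ θ ≤ z := by
        simpa using Real.rpow_le_rpow_of_exponent_ge hz0 hz.2.le hθ
      have := hkanti (z ^ θ) z hp.1 hle hz.2
      refine le_of_eq_of_le e (mul_nonpos_of_nonneg_of_nonpos (by positivity) (by linarith))
  have h0 := hanti (Set.left_mem_Icc.mpr hx.2.le) (Set.right_mem_Icc.mpr hx.2.le) hx.2.le
  have h1 : h 1 = 1 := by simp [hh]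
  simp only [Real.one_rpow, h1, Real.log_one, mul_zero, sub_zero] at h0
  have hp := hpowmem x hx.1 hx.2.le
  have : Real.log (h (x ^ θ)) ≤ Real.log (h x ^ θ) := by
    rw [Real.log_rpow (hpos x hx.1 hx.2.le)]; linarith
  exact (Real.log_le_log_iff (hpos _ hp.1 hp.2)
    (Real.rpow_pos_of_pos (hpos x hx.1 hx.2.le) _)).mp this

/-- The map `nsLower (T + 1)` is `nsLower 1` after `nsLower T`, so that the inequality
`h (x ^ θ) ≤ h x ^ θ` passes from one step to `T` steps. -/
lemma nsLower_rpow_le {θ x : ℝ} (hθ : 1 ≤ θ) (hx : x ∈ Set.Ioo (0 : ℝ) 1) (T : ℕ) :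
    nsLower T (x ^ θ) ≤ nsLower T x ^ θ := by
  have hx' : x ^ θ ≤ 1 := Real.rpow_le_one hx.1.le hx.2.le (by linarith)
  induction T with
  | zero => simp [nsLower_zero]
  | succ T ih =>
    rw [nsLower_succ hx', nsLower_succ hx.2.le]
    refine le_trans ?_ (one_sub_rpow_le hθ (nsLower_mem_Ioo hx T))
    have hm := nsLower_mem_Ioo hx T
    have : nsLower T x ^ θ ≤ 1 := Real.rpow_le_one hm.1.le hm.2.le (by linarith)
    have := Real.rpow_le_rpow (z := (3 / 2 : ℝ)) (by linarith)
      (sub_le_sub_left ih 1) (by norm_num)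
    linarith

/-- On `[κ, 1]`, `T` Newton-Schulz iterations dominate the power with exponent `p (κ, T) - 1`. If
`κ < 1`, this exponent is the one for which the power at `x = κ` equals `nsLower T κ`; for
`x = κ ^ (1 / θ)` the inequality is `nsLower T (x ^ θ) ≤ nsLower T x ^ θ`. -/
lemma rpow_le_nsPoly_iterate {κ x : ℝ} (hκ : 0 < κ) (hx : κ ≤ x) (hx1 : x ≤ 1) (T : ℕ) :
    x ^ (nsExponent κ T - 1) ≤ nsPoly^[T] x := by
  have hx0 : 0 < x := hκ.trans_le hx
  refine le_trans ?_ (nsPoly_iterate ⟨hx0.le, hx1⟩ T).2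
  rcases hx1.eq_or_lt with rfl | hx1
  · have : ((3 / 2 : ℝ) ^ T) ≠ 0 := by positivity
    simp [nsLower, Real.zero_rpow this]
  have hκ1 : κ < 1 := hx.trans_lt hx1
  have hlx := Real.log_neg hx0 hx1
  have hlκ := Real.log_neg hκ hκ1
  -- `κ = x ^ θ` with `θ ≥ 1`
  set θ := Real.log κ / Real.log x with hθ
  have hθ1 : 1 ≤ θ := by
    rw [hθ, one_le_div_of_neg hlx]; exact Real.log_le_log hκ hx
  have hκθ : x ^ θ = κ := by
    rw [Real.rpow_def_of_pos hx0, hθ, mul_div_cancel₀ _ hlx.ne, Real.exp_log hκ]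
  have key := nsLower_rpow_le hθ1 ⟨hx0, hx1⟩ T
  rw [hκθ] at key
  have hm := nsLower_mem_Ioo ⟨hx0, hx1⟩ T
  have h1 := Real.log_le_log (nsLower_mem_Ioo ⟨hκ, hκ1⟩ T).1 key
  rw [Real.log_rpow hm.1] at h1
  rw [nsExponent_eq hκ1, add_sub_cancel_left,
    ← Real.log_le_log_iff (Real.rpow_pos_of_pos hx0 _) hm.1, Real.log_rpow hx0,
    div_mul_eq_mul_div, div_le_iff_of_neg hlκ]
  have e : θ * Real.log x = Real.log κ := by rw [hθ, div_mul_cancel₀ _ hlx.ne]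
  have := mul_le_mul_of_nonpos_right h1 hlx.le
  linear_combination this - Real.log (nsLower T x) * e

/-! ### Trace inner product and matrix norms -/

section MatrixNorms

variable {d₁ d₂ : ℕ}

lemma innerM_eq_trace (A B : Mat d₁ d₂) : innerM A B = (A * B.transpose).trace := by
  simp [innerM, Matrix.trace, Matrix.mul_apply]

lemma innerM_add_left (A B Y : Mat d₁ d₂) : innerM (A + B) Y = innerM A Y + innerM B Y := by
  simp [innerM_eq_trace, Matrix.add_mul]

lemma innerM_sub_left (A B Y : Mat d₁ d₂) : innerM (A - B) Y = innerM A Y - innerM B Y := by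
  simp [innerM_eq_trace, Matrix.sub_mul]

lemma innerM_smul_left (c : ℝ) (A Y : Mat d₁ d₂) : innerM (c • A) Y = c * innerM A Y := by
  simp [innerM_eq_trace]

lemma innerM_neg_left (A Y : Mat d₁ d₂) : innerM (-A) Y = -innerM A Y := by
  simp [innerM_eq_trace]

lemma innerM_comm (A B : Mat d₁ d₂) : innerM A B = innerM B A := by
  simp [innerM, mul_comm]

lemma innerM_neg_right (A Y : Mat d₁ d₂) : innerM A (-Y) = -innerM A Y := by
  simp [innerM_eq_trace]

lemma innerM_smul_right (c : ℝ) (A Y : Mat d₁ d₂) : innerM A (c • Y) = c * innerM A Y := by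
  simp [innerM_eq_trace]

lemma innerM_sum_right {ι : Type*} (s : Finset ι) (A : Mat d₁ d₂) (Y : ι → Mat d₁ d₂) :
    innerM A (∑ i ∈ s, Y i) = ∑ i ∈ s, innerM A (Y i) := by
  simp [innerM_eq_trace, Matrix.transpose_sum, Matrix.mul_sum]

lemma frobNorm_nonneg (A : Mat d₁ d₂) : 0 ≤ frobNorm A := Real.sqrt_nonneg _

lemma frobNorm_sq (A : Mat d₁ d₂) : frobNorm A ^ 2 = ∑ a, ∑ b, A a b ^ 2 :=
  Real.sq_sqrt (Finset.sum_nonneg fun _ _ => Finset.sum_nonneg fun _ _ => sq_nonneg _)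

lemma innerM_self (A : Mat d₁ d₂) : innerM A A = frobNorm A ^ 2 := by
  rw [frobNorm_sq]; simp [innerM, sq]

lemma frobNorm_transpose (A : Mat d₁ d₂) : frobNorm A.transpose = frobNorm A := by
  unfold frobNorm; rw [Finset.sum_comm]; rfl

section Frobenius

attribute [local instance] Matrix.frobeniusNormedAddCommGroup Matrix.frobeniusNormedSpace

lemma frobNorm_eq_norm (A : Mat d₁ d₂) : frobNorm A = ‖A‖ := by
  rw [Matrix.frobenius_norm_def, frobNorm, Real.sqrt_eq_rpow]; simp

lemma frobNorm_add_le (A B : Mat d₁ d₂) : frobNorm (A + B) ≤ frobNorm A + frobNorm B := by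
  simpa only [frobNorm_eq_norm] using norm_add_le A B

lemma frobNorm_smul (c : ℝ) (A : Mat d₁ d₂) : frobNorm (c • A) = |c| * frobNorm A := by
  simpa only [frobNorm_eq_norm, Real.norm_eq_abs] using norm_smul c A

lemma frobNorm_sum_le {ι : Type*} (s : Finset ι) (A : ι → Mat d₁ d₂) :
    frobNorm (∑ i ∈ s, A i) ≤ ∑ i ∈ s, frobNorm (A i) := by
  simpa only [frobNorm_eq_norm] using norm_sum_le s A

lemma frobNorm_eq_zero {A : Mat d₁ d₂} : frobNorm A = 0 ↔ A = 0 := by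
  rw [frobNorm_eq_norm, norm_eq_zero]

end Frobenius

lemma innerM_le (A B : Mat d₁ d₂) : innerM A B ≤ frobNorm A * frobNorm B := by
  simp only [innerM, frobNorm, ← Finset.sum_product']
  exact Real.sum_mul_le_sqrt_mul_sqrt _ _ _

section Spectral

open scoped Matrix.Norms.L2Operator

lemma spNorm_eq_norm (A : Mat d₁ d₂) : spNorm A = ‖A‖ := rfl

lemma spNorm_nonneg (A : Mat d₁ d₂) : 0 ≤ spNorm A := norm_nonneg _

lemma spNorm_zero : spNorm (0 : Mat d₁ d₂) = 0 := by simp [spNorm_eq_norm]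

lemma spNorm_add_le (A B : Mat d₁ d₂) : spNorm (A + B) ≤ spNorm A + spNorm B := norm_add_le A B

lemma spNorm_smul (c : ℝ) (A : Mat d₁ d₂) : spNorm (c • A) = |c| * spNorm A := norm_smul c A

lemma spNorm_neg (A : Mat d₁ d₂) : spNorm (-A) = spNorm A := norm_neg A

lemma spNorm_sum_le {ι : Type*} (s : Finset ι) (A : ι → Mat d₁ d₂) :
    spNorm (∑ i ∈ s, A i) ≤ ∑ i ∈ s, spNorm (A i) := norm_sum_le s A

lemma spNorm_transpose (A : Mat d₁ d₂) : spNorm A.transpose = spNorm A := by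
  rw [← Matrix.conjTranspose_eq_transpose_of_trivial]
  exact Matrix.l2_opNorm_conjTranspose A

lemma spNorm_mul_diagonal_mul_le {ι : Type*} [Fintype ι] [DecidableEq ι]
    {U : Matrix (Fin d₁) ι ℝ} {V : Matrix (Fin d₂) ι ℝ} (hU : U.transpose * U = 1)
    (hV : V.transpose * V = 1) {t : ι → ℝ} (ht : ∀ j, |t j| ≤ 1) :
    spNorm (U * Matrix.diagonal t * V.transpose) ≤ 1 := by
  have hone : ‖(1 : Matrix ι ι ℝ)‖ ≤ 1 := by
    rw [← Matrix.diagonal_one, Matrix.l2_opNorm_diagonal]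
    exact (pi_norm_le_iff_of_nonneg zero_le_one).mpr fun i => by simp
  have hle : ∀ {d : ℕ} {W : Matrix (Fin d) ι ℝ}, W.transpose * W = 1 → ‖W‖ ≤ 1 := by
    intro d W hW
    have := Matrix.l2_opNorm_conjTranspose_mul_self W
    rw [Matrix.conjTranspose_eq_transpose_of_trivial, hW] at this
    nlinarith [norm_nonneg W]
  have hD : ‖(Matrix.diagonal t : Matrix ι ι ℝ)‖ ≤ 1 := by
    rw [Matrix.l2_opNorm_diagonal]
    exact (pi_norm_le_iff_of_nonneg zero_le_one).mpr fun i => by simpa using ht i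
  have hVt : ‖V.transpose‖ ≤ 1 := by
    rw [← Matrix.conjTranspose_eq_transpose_of_trivial, Matrix.l2_opNorm_conjTranspose]
    exact hle hV
  rw [spNorm_eq_norm]
  calc ‖U * Matrix.diagonal t * V.transpose‖
      ≤ ‖U‖ * ‖(Matrix.diagonal t : Matrix ι ι ℝ)‖ * ‖V.transpose‖ :=
        (Matrix.l2_opNorm_mul _ _).trans
          (mul_le_mul_of_nonneg_right (Matrix.l2_opNorm_mul _ _) (norm_nonneg _))
    _ ≤ 1 * 1 * 1 := by gcongr; exact hle hU
    _ = 1 := by norm_num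

end Spectral

/-- Every column of `A` has Euclidean norm at most `spNorm A`. -/
lemma frobNorm_sq_le (A : Mat d₁ d₂) : frobNorm A ^ 2 ≤ d₂ * spNorm A ^ 2 := by
  have hcol : ∀ b, ∑ a, A a b ^ 2 ≤ spNorm A ^ 2 := by
    intro b
    have h := (LinearMap.toContinuousLinearMap (Matrix.toEuclideanLin A)).le_opNorm
      (EuclideanSpace.single b 1)
    have h2 : ‖(LinearMap.toContinuousLinearMap (Matrix.toEuclideanLin A))
      (EuclideanSpace.single b 1)‖ ^ 2 = ∑ a, A a b ^ 2 := by
      rw [EuclideanSpace.norm_sq_eq]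
      simp [Matrix.toLpLin_apply]
    rw [← h2]
    simp only [PiLp.norm_single, norm_one, mul_one] at h
    exact pow_le_pow_left₀ (norm_nonneg _) h 2
  rw [frobNorm_sq, Finset.sum_comm]
  calc ∑ b, ∑ a, A a b ^ 2 ≤ ∑ _b : Fin d₂, spNorm A ^ 2 := Finset.sum_le_sum fun b _ => hcol b
    _ = _ := by simp

lemma frobNorm_le_spNorm (A : Mat d₁ d₂) : frobNorm A ≤ √(min d₁ d₂ : ℕ) * spNorm A := by
  refine Real.le_sqrt_of_sq_le ?_ |>.trans_eq ?_ (b := √((min d₁ d₂ : ℕ) * spNorm A ^ 2))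
  · rcases le_total d₁ d₂ with h | h
    · rw [min_eq_left h, ← frobNorm_transpose, ← spNorm_transpose]
      exact frobNorm_sq_le _
    · rw [min_eq_right h]; exact frobNorm_sq_le _
  · rw [Real.sqrt_mul (by positivity), Real.sqrt_sq (spNorm_nonneg _)]

lemma innerM_le_of_spNorm_le_one (A : Mat d₁ d₂) {Y : Mat d₁ d₂} (hY : spNorm Y ≤ 1) :
    innerM A Y ≤ √(min d₁ d₂ : ℕ) * frobNorm A := by
  have h1 := innerM_le A Y
  have h2 := frobNorm_le_spNorm Y
  have h3 : frobNorm Y ≤ √(min d₁ d₂ : ℕ) :=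
    h2.trans (mul_le_of_le_one_right (Real.sqrt_nonneg _) hY)
  nlinarith [frobNorm_nonneg A]

lemma innerM_le_dualNorm (A : Mat d₁ d₂) {Y : Mat d₁ d₂} (hY : spNorm Y ≤ 1) :
    innerM A Y ≤ dualNorm A := by
  refine le_csSup ⟨√(min d₁ d₂ : ℕ) * frobNorm A, ?_⟩ ⟨Y, hY, rfl⟩
  rintro c ⟨Y, hY, rfl⟩
  exact innerM_le_of_spNorm_le_one A hY

lemma dualNorm_le {A : Mat d₁ d₂} {c : ℝ} (h : ∀ Y, spNorm Y ≤ 1 → innerM A Y ≤ c) :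
    dualNorm A ≤ c := by
  refine csSup_le ⟨_, 0, by simp [spNorm_zero], rfl⟩ ?_
  rintro _ ⟨Y, hY, rfl⟩
  exact h Y hY

lemma dualNorm_nonneg (A : Mat d₁ d₂) : 0 ≤ dualNorm A := by
  simpa [innerM] using innerM_le_dualNorm A (Y := 0) (by simp [spNorm_zero])

lemma dualNorm_le_frobNorm (A : Mat d₁ d₂) : dualNorm A ≤ √(min d₁ d₂ : ℕ) * frobNorm A :=
  dualNorm_le fun _ hY => innerM_le_of_spNorm_le_one A hY

lemma dualNorm_add_le (A B : Mat d₁ d₂) : dualNorm (A + B) ≤ dualNorm A + dualNorm B :=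
  dualNorm_le fun Y hY => by
    rw [innerM_add_left]; exact add_le_add (innerM_le_dualNorm A hY) (innerM_le_dualNorm B hY)

lemma dualNorm_neg (A : Mat d₁ d₂) : dualNorm (-A) = dualNorm A := by
  have h : ∀ B : Mat d₁ d₂, dualNorm (-B) ≤ dualNorm B := fun B => dualNorm_le fun Y hY => by
    rw [innerM_neg_left, ← innerM_neg_right]
    exact innerM_le_dualNorm B (by rwa [spNorm_neg])
  exact le_antisymm (h A) (by simpa using h (-A))

lemma dualNorm_sub_le (A B : Mat d₁ d₂) : dualNorm (A - B) ≤ dualNorm A + dualNorm B := by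
  rw [sub_eq_add_neg, ← dualNorm_neg B]; exact dualNorm_add_le _ _

lemma dualNorm_smul_le {c : ℝ} (hc : 0 ≤ c) (A : Mat d₁ d₂) :
    dualNorm (c • A) ≤ c * dualNorm A :=
  dualNorm_le fun Y hY => by
    rw [innerM_smul_left]; exact mul_le_mul_of_nonneg_left (innerM_le_dualNorm A hY) hc

lemma dualNorm_zero : dualNorm (0 : Mat d₁ d₂) = 0 :=
  le_antisymm (dualNorm_le fun Y _ => by simp [innerM]) (dualNorm_nonneg _)

lemma dualNorm_sum_le {ι : Type*} (s : Finset ι) (A : ι → Mat d₁ d₂) :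
    dualNorm (∑ i ∈ s, A i) ≤ ∑ i ∈ s, dualNorm (A i) :=
  Finset.le_sum_of_subadditive _ dualNorm_zero.le dualNorm_add_le _ _

lemma innerM_le_dualNorm_mul_spNorm (A Y : Mat d₁ d₂) : innerM A Y ≤ dualNorm A * spNorm Y := by
  rcases (spNorm_nonneg Y).eq_or_lt with h | h
  · have : frobNorm Y = 0 :=
      le_antisymm (by simpa [← h] using frobNorm_le_spNorm Y) (frobNorm_nonneg _)
    rw [frobNorm_eq_zero.mp this]
    simp [innerM, spNorm_zero]
  · have := innerM_le_dualNorm A (Y := (spNorm Y)⁻¹ • Y)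
      (by rw [spNorm_smul, abs_of_pos (inv_pos.mpr h), inv_mul_cancel₀ h.ne'])
    rw [innerM_smul_right] at this
    rwa [mul_comm (dualNorm A), ← inv_mul_le_iff₀ h]

lemma spNorm_le_of_average_le {n : ℕ} {A : Fin n → Mat d₁ d₂} {c : ℝ} (hc : 0 ≤ c)
    (h : ∀ i, spNorm (A i) ≤ c) : spNorm ((1 / (n : ℝ)) • ∑ i, A i) ≤ c := by
  rw [spNorm_smul, abs_of_nonneg (by positivity)]
  have h1 : spNorm (∑ i, A i) ≤ n * c :=
    (spNorm_sum_le _ _).trans ((Finset.sum_le_sum fun i _ => h i).trans (by simp))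
  rcases Nat.eq_zero_or_pos n with rfl | hn
  · simpa using hc
  · have : (0 : ℝ) < n := by exact_mod_cast hn
    rw [one_div, inv_mul_le_iff₀ this]; exact h1

lemma dualNorm_average_le {n : ℕ} {A : Fin n → Mat d₁ d₂} {c : ℝ} (hc : 0 ≤ c)
    (h : ∀ i, dualNorm (A i) ≤ c) : dualNorm ((1 / (n : ℝ)) • ∑ i, A i) ≤ c := by
  refine (dualNorm_smul_le (by positivity) _).trans ?_
  have h1 : dualNorm (∑ i, A i) ≤ n * c :=
    (dualNorm_sum_le _ _).trans ((Finset.sum_le_sum fun i _ => h i).trans (by simp))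
  rcases Nat.eq_zero_or_pos n with rfl | hn
  · simpa using hc
  · have : (0 : ℝ) < n := by exact_mod_cast hn
    rw [one_div, inv_mul_le_iff₀ this]; exact h1

end MatrixNorms

/-! ### Singular value decomposition -/

section SVD

variable {d₁ d₂ : ℕ}

/-- The index type of the nonzero singular values of `A`. -/
abbrev SVIdx (A : Mat d₁ d₂) : Type := {k // k ∈ (singVals A).support}

lemma singVals_pos (A : Mat d₁ d₂) (k : SVIdx A) : 0 < singVals A k :=
  lt_of_le_of_ne (LinearMap.singularValues_nonneg _ _) (Finsupp.mem_support_iff.mp k.2).symm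

lemma singVals_sum_eq (A : Mat d₁ d₂) (h : ℝ → ℝ) :
    ((singVals A).sum fun _ s => h s) = ∑ k : SVIdx A, h (singVals A k) :=
  (Finset.sum_coe_sort (singVals A).support fun k => h (singVals A k)).symm

/-- The thin singular value decomposition: the columns of `V` are eigenvectors of `Aᵀ A`, and
those of `U` are their normalized images under `A`. -/
theorem exists_svd (A : Mat d₁ d₂) :
    ∃ (U : Matrix (Fin d₁) (SVIdx A) ℝ) (V : Matrix (Fin d₂) (SVIdx A) ℝ),
      U.transpose * U = 1 ∧ V.transpose * V = 1 ∧
        A = U * Matrix.diagonal (fun k : SVIdx A => singVals A k) * V.transpose := by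
  set T := Matrix.toEuclideanLin A with hT
  have hn : Module.finrank ℝ (EuclideanSpace ℝ (Fin d₂)) = d₂ := by simp
  set v := T.isSymmetric_adjoint_comp_self.eigenvectorBasis hn with hv
  have hlt : ∀ k : SVIdx A, (k : ℕ) < d₂ := by
    intro k
    by_contra h
    exact (singVals_pos A k).ne' (T.singularValues_of_finrank_le (by rw [hn]; omega))
  have hinner : ∀ i j : Fin d₂, inner ℝ (T (v i)) (T (v j))
      = if i = j then singVals A i ^ 2 else 0 := by
    intro i j
    have e1 : (LinearMap.adjoint T ∘ₗ T) (v j) = (singVals A j ^ 2 : ℝ) • v j := by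
      rw [show singVals A j ^ 2 = _ from T.sq_singularValues_fin hn j]
      exact T.isSymmetric_adjoint_comp_self.apply_eigenvectorBasis hn j
    rw [← LinearMap.adjoint_inner_right, ← LinearMap.comp_apply, e1, inner_smul_right,
      orthonormal_iff_ite.mp v.orthonormal i j]
    split_ifs with h
    · rw [h, mul_one]
    · rw [mul_zero]
  have hzero : ∀ i : Fin d₂, singVals A i = 0 → T (v i) = 0 := by
    intro i hi
    have := hinner i i
    rwa [if_pos rfl, hi, zero_pow two_ne_zero, inner_self_eq_zero] at this
  let vv : SVIdx A → Fin d₂ := fun k => ⟨k, hlt k⟩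
  have hvv : ∀ i j, vv i = vv j ↔ i = j := by
    exact fun i j => ⟨fun h => Subtype.ext (congrArg Fin.val h), fun h => h ▸ rfl⟩
  refine ⟨Matrix.of fun a k => (singVals A k)⁻¹ * T (v (vv k)) a, Matrix.of fun b k => v (vv k) b,
    ?_, ?_, ?_⟩
  · ext i j
    have h := hinner (vv i) (vv j)
    rw [PiLp.inner_apply] at h
    simp only [RCLike.inner_apply, conj_trivial, hvv] at h
    have hi := (singVals_pos A i).ne'
    have : ∑ a, (singVals A i)⁻¹ * T (v (vv i)) a * ((singVals A j)⁻¹ * T (v (vv j)) a)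
        = (singVals A i)⁻¹ * (singVals A j)⁻¹ * ∑ a, T (v (vv j)) a * T (v (vv i)) a := by
      rw [Finset.mul_sum]; exact Finset.sum_congr rfl fun a _ => by ring
    simp only [Matrix.mul_apply, Matrix.transpose_apply, Matrix.of_apply, Matrix.one_apply]
    rw [this, h]
    split_ifs with hij
    · subst hij
      change (singVals A i)⁻¹ * (singVals A i)⁻¹ * singVals A i ^ 2 = 1
      field_simp
    · simp
  · ext i j
    have h := orthonormal_iff_ite.mp v.orthonormal (vv i) (vv j)
    rw [PiLp.inner_apply] at h
    simp only [RCLike.inner_apply, conj_trivial, hvv] at h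
    simp only [Matrix.mul_apply, Matrix.transpose_apply, Matrix.of_apply, Matrix.one_apply]
    rw [← h]
    exact Finset.sum_congr rfl fun a _ => mul_comm _ _
  · ext a b
    have h1 : A a b = T (EuclideanSpace.single b 1) a := by simp [hT, Matrix.toLpLin_apply]
    have h2 : T (EuclideanSpace.single b 1) = ∑ i, v i b • T (v i) := by
      conv_lhs => rw [← v.sum_repr' (EuclideanSpace.single b 1)]
      simp [map_sum, EuclideanSpace.inner_single_right]
    have h3 : A a b = ∑ i, v i b * T (v i) a := by
      rw [h1, h2]; simp
    have h4 : ∑ k : SVIdx A, v (vv k) b * T (v (vv k)) a = ∑ i, v i b * T (v i) a := by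
      refine Finset.sum_of_injOn vv (fun i _ j _ h => (hvv i j).mp h)
        (fun _ _ => Finset.mem_coe.mpr (Finset.mem_univ _)) ?_ (fun _ _ => rfl)
      intro i _ hi
      have : singVals A i = 0 := by
        by_contra h
        exact hi ⟨⟨i, Finsupp.mem_support_iff.mpr h⟩, by simp, rfl⟩
      rw [hzero i this]; simp
    rw [h3, ← h4]
    rw [Matrix.mul_apply]
    refine Finset.sum_congr rfl fun k _ => ?_
    rw [Matrix.mul_diagonal]
    simp only [Matrix.transpose_apply, Matrix.of_apply]
    have := (singVals_pos A k).ne'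
    field_simp

variable {ι κ : Type*} [Fintype ι] [DecidableEq ι] [Fintype κ] [DecidableEq κ]

lemma innerM_mul_diagonal_mul (U : Matrix (Fin d₁) ι ℝ) (V : Matrix (Fin d₂) ι ℝ) (s : ι → ℝ)
    (U' : Matrix (Fin d₁) κ ℝ) (V' : Matrix (Fin d₂) κ ℝ) (t : κ → ℝ) :
    innerM (U * Matrix.diagonal s * V.transpose) (U' * Matrix.diagonal t * V'.transpose)
      = ∑ j, ∑ k, s j * t k * ((U.transpose * U') j k * (V.transpose * V') j k) := by
  rw [innerM_eq_trace]
  simp only [Matrix.transpose_mul, Matrix.transpose_transpose, Matrix.diagonal_transpose]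
  have : (U * Matrix.diagonal s * V.transpose * (V' * (Matrix.diagonal t * U'.transpose))).trace
      = ((Matrix.diagonal s * (V.transpose * V') * Matrix.diagonal t)
        * (U'.transpose * U)).trace := by
    rw [Matrix.mul_assoc, Matrix.mul_assoc, Matrix.trace_mul_comm]
    simp only [Matrix.mul_assoc]
  rw [this, Matrix.trace]
  refine Finset.sum_congr rfl fun j _ => ?_
  rw [Matrix.diag_apply, Matrix.mul_apply]
  refine Finset.sum_congr rfl fun k _ => ?_
  have e : (U'.transpose * U) k j = (U.transpose * U') j k := by
    rw [← Matrix.transpose_apply (U'.transpose * U), Matrix.transpose_mul,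
      Matrix.transpose_transpose]
  rw [Matrix.mul_diagonal, Matrix.diagonal_mul, e]
  ring

omit [Fintype ι] in
/-- Bessel's inequality for the columns of a matrix. -/
lemma sum_sq_transpose_mul_le {d : ℕ} {U : Matrix (Fin d) ι ℝ} {U' : Matrix (Fin d) κ ℝ}
    (hU : U.transpose * U = 1) (hU' : U'.transpose * U' = 1) (j : ι) :
    ∑ k, (U.transpose * U') j k ^ 2 ≤ 1 := by
  set P := U.transpose * U' with hP
  have h : 0 ≤ ((U - U' * P.transpose).transpose * (U - U' * P.transpose)) j j := by
    rw [Matrix.mul_apply]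
    exact Finset.sum_nonneg fun a _ => by rw [Matrix.transpose_apply]; exact mul_self_nonneg _
  have e : (U - U' * P.transpose).transpose * (U - U' * P.transpose) = 1 - P * P.transpose := by
    have hPt : P.transpose = U'.transpose * U := by rw [hP]; simp
    clear_value P
    rw [Matrix.transpose_sub, Matrix.sub_mul, Matrix.mul_sub, Matrix.mul_sub, hU,
      Matrix.transpose_mul, Matrix.transpose_transpose]
    have e1 : U.transpose * (U' * P.transpose) = P * P.transpose := by rw [← Matrix.mul_assoc, ← hP]
    have e2 : P * U'.transpose * U = P * P.transpose := by rw [Matrix.mul_assoc, ← hPt]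
    have e3 : P * U'.transpose * (U' * P.transpose) = P * P.transpose := by
      rw [Matrix.mul_assoc, ← Matrix.mul_assoc U'.transpose, hU', Matrix.one_mul]
    rw [e1, e2, e3]; abel
  rw [e, Matrix.sub_apply, Matrix.one_apply_eq, Matrix.mul_apply] at h
  simp only [Matrix.transpose_apply] at h
  have : ∑ k, P j k ^ 2 = ∑ k, P j k * P j k := Finset.sum_congr rfl fun k _ => sq _
  linarith

omit [Fintype ι] in
/-- The products of the overlaps of the left and of the right singular vectors of two matrices have
absolute row sums at most `1`. -/
lemma sum_abs_mul_le {U : Matrix (Fin d₁) ι ℝ} {V : Matrix (Fin d₂) ι ℝ}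
    {U' : Matrix (Fin d₁) κ ℝ} {V' : Matrix (Fin d₂) κ ℝ}
    (hU : U.transpose * U = 1) (hV : V.transpose * V = 1)
    (hU' : U'.transpose * U' = 1) (hV' : V'.transpose * V' = 1) (j : ι) :
    ∑ k, |(U.transpose * U') j k * (V.transpose * V') j k| ≤ 1 := by
  have h1 := sum_sq_transpose_mul_le hU hU' j
  have h2 := sum_sq_transpose_mul_le hV hV' j
  calc ∑ k, |(U.transpose * U') j k * (V.transpose * V') j k|
      ≤ ∑ k, (((U.transpose * U') j k) ^ 2 + ((V.transpose * V') j k) ^ 2) / 2 := by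
        refine Finset.sum_le_sum fun k _ => ?_
        rw [abs_mul]
        nlinarith [sq_nonneg (|(U.transpose * U') j k| - |(V.transpose * V') j k|),
          sq_abs ((U.transpose * U') j k), sq_abs ((V.transpose * V') j k)]
    _ ≤ 1 := by
        rw [← Finset.sum_div, Finset.sum_add_distrib]; linarith

end SVD

/-! ### Newton-Schulz as an inexact linear minimization oracle -/

section Schatten

variable {d₁ d₂ : ℕ}

lemma schattenNorm_eq (p : ℝ) (A : Mat d₁ d₂) :
    schattenNorm p A = (∑ k : SVIdx A, singVals A k ^ p) ^ (1 / p) := by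
  rw [schattenNorm, singVals_sum_eq]

lemma schattenNorm_nonneg (p : ℝ) (A : Mat d₁ d₂) : 0 ≤ schattenNorm p A := by
  rw [schattenNorm_eq]
  exact Real.rpow_nonneg (Finset.sum_nonneg fun k _ => Real.rpow_nonneg (singVals_pos A k).le _) _

lemma schattenNorm_zero {p : ℝ} (hp : 1 ≤ p) : schattenNorm p (0 : Mat d₁ d₂) = 0 := by
  have h : singVals (0 : Mat d₁ d₂) = 0 := by
    rw [singVals, map_zero]; exact LinearMap.singularValues_zero
  rw [schattenNorm, h, Finsupp.sum_zero_index, Real.zero_rpow (by positivity)]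

lemma innerM_mul_diagonal_mul_self {ι : Type*} [Fintype ι] [DecidableEq ι]
    {U : Matrix (Fin d₁) ι ℝ} {V : Matrix (Fin d₂) ι ℝ} (hU : U.transpose * U = 1)
    (hV : V.transpose * V = 1) (s t : ι → ℝ) :
    innerM (U * Matrix.diagonal s * V.transpose) (U * Matrix.diagonal t * V.transpose)
      = ∑ j, s j * t j := by
  rw [innerM_mul_diagonal_mul, hU, hV]
  refine Finset.sum_congr rfl fun j _ => ?_
  rw [Finset.sum_eq_single j]
  · simp
  · intro k _ hk; simp [Matrix.one_apply_ne hk.symm]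
  · simp

lemma sum_rpow_pos {ι : Type*} [Fintype ι] [Nonempty ι] {a : ι → ℝ} (ha : ∀ k, 0 < a k)
    (p : ℝ) : 0 < ∑ k, a k ^ p :=
  Finset.sum_pos (fun k _ => Real.rpow_pos_of_pos (ha k) p) Finset.univ_nonempty

/-- Hölder's inequality for the pairing of `G` with the matrix that norms `A`: it follows from the
weighted inequality between the arithmetic and the geometric mean, because the absolute values of
the products of the overlaps between the singular vectors of `A` and `G` form a doubly
substochastic matrix. -/
lemma innerM_le_schattenNorm {p : ℝ} (hp : 1 ≤ p) {A G : Mat d₁ d₂} [Nonempty (SVIdx A)]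
    {U : Matrix (Fin d₁) (SVIdx A) ℝ} {V : Matrix (Fin d₂) (SVIdx A) ℝ}
    (hU : U.transpose * U = 1) (hV : V.transpose * V = 1) :
    innerM G (U * Matrix.diagonal (fun k : SVIdx A => (singVals A k / schattenNorm p A) ^ (p - 1))
      * V.transpose) ≤ schattenNorm p G := by
  obtain ⟨U', V', hU', hV', hG⟩ := exists_svd G
  set a : SVIdx A → ℝ := fun k => singVals A k / schattenNorm p A with ha
  rcases isEmpty_or_nonempty (SVIdx G) with hemp | hne
  · have : G = 0 := by
      rw [hG]; ext i j; simp [Matrix.mul_apply]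
    rw [this, schattenNorm_zero hp]
    simp [innerM]
  have hnorm : ∀ (B : Mat d₁ d₂) [Nonempty (SVIdx B)], 0 < schattenNorm p B ∧
      ∑ k : SVIdx B, (singVals B k / schattenNorm p B) ^ p = 1 := by
    intro B _
    have hS := sum_rpow_pos (fun k : SVIdx B => singVals_pos B k) p
    have h1 : 0 < schattenNorm p B := by rw [schattenNorm_eq]; exact Real.rpow_pos_of_pos hS _
    refine ⟨h1, ?_⟩
    have h2 : schattenNorm p B ^ p = ∑ k : SVIdx B, singVals B k ^ p := by
      rw [schattenNorm_eq, ← Real.rpow_mul hS.le, one_div_mul_cancel (by positivity), Real.rpow_one]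
    rw [Finset.sum_congr rfl fun k _ => Real.div_rpow (singVals_pos B k).le h1.le p,
      ← Finset.sum_div, h2, div_self hS.ne']
  obtain ⟨hA0, hA1⟩ := hnorm A
  obtain ⟨hG0, hG1⟩ := hnorm G
  set g : SVIdx G → ℝ := fun k => singVals G k / schattenNorm p G with hg
  have hgpos : ∀ k, 0 < g k := fun k => div_pos (singVals_pos G k) hG0
  have hapos : ∀ k, 0 < a k := fun k => div_pos (singVals_pos A k) hA0
  set W : SVIdx G → SVIdx A → ℝ := fun j k =>
    (U'.transpose * U) j k * (V'.transpose * V) j k with hW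
  have hrow : ∀ j, ∑ k, |W j k| ≤ 1 := sum_abs_mul_le hU' hV' hU hV
  have hcol : ∀ k, ∑ j, |W j k| ≤ 1 := by
    intro k
    refine le_of_eq_of_le (Finset.sum_congr rfl fun j _ => ?_) (sum_abs_mul_le hU hV hU' hV' k)
    have e1 : (U.transpose * U') k j = (U'.transpose * U) j k := by
      simp only [Matrix.mul_apply, Matrix.transpose_apply, mul_comm]
    have e2 : (V.transpose * V') k j = (V'.transpose * V) j k := by
      simp only [Matrix.mul_apply, Matrix.transpose_apply, mul_comm]
    rw [e1, e2]
  have hyoung : ∀ j k, g j * a k ^ (p - 1) ≤ 1 / p * g j ^ p + (1 - 1 / p) * a k ^ p := by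
    intro j k
    have hp0 : 0 < p := by linarith
    have hp1 : 1 / p ≤ 1 := by rw [div_le_one hp0]; exact hp
    have := Real.geom_mean_le_arith_mean2_weighted (w₁ := 1 / p) (w₂ := 1 - 1 / p)
      (by positivity) (by linarith) (Real.rpow_nonneg (hgpos j).le p)
      (Real.rpow_nonneg (hapos k).le p) (by ring)
    rwa [← Real.rpow_mul (hgpos j).le, ← Real.rpow_mul (hapos k).le, mul_one_div_cancel hp0.ne',
      Real.rpow_one, mul_sub, mul_one_div_cancel hp0.ne', mul_one] at this
  have hp1 : 1 / p ≤ 1 := by rw [div_le_one (by linarith)]; exact hp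
  have hp0 : 0 ≤ 1 / p := by positivity
  have hsum : ∑ j, ∑ k, g j * a k ^ (p - 1) * W j k ≤ 1 := by
    calc ∑ j, ∑ k, g j * a k ^ (p - 1) * W j k
        ≤ ∑ j, ∑ k, (1 / p * g j ^ p * |W j k| + (1 - 1 / p) * a k ^ p * |W j k|) := by
          refine Finset.sum_le_sum fun j _ => Finset.sum_le_sum fun k _ => ?_
          rw [← add_mul]
          calc g j * a k ^ (p - 1) * W j k ≤ g j * a k ^ (p - 1) * |W j k| := by
                have : 0 ≤ g j * a k ^ (p - 1) :=
                  mul_nonneg (hgpos j).le (Real.rpow_nonneg (hapos k).le _)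
                exact mul_le_mul_of_nonneg_left (le_abs_self _) this
            _ ≤ _ := mul_le_mul_of_nonneg_right (hyoung j k) (abs_nonneg _)
      _ = (∑ j, 1 / p * g j ^ p * ∑ k, |W j k|) + ∑ k, (1 - 1 / p) * a k ^ p * ∑ j, |W j k| := by
          simp only [Finset.sum_add_distrib, Finset.mul_sum]
          congr 1
          exact Finset.sum_comm
      _ ≤ (∑ j, 1 / p * g j ^ p) + ∑ k, (1 - 1 / p) * a k ^ p := by
          refine add_le_add (Finset.sum_le_sum fun j _ => ?_) (Finset.sum_le_sum fun k _ => ?_)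
          · exact mul_le_of_le_one_right
              (mul_nonneg hp0 (Real.rpow_nonneg (hgpos j).le _)) (hrow j)
          · exact mul_le_of_le_one_right
              (mul_nonneg (by linarith) (Real.rpow_nonneg (hapos k).le _)) (hcol k)
      _ = 1 := by rw [← Finset.mul_sum, ← Finset.mul_sum, hA1, hG1]; ring
  conv_lhs => rw [hG]
  rw [innerM_mul_diagonal_mul]
  have : ∑ j : SVIdx G, ∑ k : SVIdx A, singVals G j * a k ^ (p - 1) * W j k
      = schattenNorm p G * ∑ j, ∑ k, g j * a k ^ (p - 1) * W j k := by
    simp only [Finset.mul_sum]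
    refine Finset.sum_congr rfl fun j _ => Finset.sum_congr rfl fun k _ => ?_
    have : singVals G j = schattenNorm p G * g j := by rw [hg]; field_simp
    rw [this]; ring
  exact this.trans_le (mul_le_of_le_one_right hG0.le hsum)

/-- The Schatten norm is Lipschitz for the dual of the spectral norm: the matrix `Y` that norms `A`,
with the singular values `(sⱼ / ‖A‖ₚ) ^ (p - 1)`, lies in the unit ball of the spectral norm. -/
lemma schattenNorm_le_add_dualNorm {p : ℝ} (hp : 1 ≤ p) (A G : Mat d₁ d₂) :
    schattenNorm p A ≤ schattenNorm p G + dualNorm (A - G) := by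
  rcases isEmpty_or_nonempty (SVIdx A) with hemp | hne
  · have : schattenNorm p A = 0 := by
      rw [schattenNorm_eq, Finset.univ_eq_empty, Finset.sum_empty, Real.zero_rpow (by positivity)]
    rw [this]
    exact add_nonneg (schattenNorm_nonneg _ _) (dualNorm_nonneg _)
  obtain ⟨U, V, hU, hV, hA⟩ := exists_svd A
  have h1 := innerM_le_schattenNorm (G := G) hp hU hV
  set S := ∑ k : SVIdx A, singVals A k ^ p with hSdef
  have hS : 0 < S := sum_rpow_pos (fun k : SVIdx A => singVals_pos A k) p
  set N := schattenNorm p A with hN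
  have hNS : N = S ^ (1 / p) := schattenNorm_eq p A
  have hN0 : 0 < N := by rw [hNS]; exact Real.rpow_pos_of_pos hS _
  have hp0 : 0 < p := by linarith
  have hNp : N ^ p = S := by
    rw [hNS, ← Real.rpow_mul hS.le, one_div_mul_cancel hp0.ne', Real.rpow_one]
  set Y := U * Matrix.diagonal (fun k : SVIdx A => (singVals A k / N) ^ (p - 1)) * V.transpose
    with hY
  have hle : ∀ k : SVIdx A, singVals A k ≤ N := by
    intro k
    rw [← Real.rpow_le_rpow_iff (singVals_pos A k).le hN0.le hp0, hNp]
    exact Finset.single_le_sum (f := fun k : SVIdx A => singVals A k ^ p)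
      (fun j _ => Real.rpow_nonneg (singVals_pos A j).le _) (Finset.mem_univ k)
  have hYsp : spNorm Y ≤ 1 := by
    refine spNorm_mul_diagonal_mul_le hU hV fun k => ?_
    have h0 : 0 ≤ singVals A k / N := (div_pos (singVals_pos A k) hN0).le
    rw [abs_of_nonneg (Real.rpow_nonneg h0 _)]
    exact Real.rpow_le_one h0 ((div_le_one hN0).mpr (hle k)) (by linarith)
  have h2 : innerM A Y = N := by
    conv_lhs => rw [hA]
    rw [hY, innerM_mul_diagonal_mul_self hU hV]
    have : ∀ k : SVIdx A, singVals A k * (singVals A k / N) ^ (p - 1)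
        = singVals A k ^ p / N ^ (p - 1) := by
      intro k
      rw [Real.div_rpow (singVals_pos A k).le hN0.le, Real.rpow_sub_one (singVals_pos A k).ne']
      have := (singVals_pos A k).ne'
      field_simp
    rw [Finset.sum_congr rfl fun k _ => this k, ← Finset.sum_div, ← hSdef, ← hNp,
      Real.rpow_sub_one hN0.ne']
    have := (Real.rpow_pos_of_pos hN0 p).ne'
    field_simp
  have h3 := innerM_le_dualNorm (A - G) hYsp
  rw [innerM_sub_left, h2] at h3
  linarith

end Schatten

section NewtonSchulz

variable {d₁ d₂ : ℕ} {ι : Type*} [Fintype ι] [DecidableEq ι]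

lemma nsStep_mul_diagonal_mul {U : Matrix (Fin d₁) ι ℝ} {V : Matrix (Fin d₂) ι ℝ}
    (hU : U.transpose * U = 1) (hV : V.transpose * V = 1) (s : ι → ℝ) :
    nsStep (15 / 8) (-5 / 4) (3 / 8) (U * Matrix.diagonal s * V.transpose)
      = U * Matrix.diagonal (fun j => nsPoly (s j)) * V.transpose := by
  set D := Matrix.diagonal s with hD
  set G := U * D * V.transpose with hG
  have hGt : G.transpose = V * D * U.transpose := by
    simp [hG, hD, Matrix.mul_assoc]
  have h1 : G * G.transpose = U * (D * D) * U.transpose := by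
    rw [hGt, hG]
    calc U * D * V.transpose * (V * D * U.transpose)
        = U * D * (V.transpose * V) * D * U.transpose := by simp only [Matrix.mul_assoc]
      _ = _ := by rw [hV]; simp only [Matrix.mul_one, Matrix.mul_assoc]
  have hmul : ∀ E : Matrix ι ι ℝ, U * (D * D) * U.transpose * (U * E * V.transpose)
      = U * (D * D * E) * V.transpose := by
    intro E
    calc U * (D * D) * U.transpose * (U * E * V.transpose)
        = U * (D * D) * (U.transpose * U) * E * V.transpose := by simp only [Matrix.mul_assoc]
      _ = _ := by rw [hU]; simp only [Matrix.mul_one, Matrix.mul_assoc]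
  have h3 : G * G.transpose * G = U * (D * D * D) * V.transpose := by rw [h1]; exact hmul D
  have h5 : (G * G.transpose) ^ 2 * G = U * (D * D * (D * D * D)) * V.transpose := by
    rw [pow_two, Matrix.mul_assoc, h3, h1, hmul]
  rw [nsStep, h3, h5, hG, hD]
  have : Matrix.diagonal (fun j => nsPoly (s j)) = (15 / 8 : ℝ) • Matrix.diagonal s
      + (-5 / 4 : ℝ) • (Matrix.diagonal s * Matrix.diagonal s * Matrix.diagonal s)
      + (3 / 8 : ℝ) • (Matrix.diagonal s * Matrix.diagonal s *
        (Matrix.diagonal s * Matrix.diagonal s * Matrix.diagonal s)) := by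
    simp only [Matrix.diagonal_mul_diagonal, ← Matrix.diagonal_smul, Matrix.diagonal_add]
    congr 1
    ext j
    simp only [nsPoly, Pi.smul_apply, smul_eq_mul]
    ring
  rw [this]
  simp only [Matrix.mul_add, Matrix.add_mul, Matrix.mul_smul, Matrix.smul_mul]

lemma nsStep_iterate {U : Matrix (Fin d₁) ι ℝ} {V : Matrix (Fin d₂) ι ℝ}
    (hU : U.transpose * U = 1) (hV : V.transpose * V = 1) (s : ι → ℝ) (T : ℕ) :
    (nsStep (15 / 8) (-5 / 4) (3 / 8))^[T] (U * Matrix.diagonal s * V.transpose)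
      = U * Matrix.diagonal (fun j => nsPoly^[T] (s j)) * V.transpose := by
  induction T with
  | zero => rfl
  | succ T ih =>
    rw [Function.iterate_succ_apply', ih, nsStep_mul_diagonal_mul hU hV]
    simp only [Function.iterate_succ_apply']

lemma frobNorm_eq_sqrt_singVals (G : Mat d₁ d₂) :
    frobNorm G = √((singVals G).sum fun _ s => s ^ 2) := by
  obtain ⟨U, V, hU, hV, hG⟩ := exists_svd G
  rw [singVals_sum_eq G (fun s => s ^ 2), ← Real.sqrt_sq (frobNorm_nonneg G), ← innerM_self]
  conv_lhs => rw [hG]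
  rw [innerM_mul_diagonal_mul_self hU hV]
  simp only [sq]

lemma singVals_le_frobNorm (G : Mat d₁ d₂) (k : SVIdx G) : singVals G k ≤ frobNorm G := by
  rw [frobNorm_eq_sqrt_singVals, singVals_sum_eq G (fun s => s ^ 2)]
  refine Real.le_sqrt_of_sq_le ?_
  exact Finset.single_le_sum (f := fun k : SVIdx G => singVals G k ^ 2)
    (fun _ _ => sq_nonneg _) (Finset.mem_univ k)

lemma nsOutput_eq {G : Mat d₁ d₂} {U : Matrix (Fin d₁) (SVIdx G) ℝ}
    {V : Matrix (Fin d₂) (SVIdx G) ℝ} (hU : U.transpose * U = 1) (hV : V.transpose * V = 1)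
    (hG : G = U * Matrix.diagonal (fun k : SVIdx G => singVals G k) * V.transpose) (T : ℕ) :
    nsOutput (15 / 8) (-5 / 4) (3 / 8) T G
      = -(U * Matrix.diagonal (fun k : SVIdx G => nsPoly^[T] (singVals G k / frobNorm G))
        * V.transpose) := by
  have : (frobNorm G)⁻¹ • G
      = U * Matrix.diagonal (fun k : SVIdx G => singVals G k / frobNorm G) * V.transpose := by
    refine (congrArg ((frobNorm G)⁻¹ • ·) hG).trans ?_
    rw [← Matrix.smul_mul, ← Matrix.mul_smul, ← Matrix.diagonal_smul]
    congr 3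
    ext k
    simp [div_eq_inv_mul]
  rw [nsOutput, this, nsStep_iterate hU hV]

lemma singVals_div_mem (G : Mat d₁ d₂) (k : SVIdx G) :
    singVals G k / frobNorm G ∈ Set.Icc (0 : ℝ) 1 :=
  ⟨div_nonneg (singVals_pos G k).le (frobNorm_nonneg G),
    div_le_one_of_le₀ (singVals_le_frobNorm G k) (frobNorm_nonneg G)⟩

lemma spNorm_nsOutput_le (T : ℕ) (G : Mat d₁ d₂) :
    spNorm (nsOutput (15 / 8) (-5 / 4) (3 / 8) T G) ≤ 1 := by
  obtain ⟨U, V, hU, hV, hG⟩ := exists_svd G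
  rw [nsOutput_eq hU hV hG, spNorm_neg]
  refine spNorm_mul_diagonal_mul_le hU hV fun k => ?_
  have := (nsPoly_iterate (singVals_div_mem G k) T).1
  rw [abs_of_nonneg this.1]
  exact this.2

/-- Newton-Schulz is an inexact linear minimization oracle for the spectral norm ball: the decrease
is at least the Schatten `p`-norm, instead of the dual norm for an exact oracle. The output
dominates the power `p - 1` of the singular values of `G / ‖G‖_F`, and `‖G‖_F ≤ ‖G‖ₚ` as `p ≤ 2`. -/
lemma innerM_nsOutput_le {κ : ℝ} (hκ : 0 < κ) (hκ1 : κ ≤ 1) (T : ℕ) {G : Mat d₁ d₂}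
    (hG : ∀ k : SVIdx G, κ ≤ singVals G k / frobNorm G) :
    innerM G (nsOutput (15 / 8) (-5 / 4) (3 / 8) T G) ≤ -schattenNorm (nsExponent κ T) G := by
  obtain ⟨U, V, hU, hV, hGUV⟩ := exists_svd G
  set p := nsExponent κ T with hp
  obtain ⟨hp1, hp2⟩ : 1 ≤ p ∧ p ≤ 2 := nsExponent_mem hκ hκ1 T
  rw [nsOutput_eq hU hV hGUV, innerM_neg_right, neg_le_neg_iff]
  refine le_of_le_of_eq ?_ ((innerM_mul_diagonal_mul_self hU hV _ _).symm.trans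
    (congrArg (innerM · _) hGUV.symm))
  rcases isEmpty_or_nonempty (SVIdx G) with hemp | hne
  · rw [schattenNorm_eq, Finset.univ_eq_empty, Finset.sum_empty, Finset.sum_empty,
      Real.zero_rpow (by positivity)]
  set S := ∑ k : SVIdx G, singVals G k ^ p with hSdef
  have hS : 0 < S := sum_rpow_pos (fun k : SVIdx G => singVals_pos G k) p
  set N := schattenNorm p G with hN
  have hNS : N = S ^ (1 / p) := schattenNorm_eq p G
  have hN0 : 0 < N := by rw [hNS]; exact Real.rpow_pos_of_pos hS _
  have hp0 : 0 < p := by linarith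
  have hNp : N ^ p = S := by
    rw [hNS, ← Real.rpow_mul hS.le, one_div_mul_cancel hp0.ne', Real.rpow_one]
  have hle : ∀ k : SVIdx G, singVals G k ≤ N := by
    intro k
    rw [← Real.rpow_le_rpow_iff (singVals_pos G k).le hN0.le hp0, hNp]
    exact Finset.single_le_sum (f := fun k : SVIdx G => singVals G k ^ p)
      (fun j _ => Real.rpow_nonneg (singVals_pos G j).le _) (Finset.mem_univ k)
  have hF0 : 0 < frobNorm G := by
    obtain ⟨k⟩ := hne
    exact (singVals_pos G k).trans_le (singVals_le_frobNorm G k)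
  -- the comparison of the `ℓ²`-norm of the singular values with their `ℓᵖ`-norm, for `p ≤ 2`
  have hFN : frobNorm G ≤ N := by
    rw [frobNorm_eq_sqrt_singVals, singVals_sum_eq G (fun s => s ^ 2)]
    refine (Real.sqrt_le_left hN0.le).mpr ?_
    calc ∑ k : SVIdx G, singVals G k ^ 2 ≤ ∑ k : SVIdx G, singVals G k ^ p * N ^ (2 - p) := by
          refine Finset.sum_le_sum fun k _ => ?_
          have hk := singVals_pos G k
          have : singVals G k ^ 2 = singVals G k ^ p * singVals G k ^ (2 - p) := by
            rw [← Real.rpow_add hk, ← Real.rpow_natCast]; norm_num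
          rw [this]
          exact mul_le_mul_of_nonneg_left (Real.rpow_le_rpow hk.le (hle k) (by linarith))
            (Real.rpow_nonneg hk.le _)
      _ = N ^ 2 := by
          rw [← Finset.sum_mul, ← hSdef, ← hNp, ← Real.rpow_add hN0, ← Real.rpow_natCast]; norm_num
  calc N = S / N ^ (p - 1) := by
        rw [← hNp, Real.rpow_sub_one hN0.ne']
        have := (Real.rpow_pos_of_pos hN0 p).ne'
        field_simp
    _ ≤ S / frobNorm G ^ (p - 1) := by
        refine div_le_div_of_nonneg_left hS.le (Real.rpow_pos_of_pos hF0 _) ?_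
        exact Real.rpow_le_rpow hF0.le hFN (by linarith)
    _ = ∑ k : SVIdx G, singVals G k * (singVals G k / frobNorm G) ^ (p - 1) := by
        rw [hSdef, Finset.sum_div]
        refine Finset.sum_congr rfl fun k _ => ?_
        have hk := singVals_pos G k
        rw [Real.div_rpow hk.le hF0.le, Real.rpow_sub_one hk.ne']
        have := hk.ne'
        field_simp
    _ ≤ _ := by
        refine Finset.sum_le_sum fun k _ => mul_le_mul_of_nonneg_left ?_ (singVals_pos G k).le
        exact rpow_le_nsPoly_iterate hκ (hG k) (singVals_div_mem G k).2 T

/-- The decrease of a linear function with gradient `A` along the output for another input `G`. -/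
lemma innerM_nsOutput_le_add {κ : ℝ} (hκ : 0 < κ) (hκ1 : κ ≤ 1) (T : ℕ) {G : Mat d₁ d₂}
    (hG : ∀ k : SVIdx G, κ ≤ singVals G k / frobNorm G) (A : Mat d₁ d₂) :
    innerM A (nsOutput (15 / 8) (-5 / 4) (3 / 8) T G)
      ≤ -schattenNorm (nsExponent κ T) A + 2 * dualNorm (A - G) := by
  have h1 := innerM_nsOutput_le hκ hκ1 T hG
  have h2 := innerM_le_dualNorm (A - G) (spNorm_nsOutput_le T G)
  have h3 := schattenNorm_le_add_dualNorm (nsExponent_mem hκ hκ1 T).1 A G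
  rw [innerM_sub_left] at h2
  linarith

end NewtonSchulz

section Kappa

variable {n d₁ d₂ : ℕ}

lemma svRatios_finite (R K : ℕ) (G : Fin n → ℕ → ℕ → Mat d₁ d₂) : (svRatios R K G).Finite := by
  have : svRatios R K G ⊆ ⋃ i : Fin n, ⋃ r ∈ Finset.range R, ⋃ k ∈ Finset.range K,
      (fun j => singVals (G i r k) j / √((singVals (G i r k)).sum fun _ s => s ^ 2)) ''
        (singVals (G i r k)).support := by
    rintro q ⟨i, r, hr, k, hk, j, hj, rfl⟩
    simp only [Set.mem_iUnion, Finset.mem_range]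
    exact ⟨i, r, hr, k, hk, j, by simpa using hj, rfl⟩
  refine Set.Finite.subset ?_ this
  refine Set.finite_iUnion fun i => ?_
  refine Set.Finite.biUnion (Finset.finite_toSet _) fun r _ => ?_
  refine Set.Finite.biUnion (Finset.finite_toSet _) fun k _ => ?_
  exact (Finset.finite_toSet _).image _

lemma svRatios_mem {R K : ℕ} {G : Fin n → ℕ → ℕ → Mat d₁ d₂} {q : ℝ} (hq : q ∈ svRatios R K G) :
    0 < q ∧ q ≤ 1 := by
  obtain ⟨i, r, -, k, -, j, hj, rfl⟩ := hq
  rw [← frobNorm_eq_sqrt_singVals]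
  let j' : SVIdx (G i r k) := ⟨j, Finsupp.mem_support_iff.mpr hj⟩
  have h0 := singVals_pos (G i r k) j'
  have h1 := singVals_le_frobNorm (G i r k) j'
  exact ⟨div_pos h0 (h0.trans_le h1), (div_le_one (h0.trans_le h1)).mpr h1⟩

lemma kappa_mem (R K : ℕ) (G : Fin n → ℕ → ℕ → Mat d₁ d₂) :
    0 < kappa R K G ∧ kappa R K G ≤ 1 := by
  unfold kappa
  split_ifs with h
  · exact svRatios_mem (h.csInf_mem (svRatios_finite R K G))
  · norm_num

lemma kappa_le {R K : ℕ} (G : Fin n → ℕ → ℕ → Mat d₁ d₂) (i : Fin n) {r k : ℕ} (hr : r < R)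
    (hk : k < K) (j : SVIdx (G i r k)) :
    kappa R K G ≤ singVals (G i r k) j / frobNorm (G i r k) := by
  have hmem : singVals (G i r k) j / frobNorm (G i r k) ∈ svRatios R K G :=
    ⟨i, r, hr, k, hk, j, (singVals_pos _ j).ne', by rw [frobNorm_eq_sqrt_singVals]⟩
  rw [kappa, if_pos ⟨_, hmem⟩]
  exact csInf_le (svRatios_finite R K G).bddBelow hmem

end Kappa

/-! ### Smoothness of the losses -/

section Smooth

variable {d₁ d₂ : ℕ}

attribute [local instance] Matrix.normedAddCommGroup Matrix.normedSpace

lemma fderiv_apply_eq_innerM (f : Mat d₁ d₂ → ℝ) (X V : Mat d₁ d₂) :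
    fderiv ℝ f X V = innerM (grad f X) V := by
  conv_lhs => rw [Matrix.matrix_eq_sum_single V]
  simp only [map_sum, innerM, grad, Matrix.of_apply]
  refine Finset.sum_congr rfl fun a _ => Finset.sum_congr rfl fun b _ => ?_
  have : Matrix.single a b (V a b) = V a b • Matrix.single a b (1 : ℝ) := by
    rw [Matrix.smul_single]; simp
  rw [this, map_smul, smul_eq_mul, mul_comm]

lemma hasDerivAt_line {f : Mat d₁ d₂ → ℝ} (hf : Differentiable ℝ f) (X V : Mat d₁ d₂) (t : ℝ) :
    HasDerivAt (fun t : ℝ => f (X + t • V)) (innerM (grad f (X + t • V)) V) t := by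
  have h1 : HasDerivAt (fun t : ℝ => X + t • V) V t := by
    exact (((hasDerivAt_id t).smul_const V).const_add X).congr_deriv (one_smul ℝ V)
  have h2 := (hf (X + t • V)).hasFDerivAt.comp_hasDerivAt t h1
  exact h2.congr_deriv (fderiv_apply_eq_innerM f _ V)

/-- The descent inequality for functions that are smooth for the spectral norm. -/
lemma le_of_smooth {f : Mat d₁ d₂ → ℝ} {L : ℝ} (hf : Differentiable ℝ f)
    (hL : ∀ X Y, dualNorm (grad f X - grad f Y) ≤ L * spNorm (X - Y)) (X V : Mat d₁ d₂) :
    f (X + V) ≤ f X + innerM (grad f X) V + L / 2 * spNorm V ^ 2 := by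
  have hd : ∀ t : ℝ, HasDerivAt
      (fun t : ℝ => f (X + t • V) - t * innerM (grad f X) V - L / 2 * spNorm V ^ 2 * t ^ 2)
      (innerM (grad f (X + t • V)) V - innerM (grad f X) V - L / 2 * spNorm V ^ 2 * (2 * t)) t := by
    intro t
    have h2 := (hasDerivAt_id t).mul_const (innerM (grad f X) V)
    have h3 := (hasDerivAt_pow 2 t).const_mul (L / 2 * spNorm V ^ 2)
    exact (((hasDerivAt_line hf X V t).sub h2).sub h3).congr_deriv (by simp)
  have hanti : AntitoneOn
      (fun t : ℝ => f (X + t • V) - t * innerM (grad f X) V - L / 2 * spNorm V ^ 2 * t ^ 2)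
      (Set.Icc 0 1) := by
    refine antitoneOn_of_deriv_nonpos (convex_Icc _ _)
      (fun t _ => (hd t).continuousAt.continuousWithinAt)
      (fun t _ => (hd t).differentiableAt.differentiableWithinAt) fun t ht => ?_
    rw [interior_Icc] at ht
    rw [(hd t).deriv, ← innerM_sub_left]
    have h1 := innerM_le_dualNorm_mul_spNorm (grad f (X + t • V) - grad f X) V
    have h2 := hL (X + t • V) X
    rw [add_sub_cancel_left, spNorm_smul, abs_of_pos ht.1] at h2
    have h3 := mul_le_mul_of_nonneg_right h2 (spNorm_nonneg V)
    linarith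
  have := hanti (Set.left_mem_Icc.mpr zero_le_one) (Set.right_mem_Icc.mpr zero_le_one) zero_le_one
  simp only [one_smul, zero_smul, add_zero] at this
  linarith

/-- A function that is bounded below and has a constant gradient has no slope at all. -/
lemma grad_eq_zero_of_bddBelow {f : Mat d₁ d₂ → ℝ} (hf : Differentiable ℝ f)
    (hL : ∀ X Y, dualNorm (grad f X - grad f Y) ≤ 0 * spNorm (X - Y))
    (hb : BddBelow (Set.range f)) (X : Mat d₁ d₂) : grad f X = 0 := by
  obtain ⟨b, hb⟩ := hb
  set A := grad f X with hA
  have key : ∀ t : ℝ, b ≤ f X - t * frobNorm A ^ 2 := by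
    intro t
    have h1 := le_of_smooth hf hL X (-t • A)
    rw [← hA, innerM_smul_right, innerM_self] at h1
    have h2 := hb (Set.mem_range_self (X + -t • A))
    linarith
  have h0 : frobNorm A ^ 2 = 0 := by
    by_contra h
    have hpos : 0 < frobNorm A ^ 2 := lt_of_le_of_ne (sq_nonneg _) (Ne.symm h)
    have := key ((f X - b + 1) / frobNorm A ^ 2)
    rw [div_mul_cancel₀ _ h] at this
    linarith
  exact frobNorm_eq_zero.mp (pow_eq_zero_iff two_ne_zero |>.mp h0)

/-- A function that is bounded below and not minimal at `X₀` has a positive smoothness constant. -/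
lemma pos_of_iInf_lt {f : Mat d₁ d₂ → ℝ} {L : ℝ} (hL0 : 0 ≤ L) (hf : Differentiable ℝ f)
    (hL : ∀ X Y, dualNorm (grad f X - grad f Y) ≤ L * spNorm (X - Y))
    (hb : BddBelow (Set.range f)) {X₀ : Mat d₁ d₂} (h : ⨅ X, f X < f X₀) : 0 < L := by
  refine lt_of_le_of_ne hL0 ?_
  rintro rfl
  refine h.not_ge (le_ciInf fun X => ?_)
  have h1 := le_of_smooth hf hL X (X₀ - X)
  rw [grad_eq_zero_of_bddBelow hf hL hb, add_sub_cancel] at h1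
  simpa [innerM] using h1

variable {n : ℕ} {Ξ : Type*} [MeasurableSpace Ξ] {𝒟 : Fin n → Measure Ξ}
  {F : Fin n → Mat d₁ d₂ → Ξ → ℝ} {L : ℝ}

lemma differentiable_globalLoss (hR : RegularLoss 𝒟 F) : Differentiable ℝ (globalLoss 𝒟 F) := by
  have : Differentiable ℝ fun X => ∑ i, clientLoss 𝒟 F i X :=
    Differentiable.fun_sum fun i _ => (hR i).2.2.2
  exact this.const_mul _

lemma grad_globalLoss (hR : RegularLoss 𝒟 F) (X : Mat d₁ d₂) :
    grad (globalLoss 𝒟 F) X = (1 / (n : ℝ)) • ∑ i, grad (clientLoss 𝒟 F i) X := by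
  have h : HasFDerivAt (globalLoss 𝒟 F)
      ((1 / (n : ℝ)) • ∑ i, fderiv ℝ (clientLoss 𝒟 F i) X) X := by
    have : HasFDerivAt (fun X => ∑ i, clientLoss 𝒟 F i X)
        (∑ i, fderiv ℝ (clientLoss 𝒟 F i) X) X :=
      HasFDerivAt.fun_sum fun i _ => ((hR i).2.2.2 X).hasFDerivAt
    exact this.const_mul _
  ext a b
  simp only [grad, Matrix.of_apply, Matrix.smul_apply, Matrix.sum_apply]
  rw [h.fderiv]
  simp

lemma smooth_globalLoss (hL0 : 0 ≤ L) (hR : RegularLoss 𝒟 F) (hL : SmoothLoss 𝒟 F L)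
    (X Y : Mat d₁ d₂) :
    dualNorm (grad (globalLoss 𝒟 F) X - grad (globalLoss 𝒟 F) Y) ≤ L * spNorm (X - Y) := by
  rw [grad_globalLoss hR, grad_globalLoss hR, ← smul_sub, ← Finset.sum_sub_distrib]
  exact dualNorm_average_le (mul_nonneg hL0 (spNorm_nonneg _)) fun i => hL i X Y

end Smooth

/-! ### The algorithm on a single time axis -/

section Flat

variable {n d₁ d₂ : ℕ} (lmo : Mat d₁ d₂ → Mat d₁ d₂) (η α : ℝ) (K : ℕ)
  (g : ℕ → ℕ → Fin n → Mat d₁ d₂ → Mat d₁ d₂) (X₀ : Mat d₁ d₂) (M₀ : Fin n → Mat d₁ d₂)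

/-- The pair of the local iterate and the momentum of client `i` at the global time `t`, where
`t = r K + k` stands for local step `k < K` of round `r`. -/
def flatIter (t : ℕ) (i : Fin n) : Mat d₁ d₂ × Mat d₁ d₂ :=
  localIter lmo η α (g (t / K)) (fedState lmo η α K g X₀ M₀ (t / K)) i (t % K)

/-- The average of the local iterates at the global time `t`. At the beginning of a round it is the
server's parameter, so that at every time step it moves by `η` times the average oracle output. -/
def flatAvg (t : ℕ) : Mat d₁ d₂ := avgIterate lmo η α K g X₀ M₀ (t / K) (t % K)

variable {K}

lemma succ_div_mod_cases (hK : 0 < K) (t : ℕ) :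
    ((t + 1) / K = t / K ∧ (t + 1) % K = t % K + 1) ∨
      ((t + 1) / K = t / K + 1 ∧ (t + 1) % K = 0 ∧ t % K + 1 = K) := by
  have h1 := Nat.div_add_mod t K
  have h2 := Nat.mod_lt t hK
  rcases Nat.lt_or_ge (t % K + 1) K with h | h
  · left
    have e : t + 1 = (t % K + 1) + K * (t / K) := by omega
    constructor
    · conv_lhs => rw [e, Nat.add_mul_div_left _ _ hK, Nat.div_eq_of_lt h, zero_add]
    · conv_lhs => rw [e, Nat.add_mul_mod_self_left, Nat.mod_eq_of_lt h]
  · right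
    have e : t + 1 = K * (t / K + 1) := by rw [mul_add]; omega
    refine ⟨?_, ?_, by omega⟩
    · conv_lhs => rw [e, Nat.mul_div_cancel_left _ hK]
    · conv_lhs => rw [e, Nat.mul_mod_right]

lemma mul_add_div_of_lt {K r k : ℕ} (hk : k < K) : (r * K + k) / K = r := by
  rw [mul_comm, Nat.mul_add_div (by omega), Nat.div_eq_of_lt hk, add_zero]

lemma average_const (hn : 0 < n) (A : Mat d₁ d₂) : (1 / (n : ℝ)) • ∑ _i : Fin n, A = A := by
  have : (n : ℝ) ≠ 0 := by positivity
  rw [Finset.sum_const, Finset.card_univ, Fintype.card_fin, ← Nat.cast_smul_eq_nsmul ℝ, smul_smul,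
    one_div_mul_cancel this, one_smul]

lemma fedState_Cc (r : ℕ) (i : Fin n) :
    (fedState lmo η α K g X₀ M₀ r).Cc i = (fedState lmo η α K g X₀ M₀ r).M i := by
  cases r <;> rfl

/-- The server's control variate is the average of the momenta at the beginning of the round. -/
lemma fedState_C (r : ℕ) : (fedState lmo η α K g X₀ M₀ r).C
    = (1 / (n : ℝ)) • ∑ i, (fedState lmo η α K g X₀ M₀ r).M i := by
  induction r with
  | zero => rfl
  | succ r ih =>
    change (fedState lmo η α K g X₀ M₀ r).C + (1 / (n : ℝ)) • ∑ i,
      ((localIter lmo η α (g r) (fedState lmo η α K g X₀ M₀ r) i K).2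
        - (fedState lmo η α K g X₀ M₀ r).Cc i)
      = (1 / (n : ℝ)) • ∑ i, (localIter lmo η α (g r) (fedState lmo η α K g X₀ M₀ r) i K).2
    simp only [fedState_Cc, Finset.sum_sub_distrib, smul_sub]
    rw [ih]; abel

lemma flatIter_zero (i : Fin n) : flatIter lmo η α K g X₀ M₀ 0 i = (X₀, M₀ i) := by
  simp [flatIter, localIter, clientIter, fedState]

lemma flatAvg_zero (hn : 0 < n) : flatAvg lmo η α K g X₀ M₀ 0 = X₀ := by
  simp only [flatAvg, avgIterate, Nat.zero_div, Nat.zero_mod]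
  exact average_const hn X₀

lemma flatAvg_eq (t : ℕ) : flatAvg lmo η α K g X₀ M₀ t
    = (1 / (n : ℝ)) • ∑ i, (flatIter lmo η α K g X₀ M₀ t i).1 := rfl

lemma flatIter_mul_div (hK : 0 < K) (t : ℕ) (i : Fin n) :
    (flatIter lmo η α K g X₀ M₀ (t / K * K) i).2 = (fedState lmo η α K g X₀ M₀ (t / K)).M i := by
  rw [flatIter, Nat.mul_div_cancel _ hK, Nat.mul_mod_left]; rfl

lemma flatIter_succ_snd (hK : 0 < K) (t : ℕ) (i : Fin n) :
    (flatIter lmo η α K g X₀ M₀ (t + 1) i).2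
      = (1 - α) • (flatIter lmo η α K g X₀ M₀ t i).2
        + α • g (t / K) (t % K) i (flatIter lmo η α K g X₀ M₀ t i).1 := by
  unfold flatIter
  rcases succ_div_mod_cases hK t with ⟨h1, h2⟩ | ⟨h1, h2, h3⟩
  · rw [h1, h2]; rfl
  · rw [h1, h2]
    change (localIter lmo η α (g (t / K)) (fedState lmo η α K g X₀ M₀ (t / K)) i K).2 = _
    rw [show localIter lmo η α (g (t / K)) (fedState lmo η α K g X₀ M₀ (t / K)) i K
      = localIter lmo η α (g (t / K)) (fedState lmo η α K g X₀ M₀ (t / K)) i (t % K + 1) by rw [h3]]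
    rfl

/-- The control variates are the momenta, and their average, at the beginning `t / K * K` of the
round. -/
lemma lmoInput_eq (hK : 0 < K) (t : ℕ) (i : Fin n) :
    lmoInput lmo η α K g X₀ M₀ i (t / K) (t % K)
      = (flatIter lmo η α K g X₀ M₀ (t + 1) i).2 - (flatIter lmo η α K g X₀ M₀ (t / K * K) i).2
        + (1 / (n : ℝ)) • ∑ j, (flatIter lmo η α K g X₀ M₀ (t / K * K) j).2 := by
  rw [flatIter_succ_snd _ _ _ _ _ _ hK, lmoInput]
  simp only [flatIter_mul_div _ _ _ _ _ _ hK, fedState_Cc, fedState_C]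
  rfl

lemma flatAvg_succ (hn : 0 < n) (hK : 0 < K) (t : ℕ) :
    flatAvg lmo η α K g X₀ M₀ (t + 1) = flatAvg lmo η α K g X₀ M₀ t
      + η • ((1 / (n : ℝ)) • ∑ i, lmo (lmoInput lmo η α K g X₀ M₀ i (t / K) (t % K))) := by
  have h : flatAvg lmo η α K g X₀ M₀ (t + 1) = (1 / (n : ℝ)) • ∑ i,
      (localIter lmo η α (g (t / K)) (fedState lmo η α K g X₀ M₀ (t / K)) i (t % K + 1)).1 := by
    rcases succ_div_mod_cases hK t with ⟨h1, h2⟩ | ⟨h1, h2, h3⟩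
    · rw [flatAvg, h1, h2]; rfl
    · rw [flatAvg, h1, h2, h3]
      exact average_const hn _
  rw [h, flatAvg, avgIterate, smul_comm η, ← smul_add, Finset.smul_sum (r := η),
    ← Finset.sum_add_distrib]
  rfl

variable {lmo η}

/-- Local iterates stay close to the start of the round, as the outputs of the oracle have spectral
norm at most `1`. -/
lemma spNorm_clientIter_sub_le (hη : 0 ≤ η) (hlmo : ∀ G, spNorm (lmo G) ≤ 1)
    (g : ℕ → Mat d₁ d₂ → Mat d₁ d₂) (Ci C X₀ M₀ : Mat d₁ d₂) (k : ℕ) :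
    spNorm ((clientIter lmo η α g Ci C X₀ M₀ k).1 - X₀) ≤ η * k := by
  induction k with
  | zero => simp [clientIter, spNorm_zero]
  | succ k ih =>
    simp only [clientIter]
    rw [add_sub_right_comm]
    refine (spNorm_add_le _ _).trans ?_
    rw [spNorm_smul, abs_of_nonneg hη]
    have := mul_le_mul_of_nonneg_left (hlmo ((1 - α) • (clientIter lmo η α g Ci C X₀ M₀ k).2 +
      α • g k (clientIter lmo η α g Ci C X₀ M₀ k).1 - Ci + C)) hη
    push_cast
    linarith

lemma spNorm_flatIter_sub_flatAvg_le (hn : 0 < n) (hK : 0 < K) (hη : 0 ≤ η)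
    (hlmo : ∀ G, spNorm (lmo G) ≤ 1) (t : ℕ) (i : Fin n) :
    spNorm ((flatIter lmo η α K g X₀ M₀ t i).1 - flatAvg lmo η α K g X₀ M₀ t) ≤ 2 * η * K := by
  set X := (fedState lmo η α K g X₀ M₀ (t / K)).X with hX
  have hk : (t % K : ℕ) ≤ (K : ℝ) := by exact_mod_cast (Nat.mod_lt t hK).le
  have h1 : ∀ j, spNorm ((flatIter lmo η α K g X₀ M₀ t j).1 - X) ≤ η * K := fun j =>
    (spNorm_clientIter_sub_le α hη hlmo _ _ _ _ _ _).trans (mul_le_mul_of_nonneg_left hk hη)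
  have h2 : (flatIter lmo η α K g X₀ M₀ t i).1 - flatAvg lmo η α K g X₀ M₀ t
      = ((flatIter lmo η α K g X₀ M₀ t i).1 - X)
        + -((1 / (n : ℝ)) • ∑ j, ((flatIter lmo η α K g X₀ M₀ t j).1 - X)) := by
    rw [Finset.sum_sub_distrib, smul_sub, average_const hn, ← flatAvg_eq]; abel
  rw [h2]
  refine (spNorm_add_le _ _).trans ?_
  rw [spNorm_neg]
  have h3 := spNorm_le_of_average_le (mul_nonneg hη (Nat.cast_nonneg K)) h1
  have h4 := h1 i
  linarith

lemma spNorm_flatAvg_succ_sub_le (hn : 0 < n) (hK : 0 < K) (hη : 0 ≤ η)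
    (hlmo : ∀ G, spNorm (lmo G) ≤ 1) (t : ℕ) :
    spNorm (flatAvg lmo η α K g X₀ M₀ (t + 1) - flatAvg lmo η α K g X₀ M₀ t) ≤ η := by
  rw [flatAvg_succ _ _ _ _ _ _ hn hK, add_sub_cancel_left, spNorm_smul, abs_of_nonneg hη]
  exact mul_le_of_le_one_right hη (spNorm_le_of_average_le zero_le_one fun i => hlmo _)

variable (lmo η)

lemma clientIter_congr {g g' : ℕ → Mat d₁ d₂ → Mat d₁ d₂} (Ci C X₀ M₀ : Mat d₁ d₂) (k : ℕ)
    (h : ∀ k' < k, g k' = g' k') :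
    clientIter lmo η α g Ci C X₀ M₀ k = clientIter lmo η α g' Ci C X₀ M₀ k := by
  induction k with
  | zero => rfl
  | succ k ih =>
    simp only [clientIter]
    rw [ih fun k' hk' => h k' (hk'.trans k.lt_succ_self), h k k.lt_succ_self]

variable {g} in
lemma fedState_congr {g' : ℕ → ℕ → Fin n → Mat d₁ d₂ → Mat d₁ d₂} (r : ℕ)
    (h : ∀ s < r * K, g (s / K) (s % K) = g' (s / K) (s % K)) :
    fedState lmo η α K g X₀ M₀ r = fedState lmo η α K g' X₀ M₀ r := by
  induction r with
  | zero => rfl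
  | succ r ih =>
    simp only [fedState]
    rw [← ih fun s hs => h s (hs.trans_le (Nat.mul_le_mul_right K r.le_succ))]
    have hl : ∀ i, localIter lmo η α (g r) (fedState lmo η α K g X₀ M₀ r) i K
        = localIter lmo η α (g' r) (fedState lmo η α K g X₀ M₀ r) i K := by
      refine fun i => clientIter_congr _ _ _ _ _ _ _ _ fun k hk => ?_
      have := h (r * K + k) (by rw [Nat.succ_mul]; omega)
      rw [mul_add_div_of_lt hk, Nat.mul_add_mod_of_lt hk] at this
      rw [this]
    simp only [fedRound, hl]

variable {g} in
/-- The iterates at time `t` depend only on the stochastic gradients at earlier times. -/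
lemma flatIter_congr {g' : ℕ → ℕ → Fin n → Mat d₁ d₂ → Mat d₁ d₂} (hK : 0 < K) (t : ℕ)
    (h : ∀ s < t, g (s / K) (s % K) = g' (s / K) (s % K)) (i : Fin n) :
    flatIter lmo η α K g X₀ M₀ t i = flatIter lmo η α K g' X₀ M₀ t i := by
  have ht := Nat.div_add_mod' t K
  rw [flatIter, flatIter, ← fedState_congr lmo η α X₀ M₀ (t / K) fun s hs => h s (by omega)]
  refine clientIter_congr _ _ _ _ _ _ _ _ fun k hk => ?_
  have hkK : k < K := hk.trans (Nat.mod_lt t hK)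
  have := h (t / K * K + k) (by omega)
  rw [mul_add_div_of_lt hkK, Nat.mul_add_mod_of_lt hkK] at this
  rw [this]

end Flat

/-! ### Error of the oracle input along a realization -/

section Momentum

variable {n d₁ d₂ : ℕ}

/-- The contribution to the momentum of the noise `N` of the `m` steps from time `u` on. -/
def noiseSum (α : ℝ) (N : ℕ → Mat d₁ d₂) (u m : ℕ) : Mat d₁ d₂ :=
  ∑ j ∈ Finset.range m, (α * (1 - α) ^ (m - 1 - j)) • N (u + j)

lemma noiseSum_zero (α : ℝ) (N : ℕ → Mat d₁ d₂) (u : ℕ) : noiseSum α N u 0 = 0 := by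
  simp [noiseSum]

lemma noiseSum_succ (α : ℝ) (N : ℕ → Mat d₁ d₂) (u m : ℕ) :
    noiseSum α N u (m + 1) = (1 - α) • noiseSum α N u m + α • N (u + m) := by
  rw [noiseSum, Finset.sum_range_succ, noiseSum, Finset.smul_sum]
  congr 1
  · refine Finset.sum_congr rfl fun j hj => ?_
    have : m + 1 - 1 - j = (m - 1 - j) + 1 := by have := Finset.mem_range.mp hj; omega
    rw [smul_smul, this, pow_succ]
    ring_nf
  · simp

/-- The noise of the steps before time `u` decays during the `m` following steps. -/
lemma noiseSum_add (α : ℝ) (N : ℕ → Mat d₁ d₂) (u m : ℕ) :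
    noiseSum α N 0 (u + m) = (1 - α) ^ m • noiseSum α N 0 u + noiseSum α N u m := by
  induction m with
  | zero => simp [noiseSum_zero]
  | succ m ih =>
    rw [← add_assoc, noiseSum_succ, ih, noiseSum_succ, zero_add, pow_succ]
    module

/-- The deviation of the momentum from the gradient, up to noise and initialization, is bounded by
the drift `L η / α` of the averaged iterate and by the distance `2 η K` of the local iterates
to it. The last argument of the gradient is the averaged iterate one step earlier (or the initial
point, as `0 - 1 = 0`). -/
lemma dualNorm_momentum_sub_le {L η α δ : ℝ} (hL : 0 ≤ L) (hη : 0 ≤ η) (hα : 0 < α) (hα1 : α ≤ 1)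
    {A : Mat d₁ d₂ → Mat d₁ d₂}
    (hA : ∀ X Y, dualNorm (A X - A Y) ≤ L * spNorm (X - Y)) {x y M N : ℕ → Mat d₁ d₂}
    (hM : ∀ t, M (t + 1) = (1 - α) • M t + α • (A (y t) + N t))
    (hx : ∀ t, spNorm (x (t + 1) - x t) ≤ η) (hy : ∀ t, spNorm (y t - x t) ≤ δ) (t : ℕ) :
    dualNorm (M t - A (x (t - 1)) - noiseSum α N 0 t - (1 - α) ^ t • (M 0 - A (x 0)))
      ≤ L * η / α + L * δ := by
  have hδ : 0 ≤ δ := (spNorm_nonneg _).trans (hy 0)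
  induction t with
  | zero =>
    have : M 0 - A (x (0 - 1)) - noiseSum α N 0 0 - (1 - α) ^ 0 • (M 0 - A (x 0)) = 0 := by
      simp [noiseSum_zero]
    rw [this, dualNorm_zero]
    positivity
  | succ t ih =>
    have e : M (t + 1) - A (x (t + 1 - 1)) - noiseSum α N 0 (t + 1)
        - (1 - α) ^ (t + 1) • (M 0 - A (x 0))
        = (1 - α) • (M t - A (x (t - 1)) - noiseSum α N 0 t - (1 - α) ^ t • (M 0 - A (x 0)))
          + ((1 - α) • (A (x (t - 1)) - A (x t)) + α • (A (y t) - A (x t))) := by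
      rw [hM, noiseSum_succ, zero_add, add_tsub_cancel_right, pow_succ]
      module
    have h1 : dualNorm (A (x (t - 1)) - A (x t)) ≤ L * η := by
      refine (hA _ _).trans (mul_le_mul_of_nonneg_left ?_ hL)
      rcases t with _ | t
      · simpa [spNorm_zero] using hη
      · rw [add_tsub_cancel_right, ← spNorm_neg, neg_sub]; exact hx t
    have h2 : dualNorm (A (y t) - A (x t)) ≤ L * δ :=
      (hA _ _).trans (mul_le_mul_of_nonneg_left (hy t) hL)
    have hα' : 0 ≤ 1 - α := by linarith
    rw [e]
    calc _ ≤ (1 - α) * (L * η / α + L * δ) + ((1 - α) * (L * η) + α * (L * δ)) :=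
          (dualNorm_add_le _ _).trans (add_le_add
            ((dualNorm_smul_le hα' _).trans (mul_le_mul_of_nonneg_left ih hα'))
            ((dualNorm_add_le _ _).trans (add_le_add
              ((dualNorm_smul_le hα' _).trans (mul_le_mul_of_nonneg_left h1 hα'))
              ((dualNorm_smul_le hα.le _).trans (mul_le_mul_of_nonneg_left h2 hα.le)))))
      _ = L * η / α + L * δ - α * (L * η) := by field_simp; ring
      _ ≤ _ := by have : 0 ≤ α * (L * η) := by positivity
                  linarith

lemma spNorm_sub_le_of_step {x : ℕ → Mat d₁ d₂} {η : ℝ}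
    (hx : ∀ t, spNorm (x (t + 1) - x t) ≤ η) (u m : ℕ) :
    spNorm (x (u + m) - x u) ≤ η * m := by
  induction m with
  | zero => simp [spNorm_zero]
  | succ m ih =>
    have : x (u + (m + 1)) - x u = (x (u + m + 1) - x (u + m)) + (x (u + m) - x u) := by
      rw [← add_assoc]; abel
    rw [this]
    refine (spNorm_add_le _ _).trans ?_
    have := hx (u + m)
    push_cast
    linarith

/-- The triangle inequality for the noise terms of `dualNorm_lmoInput_sub_le`. -/
lemma frobNorm_noise_le {c d p : ℝ} (hc : 0 ≤ c) (hd : 0 ≤ d) (hdp : d ≤ p)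
    (a b e f h : Mat d₁ d₂) :
    frobNorm (c • a + (-1 : ℝ) • b + (-1 : ℝ) • e + (d • f + (-p) • h))
      ≤ (c * frobNorm a + frobNorm b) + frobNorm e + p * (frobNorm f + frobNorm h) := by
  have s1 : frobNorm (c • a) = c * frobNorm a := by rw [frobNorm_smul, abs_of_nonneg hc]
  have s2 : ∀ B : Mat d₁ d₂, frobNorm ((-1 : ℝ) • B) = frobNorm B := by
    intro B; rw [frobNorm_smul]; simp
  have s3 : frobNorm (d • f) ≤ p * frobNorm f := by
    rw [frobNorm_smul, abs_of_nonneg hd]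
    exact mul_le_mul_of_nonneg_right hdp (frobNorm_nonneg _)
  have s4 : frobNorm ((-p) • h) = p * frobNorm h := by
    rw [frobNorm_smul, abs_neg, abs_of_nonneg (hd.trans hdp)]
  have t1 := frobNorm_add_le (c • a) ((-1 : ℝ) • b)
  have t2 := frobNorm_add_le (c • a + (-1 : ℝ) • b) ((-1 : ℝ) • e)
  have t3 := frobNorm_add_le (d • f) ((-p) • h)
  have t4 := frobNorm_add_le (c • a + (-1 : ℝ) • b + (-1 : ℝ) • e) (d • f + (-p) • h)
  rw [s1, s2] at t1
  rw [s2] at t2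
  linarith

/-- The triangle inequality for the drift terms and the noise `z` of `dualNorm_lmoInput_sub_le`. -/
lemma dualNorm_drift_le (a b c d e z : Mat d₁ d₂) :
    dualNorm (a - b - c + d - e + z)
      ≤ dualNorm a + dualNorm b + dualNorm c + dualNorm d + dualNorm e + dualNorm z := by
  have t1 := dualNorm_add_le (a - b - c + d - e) z
  have t2 := dualNorm_sub_le (a - b - c + d) e
  have t3 := dualNorm_add_le (a - b - c) d
  have t4 := dualNorm_sub_le (a - b) c
  have t5 := dualNorm_sub_le a b
  linarith

/-- The error of the input of the oracle. The control variates replace the difference between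
the gradients of the client and of the server by the same difference at the beginning `u` of
the round; the noise enters through its average and through the noise of the current round. -/
lemma dualNorm_lmoInput_sub_le {L η α δ K : ℝ} (hL : 0 ≤ L) (hη : 0 ≤ η) (hα : 0 < α) (hα1 : α ≤ 1)
    {A : Fin n → Mat d₁ d₂ → Mat d₁ d₂}
    (hA : ∀ i X Y, dualNorm (A i X - A i Y) ≤ L * spNorm (X - Y))
    {x : ℕ → Mat d₁ d₂} {y M N : ℕ → Fin n → Mat d₁ d₂}
    (hM : ∀ t i, M (t + 1) i = (1 - α) • M t i + α • (A i (y t i) + N t i))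
    (hx : ∀ t, spNorm (x (t + 1) - x t) ≤ η) (hy : ∀ t i, spNorm (y t i - x t) ≤ δ)
    (i : Fin n) (u m : ℕ) (hm : (m + 1 : ℕ) ≤ K) :
    dualNorm ((1 / (n : ℝ)) • ∑ j, A j (x (u + m)) - (M (u + m + 1) i - M u i
        + (1 / (n : ℝ)) • ∑ j, M u j))
      ≤ 2 * (L * (η * K)) + 3 * (L * η / α + L * δ)
        + √(min d₁ d₂ : ℕ) * (
          ((1 - (1 - α) ^ (m + 1)) * frobNorm (noiseSum α (fun t => N t i) 0 u)
            + frobNorm (noiseSum α (fun t => N t i) u (m + 1)))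
          + frobNorm ((1 / (n : ℝ)) • ∑ j, noiseSum α (fun t => N t j) 0 u)
          + (1 - α) ^ u * (frobNorm (M 0 i - A i (x 0))
            + (1 / (n : ℝ)) * ∑ j, frobNorm (M 0 j - A j (x 0)))) := by
  set Abar : Mat d₁ d₂ → Mat d₁ d₂ := fun X => (1 / (n : ℝ)) • ∑ j, A j X with hAbar
  set ε : Fin n → Mat d₁ d₂ := fun j => M 0 j - A j (x 0) with hε
  set nz : Fin n → ℕ → ℕ → Mat d₁ d₂ := fun j => noiseSum α fun t => N t j with hnz
  set Q : ℕ → Fin n → Mat d₁ d₂ := fun t j =>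
    M t j - A j (x (t - 1)) - nz j 0 t - (1 - α) ^ t • ε j with hQ
  have hδ : 0 ≤ δ := (spNorm_nonneg _).trans (hy 0 i)
  have hB : 0 ≤ L * η / α + L * δ := by positivity
  have hQle : ∀ t j, dualNorm (Q t j) ≤ L * η / α + L * δ := fun t j =>
    dualNorm_momentum_sub_le (x := x) (y := fun t => y t j) (M := fun t => M t j)
      (N := fun t => N t j) hL hη hα hα1 (hA j) (fun t => hM t j) hx (fun t => hy t j) t
  have hMQ : ∀ t j, M t j = A j (x (t - 1)) + Q t j + nz j 0 t + (1 - α) ^ t • ε j := by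
    intro t j
    change M t j = A j (x (t - 1)) + (M t j - A j (x (t - 1)) - nz j 0 t - (1 - α) ^ t • ε j)
      + nz j 0 t + (1 - α) ^ t • ε j
    abel
  clear_value Q
  have havg : (1 / (n : ℝ)) • ∑ j, M u j = Abar (x (u - 1)) + (1 / (n : ℝ)) • ∑ j, Q u j
      + (1 / (n : ℝ)) • ∑ j, nz j 0 u + (1 - α) ^ u • ((1 / (n : ℝ)) • ∑ j, ε j) := by
    simp only [hMQ u, Finset.sum_add_distrib, smul_add, ← Finset.smul_sum, hAbar]
    rw [smul_comm ((1 - α) ^ u)]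
  have hnoise : nz i 0 (u + m + 1) = (1 - α) ^ (m + 1) • nz i 0 u + nz i u (m + 1) := by
    rw [add_assoc]; exact noiseSum_add α _ u (m + 1)
  have hm' := hMQ (u + m + 1) i
  rw [add_tsub_cancel_right, hnoise] at hm'
  -- the noise before time `u` is contained in both momenta of client `i`, and mostly cancels
  have hdecomp : (1 / (n : ℝ)) • ∑ j, A j (x (u + m)) - (M (u + m + 1) i - M u i
        + (1 / (n : ℝ)) • ∑ j, M u j)
      = (Abar (x (u + m)) - Abar (x (u - 1))) - (A i (x (u + m)) - A i (x (u - 1)))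
        - Q (u + m + 1) i + Q u i - (1 / (n : ℝ)) • ∑ j, Q u j
        + ((1 - (1 - α) ^ (m + 1)) • nz i 0 u + (-1 : ℝ) • nz i u (m + 1)
          + (-1 : ℝ) • ((1 / (n : ℝ)) • ∑ j, nz j 0 u)
          + (((1 - α) ^ u - (1 - α) ^ (u + m + 1)) • ε i
            + (-(1 - α) ^ u) • ((1 / (n : ℝ)) • ∑ j, ε j))) := by
    rw [havg, hm', hMQ u i]
    simp only [hAbar]
    module
  have hxx : spNorm (x (u + m) - x (u - 1)) ≤ η * K := by
    have h := spNorm_sub_le_of_step hx (u - 1) (u + m - (u - 1))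
    rw [Nat.add_sub_cancel' (by omega)] at h
    refine h.trans (mul_le_mul_of_nonneg_left (le_trans ?_ hm) hη)
    exact_mod_cast (by omega)
  have hg : ∀ j, dualNorm (A j (x (u + m)) - A j (x (u - 1))) ≤ L * (η * K) := fun j =>
    (hA j _ _).trans (mul_le_mul_of_nonneg_left hxx hL)
  have hLK : 0 ≤ L * (η * K) := (dualNorm_nonneg _).trans (hg i)
  have hgbar : dualNorm (Abar (x (u + m)) - Abar (x (u - 1))) ≤ L * (η * K) := by
    simp only [hAbar]
    rw [← smul_sub, ← Finset.sum_sub_distrib]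
    exact dualNorm_average_le hLK hg
  have hα0 : 0 ≤ 1 - α := by linarith
  have hpu : 0 ≤ (1 - α) ^ u := pow_nonneg hα0 u
  have hpm : (1 - α) ^ (m + 1) ≤ 1 := pow_le_one₀ hα0 (by linarith)
  have hpum : (1 - α) ^ (u + m + 1) ≤ (1 - α) ^ u :=
    pow_le_pow_of_le_one hα0 (by linarith) (by omega)
  have hpum0 : 0 ≤ (1 - α) ^ (u + m + 1) := pow_nonneg hα0 _
  have hfro := (dualNorm_le_frobNorm _).trans (mul_le_mul_of_nonneg_left
    (frobNorm_noise_le (c := 1 - (1 - α) ^ (m + 1)) (d := (1 - α) ^ u - (1 - α) ^ (u + m + 1))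
      (p := (1 - α) ^ u) (by linarith) (by linarith) (by linarith) (nz i 0 u) (nz i u (m + 1))
      ((1 / (n : ℝ)) • ∑ j, nz j 0 u) (ε i) ((1 / (n : ℝ)) • ∑ j, ε j))
    (Real.sqrt_nonneg (min d₁ d₂ : ℕ)))
  have hε_avg : frobNorm ((1 / (n : ℝ)) • ∑ j, ε j) ≤ (1 / (n : ℝ)) * ∑ j, frobNorm (ε j) := by
    rw [frobNorm_smul, abs_of_nonneg (by positivity)]
    exact mul_le_mul_of_nonneg_left (frobNorm_sum_le _ _) (by positivity)
  rw [hdecomp]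
  refine (dualNorm_drift_le _ _ _ _ _ _).trans (add_le_add ?_ (hfro.trans ?_))
  · have q4 := dualNorm_average_le hB fun j => hQle u j
    calc _ ≤ L * (η * K) + L * (η * K) + (L * η / α + L * δ) + (L * η / α + L * δ)
        + (L * η / α + L * δ) := by
          exact add_le_add (add_le_add (add_le_add (add_le_add hgbar (hg i)) (hQle _ i))
            (hQle u i)) q4
      _ = _ := by ring
  · gcongr

end Momentum

/-! ### Independence and second moments -/

section Probability

variable {Ω : Type*} [MeasurableSpace Ω] {P : Measure Ω}

omit [MeasurableSpace Ω] in
lemma measurable_comap_iSup {ι Ξ : Type*} [MeasurableSpace Ξ] (ξ : ι → Ω → Ξ) {S : Set ι} {i : ι}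
    (hi : i ∈ S) : Measurable[⨆ j ∈ S, MeasurableSpace.comap (ξ j) inferInstance] (ξ i) :=
  (comap_measurable (ξ i)).mono (le_biSup (fun j => MeasurableSpace.comap (ξ j) inferInstance) hi)
    le_rfl

/-- A sample is independent of the initialization together with all the other samples; these are
encoded by overwriting the sample in question by a fixed value `z₀`. -/
lemma indepFun_update {ι Ξ 𝓜 : Type*} [DecidableEq ι] [MeasurableSpace Ξ] [MeasurableSpace 𝓜]
    [IsProbabilityMeasure P] {ξ : ι → Ω → Ξ} {M : Ω → 𝓜} (hξ : ∀ i, Measurable (ξ i))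
    (hM : Measurable M) (hind : iIndepFun ξ P) (hMξ : IndepFun M (fun ω i => ξ i ω) P)
    (q : ι) (z₀ : Ξ) :
    IndepFun (fun ω => (M ω, Function.update (fun i => ξ i ω) q z₀)) (ξ q) P := by
  set rest : Ω → ι → Ξ := fun ω => Function.update (fun i => ξ i ω) q z₀ with hrest
  have hupd : Measurable fun x : ι → Ξ => Function.update x q z₀ := by
    refine measurable_pi_iff.mpr fun i => ?_
    rcases eq_or_ne i q with rfl | h
    · simp
    · simpa [Function.update_of_ne h] using measurable_pi_apply i
  have hallm : Measurable fun ω i => ξ i ω := measurable_pi_iff.mpr hξ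
  have hrm : Measurable rest := hupd.comp hallm
  have h1 : IndepFun rest (ξ q) P := by
    have h := indep_iSup_of_disjoint (fun i => (hξ i).comap_le) hind
      (S := {q}ᶜ) (T := {q}) disjoint_compl_left
    rw [IndepFun_iff_Indep]
    refine indep_of_indep_of_le_left (indep_of_indep_of_le_right h ?_) ?_
    · exact (measurable_comap_iSup ξ (Set.mem_singleton q)).comap_le
    · refine @Measurable.comap_le _ _
        (⨆ i ∈ ({q}ᶜ : Set ι), MeasurableSpace.comap (ξ i) inferInstance) _ _
        ((@measurable_pi_iff _ _ _ (_) _ _).mpr fun i => ?_)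
      rcases eq_or_ne i q with rfl | hi
      · simp [hrest]
      · simpa [hrest, Function.update_of_ne hi] using measurable_comap_iSup ξ (S := {q}ᶜ) hi
  have h2 : IndepFun M (fun ω => (rest ω, ξ q ω)) P :=
    hMξ.comp (φ := id) (ψ := fun x : ι → Ξ => (Function.update x q z₀, x q)) measurable_id
      (hupd.prodMk (measurable_pi_apply q))
  have h3 : IndepFun M rest P :=
    hMξ.comp (φ := id) (ψ := fun x : ι → Ξ => Function.update x q z₀) measurable_id hupd
  have hq := hξ q
  have m1 : IsProbabilityMeasure (P.map M) := Measure.isProbabilityMeasure_map hM.aemeasurable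
  have m2 : IsProbabilityMeasure (P.map rest) := Measure.isProbabilityMeasure_map hrm.aemeasurable
  have m3 : IsProbabilityMeasure (P.map (ξ q)) := Measure.isProbabilityMeasure_map hq.aemeasurable
  rw [indepFun_iff_map_prod_eq_prod_map_map hM.aemeasurable (hrm.prodMk hq).aemeasurable,
    (indepFun_iff_map_prod_eq_prod_map_map hrm.aemeasurable hq.aemeasurable).mp h1] at h2
  rw [indepFun_iff_map_prod_eq_prod_map_map (hM.prodMk hrm).aemeasurable hq.aemeasurable,
    (indepFun_iff_map_prod_eq_prod_map_map hM.aemeasurable hrm.aemeasurable).mp h3]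
  -- the joint law is a product of three measures, so the brackets may be moved
  have h4 : P.map (fun ω => ((M ω, rest ω), ξ q ω))
      = (P.map (fun ω => (M ω, (rest ω, ξ q ω)))).map MeasurableEquiv.prodAssoc.symm := by
    rw [Measure.map_map MeasurableEquiv.prodAssoc.symm.measurable (hM.prodMk (hrm.prodMk hq))]
    rfl
  rw [h4, h2, ← Measure.prodAssoc_prod, Measure.map_map MeasurableEquiv.prodAssoc.symm.measurable
    MeasurableEquiv.prodAssoc.measurable]
  simp

variable {𝒵 Ξ : Type*} [MeasurableSpace 𝒵] [MeasurableSpace Ξ] {Z : Ω → 𝒵} {ξ : Ω → Ξ}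
  {D : Measure Ξ} [IsProbabilityMeasure P] [IsProbabilityMeasure D]

/-- A function of `Z` is uncorrelated with a function of `(Z, ξ)` that is centered given `Z`. Only
the product is assumed integrable, which is what Fubini's theorem needs. -/
lemma integral_mul_eq_zero_of_indepFun (hZ : Measurable Z) (hξ : Measurable ξ)
    (hind : IndepFun Z ξ P) (hD : P.map ξ = D) {w : 𝒵 → ℝ} {h : 𝒵 × Ξ → ℝ} (hw : Measurable w)
    (hh : Measurable h) (h0 : ∀ z, ∫ x, h (z, x) ∂D = 0)
    (hint : Integrable (fun ω => w (Z ω) * h (Z ω, ξ ω)) P) :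
    ∫ ω, w (Z ω) * h (Z ω, ξ ω) ∂P = 0 := by
  have hm : IsProbabilityMeasure (P.map Z) := Measure.isProbabilityMeasure_map hZ.aemeasurable
  have hmap : P.map (fun ω => (Z ω, ξ ω)) = (P.map Z).prod D := by
    rw [(indepFun_iff_map_prod_eq_prod_map_map hZ.aemeasurable hξ.aemeasurable).mp hind, hD]
  have hmeas : Measurable fun y : 𝒵 × Ξ => w y.1 * h y := (hw.comp measurable_fst).mul hh
  have hpair := (hZ.prodMk hξ).aemeasurable (μ := P)
  have hint' : Integrable (fun y : 𝒵 × Ξ => w y.1 * h y) ((P.map Z).prod D) := by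
    rw [← hmap, integrable_map_measure hmeas.aestronglyMeasurable hpair]
    exact hint
  calc ∫ ω, w (Z ω) * h (Z ω, ξ ω) ∂P
      = ∫ y, w y.1 * h y ∂((P.map Z).prod D) := by
        rw [← hmap, integral_map hpair hmeas.aestronglyMeasurable]
    _ = ∫ z, ∫ x, w z * h (z, x) ∂D ∂(P.map Z) := integral_prod _ hint'
    _ = 0 := by simp [integral_const_mul, h0]

/-- A bound on a conditional expectation given `Z` bounds the expectation. -/
lemma lintegral_le_of_indepFun (hZ : Measurable Z) (hξ : Measurable ξ)
    (hind : IndepFun Z ξ P) (hD : P.map ξ = D) {h : 𝒵 × Ξ → ENNReal} (hh : Measurable h)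
    {c : ENNReal} (hc : ∀ z, ∫⁻ x, h (z, x) ∂D ≤ c) : ∫⁻ ω, h (Z ω, ξ ω) ∂P ≤ c := by
  have hm : IsProbabilityMeasure (P.map Z) := Measure.isProbabilityMeasure_map hZ.aemeasurable
  have hmap : P.map (fun ω => (Z ω, ξ ω)) = (P.map Z).prod D := by
    rw [(indepFun_iff_map_prod_eq_prod_map_map hZ.aemeasurable hξ.aemeasurable).mp hind, hD]
  calc ∫⁻ ω, h (Z ω, ξ ω) ∂P = ∫⁻ y, h y ∂((P.map Z).prod D) := by
        rw [← hmap, lintegral_map hh (hZ.prodMk hξ)]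
    _ = ∫⁻ z, ∫⁻ x, h (z, x) ∂D ∂(P.map Z) := lintegral_prod _ hh.aemeasurable
    _ ≤ ∫⁻ _z, c ∂(P.map Z) := lintegral_mono hc
    _ = c := by simp

lemma integral_le_of_integral_sq_le {f : Ω → ℝ} (hf : Integrable f P)
    (hf2 : Integrable (fun ω => f ω ^ 2) P) {c : ℝ} (hc : 0 ≤ c) (h : ∫ ω, f ω ^ 2 ∂P ≤ c ^ 2) :
    ∫ ω, f ω ∂P ≤ c := by
  set m := ∫ ω, f ω ∂P with hm
  have h1 : 0 ≤ ∫ ω, (f ω ^ 2 - 2 * m * f ω + m ^ 2) ∂P :=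
    integral_nonneg fun ω => by
      have : f ω ^ 2 - 2 * m * f ω + m ^ 2 = (f ω - m) ^ 2 := by ring
      simp only [Pi.zero_apply]
      rw [this]; positivity
  have hi : Integrable (fun ω => f ω ^ 2 - 2 * m * f ω) P := hf2.sub (hf.const_mul _)
  rw [integral_add hi (integrable_const _), integral_sub hf2 (hf.const_mul _),
    integral_const_mul, ← hm] at h1
  simp only [integral_const, probReal_univ, one_smul] at h1
  exact abs_le_of_sq_le_sq' (by nlinarith) hc |>.2

/-- Without measurability, the lower integral is superadditive. So a bound on the integral of a sum
bounds the sum of the integrals, although the integrands need not be measurable. -/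
lemma sum_lintegral_le {ι : Type*} (s : Finset ι) (f : ι → Ω → ENNReal) :
    ∑ i ∈ s, ∫⁻ ω, f i ω ∂P ≤ ∫⁻ ω, ∑ i ∈ s, f i ω ∂P := by
  classical
  induction s using Finset.induction_on with
  | empty => simp
  | insert a s ha ih =>
    simp only [Finset.sum_insert ha]
    exact (add_le_add le_rfl ih).trans (le_lintegral_add _ _)

end Probability

section SecondMoments

variable {d₁ d₂ : ℕ} {Ω : Type*} [MeasurableSpace Ω] {P : Measure Ω} [IsProbabilityMeasure P]

instance instBorelSpaceMat : BorelSpace (Mat d₁ d₂) :=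
  inferInstanceAs (BorelSpace (Fin d₁ → Fin d₂ → ℝ))

instance instSecondCountableMat : SecondCountableTopology (Mat d₁ d₂) :=
  inferInstanceAs (SecondCountableTopology (Fin d₁ → Fin d₂ → ℝ))

lemma continuous_frobNorm : Continuous (frobNorm : Mat d₁ d₂ → ℝ) := by
  unfold frobNorm
  fun_prop

lemma measurable_frobNorm : Measurable (frobNorm : Mat d₁ d₂ → ℝ) := continuous_frobNorm.measurable

lemma measurable_entry (a : Fin d₁) (b : Fin d₂) : Measurable fun A : Mat d₁ d₂ => A a b :=
  (continuous_id.matrix_elem a b).measurable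

lemma sq_entry_le (A : Mat d₁ d₂) (a : Fin d₁) (b : Fin d₂) : A a b ^ 2 ≤ frobNorm A ^ 2 := by
  rw [frobNorm_sq]
  exact (Finset.single_le_sum (f := fun b => A a b ^ 2) (fun _ _ => sq_nonneg _)
    (Finset.mem_univ b)).trans (Finset.single_le_sum (f := fun a => ∑ b, A a b ^ 2)
      (fun _ _ => Finset.sum_nonneg fun _ _ => sq_nonneg _) (Finset.mem_univ a))

omit [IsProbabilityMeasure P] in
lemma integrable_entry_mul {V W : Ω → Mat d₁ d₂} (hV : Measurable V) (hW : Measurable W)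
    (hV2 : Integrable (fun ω => frobNorm (V ω) ^ 2) P)
    (hW2 : Integrable (fun ω => frobNorm (W ω) ^ 2) P) (a : Fin d₁) (b : Fin d₂) :
    Integrable (fun ω => V ω a b * W ω a b) P := by
  refine (hV2.add hW2).mono'
    (((measurable_entry a b).comp hV).mul ((measurable_entry a b).comp hW)).aestronglyMeasurable
    (ae_of_all _ fun ω => ?_)
  have h1 := sq_entry_le (V ω) a b
  have h2 := sq_entry_le (W ω) a b
  rw [Real.norm_eq_abs, abs_mul, Pi.add_apply]
  nlinarith [sq_nonneg (|V ω a b| - |W ω a b|), sq_abs (V ω a b), sq_abs (W ω a b),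
    sq_nonneg (V ω a b), sq_nonneg (W ω a b)]

omit [IsProbabilityMeasure P] in
lemma integrable_innerM {V W : Ω → Mat d₁ d₂} (hV : Measurable V) (hW : Measurable W)
    (hV2 : Integrable (fun ω => frobNorm (V ω) ^ 2) P)
    (hW2 : Integrable (fun ω => frobNorm (W ω) ^ 2) P) :
    Integrable (fun ω => innerM (V ω) (W ω)) P :=
  integrable_finsetSum _ fun a _ => integrable_finsetSum _ fun b _ =>
    integrable_entry_mul hV hW hV2 hW2 a b

lemma integrable_frobNorm {V : Ω → Mat d₁ d₂} (hV : Measurable V)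
    (hV2 : Integrable (fun ω => frobNorm (V ω) ^ 2) P) :
    Integrable (fun ω => frobNorm (V ω)) P := by
  refine (hV2.add (integrable_const 1)).mono' (measurable_frobNorm.comp hV).aestronglyMeasurable
    (ae_of_all _ fun ω => ?_)
  rw [Real.norm_eq_abs, abs_of_nonneg (frobNorm_nonneg _), Pi.add_apply]
  nlinarith [sq_nonneg (frobNorm (V ω) - 1), frobNorm_nonneg (V ω)]

lemma frobNorm_sum_smul_sq {ι : Type*} (s : Finset ι) (c : ι → ℝ) (V : ι → Mat d₁ d₂) :
    frobNorm (∑ q ∈ s, c q • V q) ^ 2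
      = ∑ q ∈ s, ∑ q' ∈ s, c q * c q' * innerM (V q) (V q') := by
  rw [← innerM_self, innerM_sum_right, Finset.sum_comm]
  refine Finset.sum_congr rfl fun q _ => ?_
  rw [innerM_comm, innerM_sum_right]
  refine Finset.sum_congr rfl fun q' _ => ?_
  rw [innerM_smul_left, innerM_smul_right, innerM_comm]
  ring

/-- Pythagoras for linear combinations of uncorrelated matrices, followed by the inequality between
the first and the second moment. -/
lemma integral_frobNorm_sum_le {ι : Type*} (s : Finset ι) (c : ι → ℝ) {V : ι → Ω → Mat d₁ d₂}
    {σ : ℝ} (hσ : 0 ≤ σ) (hm : ∀ q, Measurable (V q))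
    (h2 : ∀ q, Integrable (fun ω => frobNorm (V q ω) ^ 2) P)
    (hle : ∀ q, ∫ ω, frobNorm (V q ω) ^ 2 ∂P ≤ σ ^ 2)
    (horth : ∀ q q', q ≠ q' → ∫ ω, innerM (V q ω) (V q' ω) ∂P = 0) :
    Integrable (fun ω => frobNorm (∑ q ∈ s, c q • V q ω)) P ∧
      ∫ ω, frobNorm (∑ q ∈ s, c q • V q ω) ∂P ≤ σ * √(∑ q ∈ s, c q ^ 2) := by
  classical
  have hterm : ∀ q q', Integrable (fun ω => c q * c q' * innerM (V q ω) (V q' ω)) P := fun q q' =>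
    (integrable_innerM (hm q) (hm q') (h2 q) (h2 q')).const_mul _
  have hi2 : Integrable (fun ω => frobNorm (∑ q ∈ s, c q • V q ω) ^ 2) P := by
    simp only [frobNorm_sum_smul_sq]
    exact integrable_finsetSum _ fun q _ => integrable_finsetSum _ fun q' _ => hterm q q'
  have hmeas : Measurable fun ω => ∑ q ∈ s, c q • V q ω :=
    Finset.measurable_fun_sum s fun q _ => (hm q).const_smul (c q)
  have hi1 := integrable_frobNorm hmeas hi2
  refine ⟨hi1, integral_le_of_integral_sq_le hi1 hi2 (by positivity) ?_⟩
  have hS : 0 ≤ ∑ q ∈ s, c q ^ 2 := Finset.sum_nonneg fun _ _ => sq_nonneg _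
  rw [mul_pow, Real.sq_sqrt hS]
  simp only [frobNorm_sum_smul_sq]
  rw [integral_finsetSum _ fun q _ => integrable_finsetSum _ fun q' _ => hterm q q', Finset.mul_sum]
  refine Finset.sum_le_sum fun q hq => ?_
  rw [integral_finsetSum _ fun q' _ => hterm q q', Finset.sum_eq_single_of_mem q hq]
  · rw [integral_const_mul]
    simp only [innerM_self]
    have := hle q
    nlinarith [sq_nonneg (c q)]
  · intro q' _ hq'
    rw [integral_const_mul, horth q q' hq'.symm, mul_zero]

end SecondMoments

/-! ### Measurability and the noise of the stochastic gradients -/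

section Measurability

variable {n d₁ d₂ : ℕ} {Θ : Type*} [MeasurableSpace Θ]

lemma measurable_nsOutput (a b c : ℝ) (T : ℕ) :
    Measurable (nsOutput a b c T : Mat d₁ d₂ → Mat d₁ d₂) := by
  have h1 : Measurable fun G : Mat d₁ d₂ => (frobNorm G)⁻¹ • G :=
    measurable_frobNorm.inv.smul measurable_id
  have h2 : Continuous (nsStep a b c : Mat d₁ d₂ → Mat d₁ d₂) := by
    unfold nsStep
    fun_prop
  exact ((h2.iterate T).measurable.comp h1).neg

lemma measurable_clientIter {lmo : Mat d₁ d₂ → Mat d₁ d₂} (hlmo : Measurable lmo) (η α : ℝ)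
    {g : Θ → ℕ → Mat d₁ d₂ → Mat d₁ d₂}
    (hg : ∀ k, Measurable fun q : Θ × Mat d₁ d₂ => g q.1 k q.2) {Ci C X₀ M₀ : Θ → Mat d₁ d₂}
    (hCi : Measurable Ci) (hC : Measurable C) (hX : Measurable X₀) (hM : Measurable M₀) (k : ℕ) :
    Measurable fun θ => clientIter lmo η α (g θ) (Ci θ) (C θ) (X₀ θ) (M₀ θ) k := by
  induction k with
  | zero => exact hX.prodMk hM
  | succ k ih =>
    have hm : Measurable fun θ =>
        (1 - α) • (clientIter lmo η α (g θ) (Ci θ) (C θ) (X₀ θ) (M₀ θ) k).2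
          + α • g θ k (clientIter lmo η α (g θ) (Ci θ) (C θ) (X₀ θ) (M₀ θ) k).1 :=
      (ih.snd.const_smul (1 - α)).add (((hg k).comp (measurable_id.prodMk ih.fst)).const_smul α)
    exact (ih.fst.add ((hlmo.comp ((hm.sub hCi).add hC)).const_smul η)).prodMk hm

lemma measurable_fedState {lmo : Mat d₁ d₂ → Mat d₁ d₂} (hlmo : Measurable lmo) (η α : ℝ) (K : ℕ)
    {g : Θ → ℕ → ℕ → Fin n → Mat d₁ d₂ → Mat d₁ d₂}
    (hg : ∀ r k i, Measurable fun q : Θ × Mat d₁ d₂ => g q.1 r k i q.2) (X₀ : Mat d₁ d₂)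
    {M₀ : Θ → Fin n → Mat d₁ d₂} (hM : ∀ i, Measurable fun θ => M₀ θ i) (r : ℕ) :
    Measurable (fun θ => (fedState lmo η α K (g θ) X₀ (M₀ θ) r).X) ∧
      (∀ i, Measurable fun θ => (fedState lmo η α K (g θ) X₀ (M₀ θ) r).M i) := by
  induction r with
  | zero => exact ⟨measurable_const, hM⟩
  | succ r ih =>
    have hC : Measurable fun θ => (fedState lmo η α K (g θ) X₀ (M₀ θ) r).C := by
      simp only [fedState_C]
      exact (Finset.measurable_fun_sum _ fun i _ => ih.2 i).const_smul (1 / (n : ℝ))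
    have hl : ∀ i, Measurable fun θ => localIter lmo η α (g θ r)
        (fedState lmo η α K (g θ) X₀ (M₀ θ) r) i K := fun i =>
      measurable_clientIter hlmo η α (g := fun θ k => g θ r k i) (fun k => hg r k i)
        (by simpa only [fedState_Cc] using ih.2 i) hC ih.1 (ih.2 i) K
    have hX :=
      (Finset.measurable_fun_sum Finset.univ fun i _ => (hl i).fst).const_smul (1 / (n : ℝ))
    exact ⟨hX, fun i => (hl i).snd⟩

lemma measurable_flatIter {lmo : Mat d₁ d₂ → Mat d₁ d₂} (hlmo : Measurable lmo) (η α : ℝ) (K : ℕ)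
    {g : Θ → ℕ → ℕ → Fin n → Mat d₁ d₂ → Mat d₁ d₂}
    (hg : ∀ r k i, Measurable fun q : Θ × Mat d₁ d₂ => g q.1 r k i q.2) (X₀ : Mat d₁ d₂)
    {M₀ : Θ → Fin n → Mat d₁ d₂} (hM : ∀ i, Measurable fun θ => M₀ θ i) (t : ℕ) (i : Fin n) :
    Measurable fun θ => flatIter lmo η α K (g θ) X₀ (M₀ θ) t i := by
  have ih := measurable_fedState hlmo η α K hg X₀ hM (t / K)
  have hC : Measurable fun θ => (fedState lmo η α K (g θ) X₀ (M₀ θ) (t / K)).C := by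
    simp only [fedState_C]
    exact (Finset.measurable_fun_sum _ fun i _ => ih.2 i).const_smul (1 / (n : ℝ))
  exact measurable_clientIter hlmo η α (g := fun θ k => g θ (t / K) k i)
    (fun k => hg (t / K) k i) (by simpa only [fedState_Cc] using ih.2 i) hC ih.1 (ih.2 i) (t % K)

end Measurability

section Noise

variable {n d₁ d₂ : ℕ} {Ξ : Type*} [MeasurableSpace Ξ]

/-- The stochastic gradients that belong to the samples `x r k i`. -/
def sampleGrad (F : Fin n → Mat d₁ d₂ → Ξ → ℝ) (x : ℕ × ℕ × Fin n → Ξ) (r k : ℕ) (i : Fin n)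
    (Y : Mat d₁ d₂) : Mat d₁ d₂ := stochGrad F i Y (x (r, k, i))

/-- The noise of client `i` at global time `t`, as a function of the initial momenta and of the
samples. -/
def flatNoise (lmo : Mat d₁ d₂ → Mat d₁ d₂) (η α : ℝ) (K : ℕ) (𝒟 : Fin n → Measure Ξ)
    (F : Fin n → Mat d₁ d₂ → Ξ → ℝ) (X₀ : Mat d₁ d₂) (t : ℕ) (i : Fin n)
    (z : (Fin n → Mat d₁ d₂) × (ℕ × ℕ × Fin n → Ξ)) : Mat d₁ d₂ :=
  stochGrad F i (flatIter lmo η α K (sampleGrad F z.2) X₀ z.1 t i).1 (z.2 (t / K, t % K, i))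
    - grad (clientLoss 𝒟 F i) (flatIter lmo η α K (sampleGrad F z.2) X₀ z.1 t i).1

variable {lmo : Mat d₁ d₂ → Mat d₁ d₂} {η α : ℝ} {K : ℕ} {𝒟 : Fin n → Measure Ξ}
  {F : Fin n → Mat d₁ d₂ → Ξ → ℝ} {X₀ : Mat d₁ d₂}

lemma measurable_stochGrad (hR : RegularLoss 𝒟 F) (i : Fin n) :
    Measurable fun q : Mat d₁ d₂ × Ξ => stochGrad F i q.1 q.2 := (hR i).2.2.1

lemma measurable_of_entries {Θ : Type*} [MeasurableSpace Θ] {f : Θ → Mat d₁ d₂}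
    (h : ∀ a b, Measurable fun θ => f θ a b) : Measurable f :=
  measurable_pi_iff.mpr fun a => measurable_pi_iff.mpr fun b => h a b

/-- The gradient of a client loss is measurable as it is the mean of the stochastic gradient. -/
lemma measurable_grad_clientLoss [∀ i, IsProbabilityMeasure (𝒟 i)] {σ : ℝ} (hR : RegularLoss 𝒟 F)
    (hB : BoundedNoise 𝒟 F σ) (i : Fin n) : Measurable (grad (clientLoss 𝒟 F i)) := by
  refine measurable_of_entries fun a b => ?_
  have h : Measurable fun q : Mat d₁ d₂ × Ξ => stochGrad F i q.1 q.2 a b :=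
    (measurable_entry a b).comp (measurable_stochGrad hR i)
  have h2 := (h.stronglyMeasurable.integral_prod_right' (ν := 𝒟 i)).measurable
  simpa only [((hB i _).1 a b).2] using h2

lemma measurable_sampleGrad (hR : RegularLoss 𝒟 F) (r k : ℕ) (i : Fin n) :
    Measurable fun q : ((Fin n → Mat d₁ d₂) × (ℕ × ℕ × Fin n → Ξ)) × Mat d₁ d₂ =>
      sampleGrad F q.1.2 r k i q.2 :=
  (measurable_stochGrad hR i).comp
    (measurable_snd.prodMk ((measurable_pi_apply (r, k, i)).comp measurable_fst.snd))

lemma measurable_flatIter_sample (hlmo : Measurable lmo) (hR : RegularLoss 𝒟 F) (t : ℕ)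
    (i : Fin n) : Measurable fun z : (Fin n → Mat d₁ d₂) × (ℕ × ℕ × Fin n → Ξ) =>
      (flatIter lmo η α K (sampleGrad F z.2) X₀ z.1 t i).1 :=
  (measurable_flatIter hlmo η α K (fun r k i => measurable_sampleGrad hR r k i) X₀
    (fun i => (measurable_pi_apply i).comp measurable_fst) t i).fst

lemma measurable_flatNoise [∀ i, IsProbabilityMeasure (𝒟 i)] {σ : ℝ} (hlmo : Measurable lmo)
    (hR : RegularLoss 𝒟 F) (hB : BoundedNoise 𝒟 F σ) (t : ℕ) (i : Fin n) :
    Measurable (flatNoise lmo η α K 𝒟 F X₀ t i) := by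
  have h := measurable_flatIter_sample (η := η) (α := α) (K := K) (X₀ := X₀) hlmo hR t i
  exact ((measurable_stochGrad hR i).comp
    (h.prodMk ((measurable_pi_apply (t / K, t % K, i)).comp measurable_snd))).sub
    ((measurable_grad_clientLoss hR hB i).comp h)

lemma div_mod_index_inj {s t : ℕ} {i j : Fin n}
    (h : (s / K, s % K, i) = (t / K, t % K, j)) : s = t ∧ i = j := by
  simp only [Prod.mk.injEq] at h
  obtain ⟨h1, h2, h3⟩ := h
  refine ⟨?_, h3⟩
  rw [← Nat.div_add_mod s K, ← Nat.div_add_mod t K, h1, h2]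

omit [MeasurableSpace Ξ] in
/-- The local iterates at time `t` do not depend on the samples of time `t` or later. -/
lemma flatIter_update (hK : 0 < K) (z : (Fin n → Mat d₁ d₂) × (ℕ × ℕ × Fin n → Ξ)) {s t : ℕ}
    (hst : s ≤ t) (i j : Fin n) (ζ : Ξ) :
    flatIter lmo η α K (sampleGrad F (Function.update z.2 (t / K, t % K, j) ζ)) X₀ z.1 s i
      = flatIter lmo η α K (sampleGrad F z.2) X₀ z.1 s i := by
  refine flatIter_congr lmo η α X₀ z.1 hK s (fun u hu => ?_) i
  funext i' Y
  rw [sampleGrad, sampleGrad, Function.update_of_ne]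
  intro h
  have := (div_mod_index_inj h).1
  omega

/-- The noise does not depend on any other sample of the same time, nor on a later one. -/
lemma flatNoise_update (hK : 0 < K) (z : (Fin n → Mat d₁ d₂) × (ℕ × ℕ × Fin n → Ξ)) {s t : ℕ}
    (hst : s ≤ t) {i j : Fin n} (hne : (s, i) ≠ (t, j)) (ζ : Ξ) :
    flatNoise lmo η α K 𝒟 F X₀ s i (z.1, Function.update z.2 (t / K, t % K, j) ζ)
      = flatNoise lmo η α K 𝒟 F X₀ s i z := by
  simp only [flatNoise]
  rw [flatIter_update hK z hst, Function.update_of_ne]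
  intro h
  obtain ⟨rfl, rfl⟩ := div_mod_index_inj h
  exact hne rfl

variable {Ω : Type*} [MeasurableSpace Ω] {P : Measure Ω} [IsProbabilityMeasure P]
  [∀ i, IsProbabilityMeasure (𝒟 i)] {σ : ℝ}
  {M₀ : Ω → Fin n → Mat d₁ d₂} {ξ : ℕ × ℕ × Fin n → Ω → Ξ}

/-- The iterate at which a gradient is sampled is independent of the sample, so that the bound on
the variance at fixed points applies. -/
lemma flatNoise_secondMoment (hK : 0 < K) (hlmo : Measurable lmo) (hR : RegularLoss 𝒟 F)
    (hB : BoundedNoise 𝒟 F σ) (hM : Measurable M₀) (hξ : ∀ q, Measurable (ξ q))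
    (hD : ∀ q, P.map (ξ q) = 𝒟 q.2.2) (hind : iIndepFun ξ P)
    (hMξ : IndepFun M₀ (fun ω q => ξ q ω) P) (t : ℕ) (i : Fin n) :
    Integrable (fun ω => frobNorm (flatNoise lmo η α K 𝒟 F X₀ t i (M₀ ω, fun q => ξ q ω)) ^ 2) P ∧
      ∫ ω, frobNorm (flatNoise lmo η α K 𝒟 F X₀ t i (M₀ ω, fun q => ξ q ω)) ^ 2 ∂P ≤ σ ^ 2 := by
  obtain ⟨z₀⟩ : Nonempty Ξ := (𝒟 i).nonempty_of_neZero
  set q : ℕ × ℕ × Fin n := (t / K, t % K, i) with hq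
  set Z : Ω → (Fin n → Mat d₁ d₂) × (ℕ × ℕ × Fin n → Ξ) :=
    fun ω => (M₀ ω, Function.update (fun q' => ξ q' ω) q z₀) with hZ
  have hallm : Measurable fun ω q => ξ q ω := measurable_pi_iff.mpr hξ
  have hZm : Measurable Z := by
    refine hM.prodMk (measurable_pi_iff.mpr fun i => ?_)
    rcases eq_or_ne i q with rfl | h
    · simp
    · simpa [Function.update_of_ne h] using hξ i
  have hZind : IndepFun Z (ξ q) P := indepFun_update hξ hM hind hMξ q z₀
  have hX := measurable_flatIter_sample (η := η) (α := α) (K := K) (X₀ := X₀) hlmo hR t i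
  set h : ((Fin n → Mat d₁ d₂) × (ℕ × ℕ × Fin n → Ξ)) × Ξ → ENNReal := fun y =>
    ENNReal.ofReal (frobNorm
      (stochGrad F i (flatIter lmo η α K (sampleGrad F y.1.2) X₀ y.1.1 t i).1 y.2
        - grad (clientLoss 𝒟 F i) (flatIter lmo η α K (sampleGrad F y.1.2) X₀ y.1.1 t i).1) ^ 2)
    with hh
  have hhm : Measurable h := by
    have hX' : Measurable fun y : ((Fin n → Mat d₁ d₂) × (ℕ × ℕ × Fin n → Ξ)) × Ξ =>
      (flatIter lmo η α K (sampleGrad F y.1.2) X₀ y.1.1 t i).1 := hX.comp measurable_fst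
    exact ((measurable_frobNorm.comp (((measurable_stochGrad hR i).comp
      (hX'.prodMk measurable_snd)).sub
        ((measurable_grad_clientLoss hR hB i).comp hX'))).pow_const 2).ennreal_ofReal
  have hle := lintegral_le_of_indepFun hZm (hξ q) hZind (hD q) hhm
    (c := ENNReal.ofReal (σ ^ 2)) fun z => by
      obtain ⟨-, h2, h3⟩ := hB i (flatIter lmo η α K (sampleGrad F z.2) X₀ z.1 t i).1
      simp only [hh]
      rw [← ofReal_integral_eq_lintegral_ofReal h2 (ae_of_all _ fun _ => sq_nonneg _)]
      exact ENNReal.ofReal_le_ofReal h3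
  have he : ∀ ω, h (Z ω, ξ q ω) = ENNReal.ofReal
      (frobNorm (flatNoise lmo η α K 𝒟 F X₀ t i (M₀ ω, fun q => ξ q ω)) ^ 2) := by
    intro ω
    simp only [hh, hZ, flatNoise]
    rw [flatIter_update hK (M₀ ω, fun q => ξ q ω) le_rfl]
  simp only [he] at hle
  have hmeas : Measurable fun ω =>
      frobNorm (flatNoise lmo η α K 𝒟 F X₀ t i (M₀ ω, fun q => ξ q ω)) ^ 2 :=
    (measurable_frobNorm.comp ((measurable_flatNoise hlmo hR hB t i).comp
      (hM.prodMk hallm))).pow_const 2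
  have hint : Integrable (fun ω =>
      frobNorm (flatNoise lmo η α K 𝒟 F X₀ t i (M₀ ω, fun q => ξ q ω)) ^ 2) P := by
    refine ⟨hmeas.aestronglyMeasurable, ?_⟩
    rw [hasFiniteIntegral_iff_ofReal (ae_of_all _ fun _ => sq_nonneg _)]
    exact hle.trans_lt ENNReal.ofReal_lt_top
  refine ⟨hint, ?_⟩
  rw [← ofReal_integral_eq_lintegral_ofReal hint (ae_of_all _ fun _ => sq_nonneg _)] at hle
  exact (ENNReal.ofReal_le_ofReal_iff (sq_nonneg σ)).mp hle

/-- The noises of different clients or times are uncorrelated: the earlier one is a function of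
the initialization and the samples other than that of the later one. -/
lemma flatNoise_uncorrelated (hK : 0 < K) (hlmo : Measurable lmo) (hR : RegularLoss 𝒟 F)
    (hB : BoundedNoise 𝒟 F σ) (hM : Measurable M₀) (hξ : ∀ q, Measurable (ξ q))
    (hD : ∀ q, P.map (ξ q) = 𝒟 q.2.2) (hind : iIndepFun ξ P)
    (hMξ : IndepFun M₀ (fun ω q => ξ q ω) P) {p p' : ℕ × Fin n} (hne : p ≠ p') :
    ∫ ω, innerM (flatNoise lmo η α K 𝒟 F X₀ p.1 p.2 (M₀ ω, fun q => ξ q ω))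
      (flatNoise lmo η α K 𝒟 F X₀ p'.1 p'.2 (M₀ ω, fun q => ξ q ω)) ∂P = 0 := by
  wlog hst : p.1 ≤ p'.1 generalizing p p'
  · simpa only [innerM_comm] using this hne.symm (le_of_not_ge hst)
  obtain ⟨s, i⟩ := p
  obtain ⟨t, j⟩ := p'
  simp only at hst ⊢
  obtain ⟨z₀⟩ : Nonempty Ξ := (𝒟 i).nonempty_of_neZero
  set q : ℕ × ℕ × Fin n := (t / K, t % K, j) with hq
  set Z : Ω → (Fin n → Mat d₁ d₂) × (ℕ × ℕ × Fin n → Ξ) :=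
    fun ω => (M₀ ω, Function.update (fun q' => ξ q' ω) q z₀) with hZ
  have hallm : Measurable fun ω q => ξ q ω := measurable_pi_iff.mpr hξ
  have hZm : Measurable Z := by
    refine hM.prodMk (measurable_pi_iff.mpr fun i => ?_)
    rcases eq_or_ne i q with rfl | h
    · simp
    · simpa [Function.update_of_ne h] using hξ i
  have hZind : IndepFun Z (ξ q) P := indepFun_update hξ hM hind hMξ q z₀
  have hm2 := fun t i => flatNoise_secondMoment (η := η) (α := α) (X₀ := X₀)
    hK hlmo hR hB hM hξ hD hind hMξ t i
  have hnm : ∀ t i, Measurable fun ω => flatNoise lmo η α K 𝒟 F X₀ t i (M₀ ω, fun q => ξ q ω) :=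
    fun t i => (measurable_flatNoise hlmo hR hB t i).comp (hM.prodMk hallm)
  have hint := fun a b => integrable_entry_mul (hnm s i) (hnm t j) (hm2 s i).1 (hm2 t j).1 a b
  have hX : Measurable fun y : ((Fin n → Mat d₁ d₂) × (ℕ × ℕ × Fin n → Ξ)) × Ξ =>
      (flatIter lmo η α K (sampleGrad F y.1.2) X₀ y.1.1 t j).1 :=
    (measurable_flatIter_sample hlmo hR t j).comp measurable_fst
  set h : ((Fin n → Mat d₁ d₂) × (ℕ × ℕ × Fin n → Ξ)) × Ξ → Mat d₁ d₂ := fun y =>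
      stochGrad F j (flatIter lmo η α K (sampleGrad F y.1.2) X₀ y.1.1 t j).1 y.2
        - grad (clientLoss 𝒟 F j) (flatIter lmo η α K (sampleGrad F y.1.2) X₀ y.1.1 t j).1
    with hh
  have hhm : Measurable h := ((measurable_stochGrad hR j).comp (hX.prodMk measurable_snd)).sub
    ((measurable_grad_clientLoss hR hB j).comp hX)
  have he1 : ∀ ω, flatNoise lmo η α K 𝒟 F X₀ s i (Z ω)
      = flatNoise lmo η α K 𝒟 F X₀ s i (M₀ ω, fun q => ξ q ω) := fun ω =>
    flatNoise_update hK (M₀ ω, fun q => ξ q ω) hst hne z₀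
  have he2 : ∀ ω, h (Z ω, ξ q ω) = flatNoise lmo η α K 𝒟 F X₀ t j (M₀ ω, fun q => ξ q ω) := by
    intro ω
    simp only [hh, hZ, flatNoise]
    rw [flatIter_update hK (M₀ ω, fun q => ξ q ω) le_rfl]
  have hzero : ∀ a b, ∫ ω, flatNoise lmo η α K 𝒟 F X₀ s i (M₀ ω, fun q => ξ q ω) a b
      * flatNoise lmo η α K 𝒟 F X₀ t j (M₀ ω, fun q => ξ q ω) a b ∂P = 0 := by
    intro a b
    have := integral_mul_eq_zero_of_indepFun (D := 𝒟 j) hZm (hξ q) hZind (hD q)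
      (w := fun z => flatNoise lmo η α K 𝒟 F X₀ s i z a b) (h := fun y => h y a b)
      ((measurable_entry a b).comp (measurable_flatNoise hlmo hR hB s i))
      ((measurable_entry a b).comp hhm) (fun z => by
        obtain ⟨h1, h2⟩ := (hB j (flatIter lmo η α K (sampleGrad F z.2) X₀ z.1 t j).1).1 a b
        simp only [hh, Matrix.sub_apply]
        rw [integral_sub h1 (integrable_const _), h2]
        simp) (by simpa only [he1, he2] using hint a b)
    simpa only [he1, he2] using this
  simp only [innerM]
  rw [integral_finsetSum _ fun a _ => integrable_finsetSum _ fun b _ => hint a b]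
  refine Finset.sum_eq_zero fun a _ => ?_
  rw [integral_finsetSum _ fun b _ => hint a b]
  exact Finset.sum_eq_zero fun b _ => hzero a b

end Noise

/-! ### Expected size of the accumulated noise -/

section Series

/-- The squares of the weights of the noise in the momentum: the geometric series for many steps,
and the trivial bound for few. -/
lemma sum_sq_weights_le {α : ℝ} (h0 : 0 ≤ α) (h1 : α ≤ 1) (m : ℕ) :
    ∑ j ∈ Finset.range m, (α * (1 - α) ^ (m - 1 - j)) ^ 2 ≤ α ∧
      ∑ j ∈ Finset.range m, (α * (1 - α) ^ (m - 1 - j)) ^ 2 ≤ α ^ 2 * m := by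
  rw [Finset.sum_range_reflect (fun j => (α * (1 - α) ^ j) ^ 2) m]
  constructor
  · have h : ∀ m : ℕ, ∑ j ∈ Finset.range m, (α * (1 - α) ^ j) ^ 2
        ≤ α * (1 - ((1 - α) ^ m) ^ 2) := by
      intro m
      induction m with
      | zero => simp
      | succ m ih =>
        rw [Finset.sum_range_succ]
        have : 0 ≤ ((1 - α) ^ m) ^ 2 * (α ^ 2 * (1 - α)) :=
          mul_nonneg (sq_nonneg _) (mul_nonneg (sq_nonneg _) (by linarith))
        have e : (1 - α) ^ (m + 1) = (1 - α) ^ m * (1 - α) := pow_succ _ _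
        rw [e]
        nlinarith
    refine (h m).trans (mul_le_of_le_one_right h0 ?_)
    nlinarith [sq_nonneg ((1 - α) ^ m)]
  · calc ∑ j ∈ Finset.range m, (α * (1 - α) ^ j) ^ 2 ≤ ∑ _j ∈ Finset.range m, α ^ 2 := by
          refine Finset.sum_le_sum fun j _ => ?_
          rw [mul_pow]
          refine mul_le_of_le_one_right (sq_nonneg _) ?_
          exact pow_le_one₀ (pow_nonneg (by linarith) _) (pow_le_one₀ (by linarith) (by linarith))
      _ = α ^ 2 * m := by rw [Finset.sum_const, Finset.card_range, nsmul_eq_mul, mul_comm]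

/-- The control variates multiply the noise of the earlier rounds, of size `√α`, by
`1 - (1 - α) ^ m`. The product is no larger than the noise of the `m` steps of the current round. -/
lemma one_sub_pow_mul_sqrt_le {α : ℝ} (h0 : 0 ≤ α) (h1 : α ≤ 1) (m : ℕ) :
    (1 - (1 - α) ^ m) * √α ≤ α * √m := by
  have hb : 1 - m * α ≤ (1 - α) ^ m := by
    have := one_add_mul_le_pow (a := -α) (by linarith) m
    simpa [sub_eq_add_neg] using this
  have hp : 0 ≤ (1 - α) ^ m := pow_nonneg (by linarith) m
  have hp1 : (1 - α) ^ m ≤ 1 := pow_le_one₀ (by linarith) (by linarith)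
  have hle : 1 - (1 - α) ^ m ≤ √(m * α) := by
    refine Real.le_sqrt_of_sq_le ?_
    nlinarith
  calc (1 - (1 - α) ^ m) * √α ≤ √(m * α) * √α :=
        mul_le_mul_of_nonneg_right hle (Real.sqrt_nonneg _)
    _ = α * √m := by
        rw [Real.sqrt_mul (by positivity), mul_assoc, Real.mul_self_sqrt h0, mul_comm]

lemma sum_range_mul (f : ℕ → ℝ) (R K : ℕ) :
    ∑ t ∈ Finset.range (R * K), f t
      = ∑ r ∈ Finset.range R, ∑ k ∈ Finset.range K, f (r * K + k) := by
  induction R with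
  | zero => simp
  | succ R ih => rw [Nat.succ_mul, Finset.sum_range_add, ih, Finset.sum_range_succ]

/-- The total weight of the initialization error, at the beginnings of the rounds. -/
lemma sum_pow_round_le {α : ℝ} (h0 : 0 < α) (h1 : α ≤ 1) (R : ℕ) {K : ℕ} (hK : 0 < K) :
    ∑ t ∈ Finset.range (R * K), (1 - α) ^ (t / K * K) ≤ K * (1 + 1 / (α * K)) := by
  have hK' : (0 : ℝ) < K := by exact_mod_cast hK
  set q := (1 - α) ^ K with hq
  have hq0 : 0 ≤ q := pow_nonneg (by linarith) K
  have hαK : 0 < α * K := by positivity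
  have hq1 : q * (1 + α * K) ≤ 1 := by
    have h2 : 1 + K * α ≤ (1 + α) ^ K := one_add_mul_le_pow (by linarith) K
    calc q * (1 + α * K) ≤ q * (1 + α) ^ K :=
          mul_le_mul_of_nonneg_left (by linarith) hq0
      _ = ((1 - α) * (1 + α)) ^ K := by rw [hq, mul_pow]
      _ ≤ 1 := pow_le_one₀ (mul_nonneg (by linarith) (by linarith)) (by nlinarith)
  have hgeom : ∑ r ∈ Finset.range R, q ^ r ≤ 1 + 1 / (α * K) := by
    have hlt : q < 1 := by nlinarith
    have h3 : (∑ r ∈ Finset.range R, q ^ r) * (1 - q) ≤ 1 := by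
      rw [geom_sum_mul_neg]
      linarith [pow_nonneg hq0 R]
    have h4 : 1 ≤ (1 + 1 / (α * K)) * (1 - q) := by
      field_simp
      nlinarith
    exact le_of_mul_le_mul_right (h3.trans h4) (by linarith)
  rw [sum_range_mul]
  calc ∑ r ∈ Finset.range R, ∑ k ∈ Finset.range K, (1 - α) ^ ((r * K + k) / K * K)
      = ∑ r ∈ Finset.range R, K * q ^ r := by
        refine Finset.sum_congr rfl fun r _ => ?_
        rw [Finset.sum_congr rfl fun k hk => by
          rw [mul_add_div_of_lt (Finset.mem_range.mp hk), mul_comm r K, pow_mul]]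
        simp [hq]
    _ ≤ _ := by rw [← Finset.mul_sum]; exact mul_le_mul_of_nonneg_left hgeom hK'.le

end Series

section NoiseMoments

variable {n d₁ d₂ : ℕ} {Ω : Type*} [MeasurableSpace Ω] {P : Measure Ω} [IsProbabilityMeasure P]
  {V : ℕ × Fin n → Ω → Mat d₁ d₂} {α σ : ℝ}

lemma integral_noiseSum_le (hα : 0 ≤ α) (hα1 : α ≤ 1) (hσ : 0 ≤ σ) (hm : ∀ q, Measurable (V q))
    (h2 : ∀ q, Integrable (fun ω => frobNorm (V q ω) ^ 2) P)
    (hle : ∀ q, ∫ ω, frobNorm (V q ω) ^ 2 ∂P ≤ σ ^ 2)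
    (horth : ∀ q q', q ≠ q' → ∫ ω, innerM (V q ω) (V q' ω) ∂P = 0) (i : Fin n) (u m : ℕ) :
    Integrable (fun ω => frobNorm (noiseSum α (fun t => V (t, i) ω) u m)) P ∧
      ∫ ω, frobNorm (noiseSum α (fun t => V (t, i) ω) u m) ∂P ≤ σ * √α ∧
      ∫ ω, frobNorm (noiseSum α (fun t => V (t, i) ω) u m) ∂P ≤ σ * (α * √m) := by
  obtain ⟨h1, h3⟩ := integral_frobNorm_sum_le (Finset.range m)
    (fun j => α * (1 - α) ^ (m - 1 - j)) (V := fun j => V (u + j, i)) hσ (fun j => hm _)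
    (fun j => h2 _) (fun j => hle _) (fun j j' hj => horth _ _ (by simpa using hj))
  obtain ⟨s1, s2⟩ := sum_sq_weights_le hα hα1 m
  refine ⟨h1, h3.trans (mul_le_mul_of_nonneg_left (Real.sqrt_le_sqrt s1) hσ),
    h3.trans (mul_le_mul_of_nonneg_left ((Real.sqrt_le_sqrt s2).trans_eq ?_) hσ)⟩
  rw [Real.sqrt_mul (sq_nonneg _), Real.sqrt_sq hα]

/-- Averaging over the `n` independent clients reduces the variance by the factor `n`. -/
lemma integral_average_noiseSum_le (hα : 0 ≤ α) (hα1 : α ≤ 1) (hσ : 0 ≤ σ)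
    (hm : ∀ q, Measurable (V q)) (h2 : ∀ q, Integrable (fun ω => frobNorm (V q ω) ^ 2) P)
    (hle : ∀ q, ∫ ω, frobNorm (V q ω) ^ 2 ∂P ≤ σ ^ 2)
    (horth : ∀ q q', q ≠ q' → ∫ ω, innerM (V q ω) (V q' ω) ∂P = 0) (u : ℕ) :
    Integrable (fun ω =>
        frobNorm ((1 / (n : ℝ)) • ∑ j, noiseSum α (fun t => V (t, j) ω) 0 u)) P ∧
      ∫ ω, frobNorm ((1 / (n : ℝ)) • ∑ j, noiseSum α (fun t => V (t, j) ω) 0 u) ∂P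
        ≤ σ * √(α / n) := by
  have he : ∀ ω, (1 / (n : ℝ)) • ∑ j, noiseSum α (fun t => V (t, j) ω) 0 u
      = ∑ q ∈ Finset.range u ×ˢ Finset.univ,
        (1 / (n : ℝ) * (α * (1 - α) ^ (u - 1 - q.1))) • V q ω := by
    intro ω
    rw [Finset.sum_product, Finset.sum_comm, Finset.smul_sum]
    simp only [noiseSum, Finset.smul_sum, smul_smul, zero_add]
  obtain ⟨h1, h3⟩ := integral_frobNorm_sum_le (Finset.range u ×ˢ (Finset.univ : Finset (Fin n)))
    (fun q => 1 / (n : ℝ) * (α * (1 - α) ^ (u - 1 - q.1))) hσ hm h2 hle horth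
  simp only [he]
  refine ⟨h1, h3.trans (mul_le_mul_of_nonneg_left (Real.sqrt_le_sqrt ?_) hσ)⟩
  rw [Finset.sum_product]
  simp only [Finset.sum_const, Finset.card_univ, Fintype.card_fin, nsmul_eq_mul,
    mul_pow (1 / (n : ℝ))]
  rw [← Finset.mul_sum, ← Finset.mul_sum]
  have s1 := (sum_sq_weights_le hα hα1 u).1
  rcases Nat.eq_zero_or_pos n with rfl | hn
  · simp
  · have hn' : (0 : ℝ) < n := by exact_mod_cast hn
    calc (n : ℝ) * ((1 / (n : ℝ)) ^ 2 * ∑ j ∈ Finset.range u, (α * (1 - α) ^ (u - 1 - j)) ^ 2)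
        = (∑ j ∈ Finset.range u, (α * (1 - α) ^ (u - 1 - j)) ^ 2) / n := by field_simp
      _ ≤ α / n := div_le_div_of_nonneg_right s1 hn'.le

end NoiseMoments

/-! ### The bound for general parameters -/

section Descent

variable {n d₁ d₂ : ℕ} {Ξ : Type*} [MeasurableSpace Ξ] {𝒟 : Fin n → Measure Ξ}
  {F : Fin n → Mat d₁ d₂ → Ξ → ℝ} {L : ℝ}

/-- The descent inequality along a realization, summed over all local steps. -/
lemma sum_schattenNorm_le (hn : 0 < n) {R K : ℕ} (hK : 0 < K) (hL0 : 0 ≤ L)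
    (hR : RegularLoss 𝒟 F) (hL : SmoothLoss 𝒟 F L) (hb : BddBelow (Set.range (globalLoss 𝒟 F)))
    {η : ℝ} (hη : 0 < η) (α : ℝ) (T : ℕ) (g : ℕ → ℕ → Fin n → Mat d₁ d₂ → Mat d₁ d₂)
    (X₀ : Mat d₁ d₂) (M₀ : Fin n → Mat d₁ d₂) {lmo : Mat d₁ d₂ → Mat d₁ d₂}
    (hlmo : lmo = nsOutput (15 / 8) (-5 / 4) (3 / 8) T) {κ : ℝ} (hκ : 0 < κ)
    (hκ' : κ ≤ kappa R K (lmoInput lmo η α K g X₀ M₀)) :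
    ∑ t ∈ Finset.range (R * K), schattenNorm (nsExponent κ T)
        (grad (globalLoss 𝒟 F) (flatAvg lmo η α K g X₀ M₀ t))
      ≤ (globalLoss 𝒟 F X₀ - ⨅ X, globalLoss 𝒟 F X) / η
        + ∑ t ∈ Finset.range (R * K), (2 * ((1 / (n : ℝ)) * ∑ i,
          dualNorm (grad (globalLoss 𝒟 F) (flatAvg lmo η α K g X₀ M₀ t)
            - lmoInput lmo η α K g X₀ M₀ i (t / K) (t % K))) + L * η / 2) := by
  set f := globalLoss 𝒟 F with hf
  set x := flatAvg lmo η α K g X₀ M₀ with hx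
  set S : ℕ → ℝ := fun t => schattenNorm (nsExponent κ T) (grad f (x t)) with hS
  set E : ℕ → ℝ := fun t => 2 * ((1 / (n : ℝ)) * ∑ i,
    dualNorm (grad f (x t) - lmoInput lmo η α K g X₀ M₀ i (t / K) (t % K))) + L * η / 2 with hE
  have hκ1 : κ ≤ 1 := hκ'.trans (kappa_mem R K _).2
  have hn' : (0 : ℝ) < n := by exact_mod_cast hn
  have hsp : ∀ G, spNorm (lmo G) ≤ 1 := fun G => by rw [hlmo]; exact spNorm_nsOutput_le T G
  have hstep : ∀ t < R * K, f (x (t + 1)) ≤ f (x t) - η * S t + η * E t := by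
    intro t ht
    have h1 := flatAvg_succ lmo η α g X₀ M₀ hn hK t
    have h2 := le_of_smooth (differentiable_globalLoss hR) (smooth_globalLoss hL0 hR hL) (x t)
      (η • ((1 / (n : ℝ)) • ∑ i, lmo (lmoInput lmo η α K g X₀ M₀ i (t / K) (t % K))))
    rw [← h1, innerM_smul_right, innerM_smul_right, innerM_sum_right, spNorm_smul,
      abs_of_pos hη] at h2
    have h3 : spNorm ((1 / (n : ℝ)) • ∑ i,
        lmo (lmoInput lmo η α K g X₀ M₀ i (t / K) (t % K))) ≤ 1 :=
      spNorm_le_of_average_le zero_le_one fun i => hsp _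
    have h4 : ∑ i, innerM (grad f (x t)) (lmo (lmoInput lmo η α K g X₀ M₀ i (t / K) (t % K)))
        ≤ ∑ i, (-S t + 2 * dualNorm (grad f (x t)
          - lmoInput lmo η α K g X₀ M₀ i (t / K) (t % K))) := by
      refine Finset.sum_le_sum fun i _ => ?_
      have hr : t / K < R := Nat.div_lt_of_lt_mul (by rwa [mul_comm])
      have := innerM_nsOutput_le_add hκ hκ1 T
        (G := lmoInput lmo η α K g X₀ M₀ i (t / K) (t % K))
        (fun j => hκ'.trans (kappa_le (lmoInput lmo η α K g X₀ M₀) i hr (Nat.mod_lt t hK) j))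
        (grad f (x t))
      rwa [← hlmo] at this
    rw [Finset.sum_add_distrib, Finset.sum_const, Finset.card_univ, Fintype.card_fin, nsmul_eq_mul,
      ← Finset.mul_sum] at h4
    have h5 := mul_le_mul_of_nonneg_left h4 (show 0 ≤ 1 / (n : ℝ) by positivity)
    have h6 : 1 / (n : ℝ) * (n * -S t + 2 * ∑ i, dualNorm (grad f (x t)
          - lmoInput lmo η α K g X₀ M₀ i (t / K) (t % K))) = -S t + (E t - L * η / 2) := by
      simp only [hE]; field_simp; ring
    rw [h6] at h5
    have h7 := mul_le_mul_of_nonneg_left h5 hη.le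
    have h8 : L / 2 * (η * spNorm ((1 / (n : ℝ)) • ∑ i,
        lmo (lmoInput lmo η α K g X₀ M₀ i (t / K) (t % K)))) ^ 2 ≤ L / 2 * (η * 1) ^ 2 := by
      have := spNorm_nonneg ((1 / (n : ℝ)) • ∑ i,
        lmo (lmoInput lmo η α K g X₀ M₀ i (t / K) (t % K)))
      gcongr
    have h9 : f (x (t + 1)) ≤ f (x t) + η * (1 / ↑n * ∑ i,
      innerM (grad f (x t)) (lmo (lmoInput lmo η α K g X₀ M₀ i (t / K) (t % K)))) + L / 2 *
      (η * spNorm ((1 / (n : ℝ)) • ∑ i,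
        lmo (lmoInput lmo η α K g X₀ M₀ i (t / K) (t % K)))) ^ 2 := h2
    linarith
  have hsum : ∀ m ≤ R * K, f (x m) ≤ f (x 0) - η * ∑ t ∈ Finset.range m, S t
      + η * ∑ t ∈ Finset.range m, E t := by
    intro m
    induction m with
    | zero => simp
    | succ m ih =>
      intro hm
      have h1 := ih (by omega)
      have h2 := hstep m (by omega)
      rw [Finset.sum_range_succ, Finset.sum_range_succ]
      linarith
  have hfin := hsum (R * K) le_rfl
  have hinf : ⨅ X, f X ≤ f (x (R * K)) := ciInf_le hb _
  have hx0 : x 0 = X₀ := flatAvg_zero lmo η α g X₀ M₀ hn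
  rw [hx0] at hfin
  have : η * ∑ t ∈ Finset.range (R * K), S t
      ≤ η * ((f X₀ - ⨅ X, f X) / η + ∑ t ∈ Finset.range (R * K), E t) := by
    rw [mul_add, mul_div_cancel₀ _ hη.ne']
    linarith
  exact le_of_mul_le_mul_left this hη

end Descent

section Expectation

variable {n d₁ d₂ : ℕ} {Ξ : Type*} [MeasurableSpace Ξ] {𝒟 : Fin n → Measure Ξ}
  [∀ i, IsProbabilityMeasure (𝒟 i)]
  {F : Fin n → Mat d₁ d₂ → Ξ → ℝ} {L σ : ℝ}
  {Ω : Type*} [MeasurableSpace Ω] {P : Measure Ω} [IsProbabilityMeasure P]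
  {M₀ : Ω → Fin n → Mat d₁ d₂} {ξ : ℕ × ℕ × Fin n → Ω → Ξ}

/-- The noise part of the bound on the error of the oracle input of client `i` at the `m`-th step of
the round that begins at time `u`, where `V` is the noise of the stochastic gradients and `ε` the
error of the initial momenta. -/
def noiseError (α : ℝ) (V : ℕ → Fin n → Mat d₁ d₂) (ε : Fin n → Mat d₁ d₂) (u m : ℕ) (i : Fin n) :
    ℝ :=
  ((1 - (1 - α) ^ m) * frobNorm (noiseSum α (fun t => V t i) 0 u)
      + frobNorm (noiseSum α (fun t => V t i) u m))
    + frobNorm ((1 / (n : ℝ)) • ∑ j, noiseSum α (fun t => V t j) 0 u)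
    + (1 - α) ^ u * (frobNorm (ε i) + (1 / (n : ℝ)) * ∑ j, frobNorm (ε j))

/-- The expectation of the noise, averaged over the clients. The average noise of all clients enters
with the factor `√(α / n)`, that of a single client only with the factor `α √K`. -/
lemma integral_average_noiseError_le (hn : 0 < n) {α : ℝ} (hα : 0 ≤ α) (hα1 : α ≤ 1) (hσ : 0 ≤ σ)
    {V : ℕ × Fin n → Ω → Mat d₁ d₂} (hm : ∀ q, Measurable (V q))
    (h2 : ∀ q, Integrable (fun ω => frobNorm (V q ω) ^ 2) P)
    (hle : ∀ q, ∫ ω, frobNorm (V q ω) ^ 2 ∂P ≤ σ ^ 2)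
    (horth : ∀ q q', q ≠ q' → ∫ ω, innerM (V q ω) (V q' ω) ∂P = 0)
    {ε : Fin n → Ω → Mat d₁ d₂} {σ₀ : ℝ} (hε : ∀ i, Integrable (fun ω => frobNorm (ε i ω)) P)
    (hε' : (1 / (n : ℝ)) * ∑ i, ∫ ω, frobNorm (ε i ω) ∂P ≤ σ₀) (u : ℕ) {m K : ℕ} (hmK : m ≤ K) :
    Integrable (fun ω => (1 / (n : ℝ)) * ∑ i, noiseError α (fun t i => V (t, i) ω)
        (fun i => ε i ω) u m i) P ∧
      ∫ ω, (1 / (n : ℝ)) * ∑ i, noiseError α (fun t i => V (t, i) ω) (fun i => ε i ω) u m i ∂P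
        ≤ 2 * (σ * (α * √K)) + σ * √(α / n) + 2 * σ₀ * (1 - α) ^ u := by
  have hn' : (0 : ℝ) < n := by exact_mod_cast hn
  have hA := fun i => integral_noiseSum_le hα hα1 hσ hm h2 hle horth i 0 u
  have hB := fun i => integral_noiseSum_le hα hα1 hσ hm h2 hle horth i u m
  obtain ⟨hC1, hC2⟩ := integral_average_noiseSum_le hα hα1 hσ hm h2 hle horth u
  have hεs : Integrable (fun ω => (1 / (n : ℝ)) * ∑ j, frobNorm (ε j ω)) P :=
    (integrable_finsetSum _ fun j _ => hε j).const_mul _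
  have hεsv : ∫ ω, (1 / (n : ℝ)) * ∑ j, frobNorm (ε j ω) ∂P
      = (1 / (n : ℝ)) * ∑ j, ∫ ω, frobNorm (ε j ω) ∂P := by
    rw [integral_const_mul, integral_finsetSum _ fun j _ => hε j]
  have hI1 : ∀ i, Integrable (fun ω => (1 - (1 - α) ^ m)
      * frobNorm (noiseSum α (fun t => V (t, i) ω) 0 u)
      + frobNorm (noiseSum α (fun t => V (t, i) ω) u m)) P :=
    fun i => ((hA i).1.const_mul (1 - (1 - α) ^ m)).add (hB i).1
  have hI2 : ∀ i, Integrable (fun ω => ((1 - (1 - α) ^ m)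
      * frobNorm (noiseSum α (fun t => V (t, i) ω) 0 u)
      + frobNorm (noiseSum α (fun t => V (t, i) ω) u m))
      + frobNorm ((1 / (n : ℝ)) • ∑ j, noiseSum α (fun t => V (t, j) ω) 0 u)) P :=
    fun i => (hI1 i).add hC1
  have hI4 : ∀ i, Integrable (fun ω => frobNorm (ε i ω)
      + (1 / (n : ℝ)) * ∑ j, frobNorm (ε j ω)) P := fun i => (hε i).add hεs
  have hI3 : ∀ i, Integrable (fun ω => (1 - α) ^ u * (frobNorm (ε i ω)
      + (1 / (n : ℝ)) * ∑ j, frobNorm (ε j ω))) P := fun i => (hI4 i).const_mul ((1 - α) ^ u)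
  have hI : ∀ i, Integrable (fun ω => noiseError α (fun t i => V (t, i) ω)
      (fun i => ε i ω) u m i) P := fun i => (hI2 i).add (hI3 i)
  have hval : ∀ i, ∫ ω, noiseError α (fun t i => V (t, i) ω) (fun i => ε i ω) u m i ∂P
      ≤ 2 * (σ * (α * √K)) + σ * √(α / n)
        + (1 - α) ^ u * (∫ ω, frobNorm (ε i ω) ∂P
          + (1 / (n : ℝ)) * ∑ j, ∫ ω, frobNorm (ε j ω) ∂P) := by
    intro i
    have e : ∫ ω, noiseError α (fun t i => V (t, i) ω) (fun i => ε i ω) u m i ∂P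
        = (((1 - (1 - α) ^ m) * ∫ ω, frobNorm (noiseSum α (fun t => V (t, i) ω) 0 u) ∂P
          + ∫ ω, frobNorm (noiseSum α (fun t => V (t, i) ω) u m) ∂P)
          + ∫ ω, frobNorm ((1 / (n : ℝ)) • ∑ j, noiseSum α (fun t => V (t, j) ω) 0 u) ∂P)
          + (1 - α) ^ u * (∫ ω, frobNorm (ε i ω) ∂P
            + (1 / (n : ℝ)) * ∑ j, ∫ ω, frobNorm (ε j ω) ∂P) := by
      rw [← hεsv, ← integral_add (hε i) hεs, ← integral_const_mul, ← integral_const_mul,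
        ← integral_add ((hA i).1.const_mul (1 - (1 - α) ^ m)) (hB i).1, ← integral_add (hI1 i) hC1,
        ← integral_add (hI2 i) (hI3 i)]
      rfl
    rw [e]
    have hp1 : (1 - α) ^ m ≤ 1 := pow_le_one₀ (by linarith) (by linarith)
    have hmK' : √(m : ℝ) ≤ √(K : ℝ) := Real.sqrt_le_sqrt (by exact_mod_cast hmK)
    have t1 : (1 - (1 - α) ^ m) * ∫ ω, frobNorm (noiseSum α (fun t => V (t, i) ω) 0 u) ∂P
        ≤ σ * (α * √K) := by
      calc _ ≤ (1 - (1 - α) ^ m) * (σ * √α) :=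
            mul_le_mul_of_nonneg_left (hA i).2.1 (by linarith)
        _ = σ * ((1 - (1 - α) ^ m) * √α) := by ring
        _ ≤ σ * (α * √m) := mul_le_mul_of_nonneg_left (one_sub_pow_mul_sqrt_le hα hα1 m) hσ
        _ ≤ σ * (α * √K) := by gcongr
    have t2 : ∫ ω, frobNorm (noiseSum α (fun t => V (t, i) ω) u m) ∂P ≤ σ * (α * √K) :=
      (hB i).2.2.trans (by gcongr)
    linarith
  refine ⟨(integrable_finsetSum _ fun i _ => hI i).const_mul _, ?_⟩
  rw [integral_const_mul, integral_finsetSum _ fun i _ => hI i]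
  have hs := mul_le_mul_of_nonneg_left (Finset.sum_le_sum fun i (_ : i ∈ Finset.univ) => hval i)
    (show 0 ≤ 1 / (n : ℝ) by positivity)
  refine hs.trans ?_
  have hpu : 0 ≤ (1 - α) ^ u := pow_nonneg (by linarith) u
  have e : ∀ (b : Fin n → ℝ) (w : ℝ), w = ∑ j, b j →
      1 / (n : ℝ) * ∑ i, (2 * (σ * (α * √K)) + σ * √(α / n)
      + (1 - α) ^ u * (b i + (1 / (n : ℝ)) * w))
      = 2 * (σ * (α * √K)) + σ * √(α / n) + 2 * ((1 - α) ^ u * (1 / (n : ℝ) * w)) := by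
    intro b w hw
    rw [Finset.sum_add_distrib, ← Finset.mul_sum, Finset.sum_add_distrib (f := b), ← hw]
    simp only [Finset.sum_const, Finset.card_univ, Fintype.card_fin, nsmul_eq_mul]
    field_simp
    ring
  rw [e _ _ rfl]
  have := mul_le_mul_of_nonneg_left hε' hpu
  linarith

/-- The bound on the average expected Schatten norm of the gradients for a general step size `η` and
momentum parameter `α`. -/
lemma lintegral_schattenNorm_le (hn : 0 < n) {R K : ℕ} (hR0 : 0 < R) (hK : 0 < K) (hL0 : 0 ≤ L)
    (hσ : 0 ≤ σ) (hR : RegularLoss 𝒟 F) (hL : SmoothLoss 𝒟 F L) (hB : BoundedNoise 𝒟 F σ)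
    (hb : BddBelow (Set.range (globalLoss 𝒟 F))) (X₀ : Mat d₁ d₂)
    (hM : Measurable M₀)
    (hM2 : ∀ i, Integrable (fun ω => frobNorm (M₀ ω i - grad (clientLoss 𝒟 F i) X₀) ^ 2) P)
    (hξ : ∀ q, Measurable (ξ q)) (hD : ∀ q, P.map (ξ q) = 𝒟 q.2.2) (hind : iIndepFun ξ P)
    (hMξ : IndepFun M₀ (fun ω q => ξ q ω) P) {σ₀ : ℝ}
    (hσ₀ : σ₀ = √((1 / (n : ℝ)) *
        ∑ i, ∫ ω, frobNorm (M₀ ω i - grad (clientLoss 𝒟 F i) X₀) ^ 2 ∂P))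
    {η α : ℝ} (hη : 0 < η) (hα : 0 < α) (hα1 : α ≤ 1) (T : ℕ) {lmo : Mat d₁ d₂ → Mat d₁ d₂}
    (hlmo : lmo = nsOutput (15 / 8) (-5 / 4) (3 / 8) T) {κ : Ω → ℝ}
    (hκ : ∀ᵐ ω ∂P, 0 < κ ω ∧ κ ω ≤ kappa R K
      (lmoInput lmo η α K (sampleGrad F fun q => ξ q ω) X₀ (M₀ ω))) :
    (∑ r ∈ Finset.range R, ∑ k ∈ Finset.range K, ∫⁻ ω, ENNReal.ofReal
        (schattenNorm (nsExponent (κ ω) T) (grad (globalLoss 𝒟 F)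
          (avgIterate lmo η α K (sampleGrad F fun q => ξ q ω) X₀ (M₀ ω) r k))) ∂P)
        / ((R : ENNReal) * (K : ENNReal))
      ≤ ENNReal.ofReal ((globalLoss 𝒟 F X₀ - ⨅ X, globalLoss 𝒟 F X) / (η * R * K)
        + 17 * (L * η * (K + 1 / α)) + √(min d₁ d₂ : ℕ) * (4 * (σ * (α * √K)) + 2 * (σ * √(α / n))
          + 4 * σ₀ * (1 / R + 1 / (α * R * K)))) := by
  set f := globalLoss 𝒟 F with hf
  set ρ := √(min d₁ d₂ : ℕ) with hρ
  have hρ0 : 0 ≤ ρ := Real.sqrt_nonneg _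
  set r₀ := f X₀ - ⨅ X, f X with hr₀
  have hn' : (0 : ℝ) < n := by exact_mod_cast hn
  have hK' : (0 : ℝ) < K := by exact_mod_cast hK
  have hR' : (0 : ℝ) < R := by exact_mod_cast hR0
  have hK1 : (1 : ℝ) ≤ K := by exact_mod_cast hK
  have hlm : Measurable lmo := by rw [hlmo]; exact measurable_nsOutput _ _ _ T
  have hsp : ∀ G, spNorm (lmo G) ≤ 1 := fun G => by rw [hlmo]; exact spNorm_nsOutput_le T G
  have hallm : Measurable fun ω q => ξ q ω := measurable_pi_iff.mpr hξ
  -- the noise, and the error of the initialization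
  set V : ℕ × Fin n → Ω → Mat d₁ d₂ := fun p ω =>
    flatNoise lmo η α K 𝒟 F X₀ p.1 p.2 (M₀ ω, fun q => ξ q ω) with hV
  set ε : Fin n → Ω → Mat d₁ d₂ := fun i ω => M₀ ω i - grad (clientLoss 𝒟 F i) X₀ with hε
  have hVm : ∀ p, Measurable (V p) := fun p =>
    (measurable_flatNoise hlm hR hB p.1 p.2).comp (hM.prodMk hallm)
  have hV2 := fun p : ℕ × Fin n => flatNoise_secondMoment (η := η) (α := α) (X₀ := X₀)
    hK hlm hR hB hM hξ hD hind hMξ p.1 p.2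
  have hVo : ∀ p p', p ≠ p' → ∫ ω, innerM (V p ω) (V p' ω) ∂P = 0 := fun p p' hne =>
    flatNoise_uncorrelated hK hlm hR hB hM hξ hD hind hMξ hne
  have hεm : ∀ i, Measurable (ε i) := fun i =>
    ((measurable_pi_apply i).comp hM).sub measurable_const
  have hε1 : ∀ i, Integrable (fun ω => frobNorm (ε i ω)) P := fun i =>
    integrable_frobNorm (hεm i) (hM2 i)
  have hεσ : (1 / (n : ℝ)) * ∑ i, ∫ ω, frobNorm (ε i ω) ∂P ≤ σ₀ := by
    rw [hσ₀]
    refine Real.le_sqrt_of_sq_le ?_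
    have hj : ∀ i, (∫ ω, frobNorm (ε i ω) ∂P) ^ 2 ≤ ∫ ω, frobNorm (ε i ω) ^ 2 ∂P := by
      intro i
      have h0 : 0 ≤ ∫ ω, frobNorm (ε i ω) ^ 2 ∂P := integral_nonneg fun _ => sq_nonneg _
      have h1 : 0 ≤ ∫ ω, frobNorm (ε i ω) ∂P := integral_nonneg fun _ => frobNorm_nonneg _
      have := integral_le_of_integral_sq_le (hε1 i) (hM2 i) (Real.sqrt_nonneg _)
        (Real.sq_sqrt h0).ge
      calc _ ≤ (√(∫ ω, frobNorm (ε i ω) ^ 2 ∂P)) ^ 2 := pow_le_pow_left₀ h1 this 2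
        _ = _ := Real.sq_sqrt h0
    have h2 := sq_sum_le_card_mul_sum_sq (s := (Finset.univ : Finset (Fin n)))
      (f := fun i => ∫ ω, frobNorm (ε i ω) ∂P)
    rw [Finset.card_univ, Fintype.card_fin] at h2
    have h3 : ∑ i, (∫ ω, frobNorm (ε i ω) ∂P) ^ 2 ≤ ∑ i, ∫ ω, frobNorm (ε i ω) ^ 2 ∂P :=
      Finset.sum_le_sum fun i _ => hj i
    rw [mul_pow]
    calc (1 / (n : ℝ)) ^ 2 * (∑ i, ∫ ω, frobNorm (ε i ω) ∂P) ^ 2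
        ≤ (1 / (n : ℝ)) ^ 2 * (n * ∑ i, ∫ ω, frobNorm (ε i ω) ^ 2 ∂P) := by
          gcongr
          exact h2.trans (mul_le_mul_of_nonneg_left h3 hn'.le)
      _ = _ := by field_simp; rfl
  set Y : ℕ → Ω → ℝ := fun t ω => (1 / (n : ℝ)) * ∑ i, noiseError α (fun t i => V (t, i) ω)
    (fun i => ε i ω) (t / K * K) (t % K + 1) i with hY
  have hYI := fun t => integral_average_noiseError_le hn hα.le hα1 hσ hVm (fun p => (hV2 p).1)
    (fun p => (hV2 p).2) hVo hε1 hεσ (t / K * K) (m := t % K + 1) (K := K) (Nat.mod_lt t hK)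
  set C := 2 * (L * (η * K)) + 3 * (L * η / α + L * (2 * η * K)) with hC
  -- the bound along a realization
  have hpath : ∀ᵐ ω ∂P, ∑ t ∈ Finset.range (R * K), schattenNorm (nsExponent (κ ω) T)
      (grad f (flatAvg lmo η α K (sampleGrad F fun q => ξ q ω) X₀ (M₀ ω) t))
      ≤ r₀ / η + ∑ t ∈ Finset.range (R * K), (2 * (C + ρ * Y t ω) + L * η / 2) := by
    filter_upwards [hκ] with ω hω
    refine (sum_schattenNorm_le hn hK hL0 hR hL hb hη α T (sampleGrad F fun q => ξ q ω) X₀ (M₀ ω)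
      hlmo hω.1 hω.2).trans (add_le_add le_rfl (Finset.sum_le_sum fun t _ => ?_))
    have hEi : ∀ i, dualNorm (grad f (flatAvg lmo η α K (sampleGrad F fun q => ξ q ω) X₀ (M₀ ω) t)
        - lmoInput lmo η α K (sampleGrad F fun q => ξ q ω) X₀ (M₀ ω) i (t / K) (t % K))
        ≤ C + ρ * noiseError α (fun t i => V (t, i) ω) (fun i => ε i ω)
          (t / K * K) (t % K + 1) i := by
      intro i
      set x := flatAvg lmo η α K (sampleGrad F fun q => ξ q ω) X₀ (M₀ ω) with hx
      set y : ℕ → Fin n → Mat d₁ d₂ := fun t i =>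
        (flatIter lmo η α K (sampleGrad F fun q => ξ q ω) X₀ (M₀ ω) t i).1 with hy
      set M : ℕ → Fin n → Mat d₁ d₂ := fun t i =>
        (flatIter lmo η α K (sampleGrad F fun q => ξ q ω) X₀ (M₀ ω) t i).2 with hMdef
      have hrec : ∀ t i, M (t + 1) i = (1 - α) • M t i
          + α • (grad (clientLoss 𝒟 F i) (y t i) + V (t, i) ω) := by
        intro t i
        simp only [hMdef]
        rw [flatIter_succ_snd _ _ _ _ _ _ hK]
        congr 2
        change _ = grad (clientLoss 𝒟 F i) (y t i) + (stochGrad F i (y t i) (ξ (t / K, t % K, i) ω)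
          - grad (clientLoss 𝒟 F i) (y t i))
        rw [add_sub_cancel]
        rfl
      have h := dualNorm_lmoInput_sub_le (K := K) (x := x) (y := y) (M := M)
        (N := fun t i => V (t, i) ω) (A := fun i => grad (clientLoss 𝒟 F i))
        hL0 hη.le hα hα1 hL hrec
        (spNorm_flatAvg_succ_sub_le α _ X₀ (M₀ ω) hn hK hη.le hsp)
        (fun t i => spNorm_flatIter_sub_flatAvg_le α _ X₀ (M₀ ω) hn hK hη.le hsp t i)
        i (t / K * K) (t % K) (by exact_mod_cast Nat.mod_lt t hK)
      rw [Nat.div_add_mod', ← grad_globalLoss hR] at h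
      have hx0 : x 0 = X₀ := flatAvg_zero lmo η α _ X₀ (M₀ ω) hn
      have hM0 : ∀ j, M 0 j = M₀ ω j := fun j => by
        simp only [hMdef]; rw [flatIter_zero]
      simp only [hx0, hM0] at h
      rw [lmoInput_eq _ _ _ _ _ _ hK]
      exact h
    have havg : (1 / (n : ℝ)) * ∑ i, dualNorm
        (grad f (flatAvg lmo η α K (sampleGrad F fun q => ξ q ω) X₀ (M₀ ω) t)
        - lmoInput lmo η α K (sampleGrad F fun q => ξ q ω) X₀ (M₀ ω) i (t / K) (t % K))
        ≤ C + ρ * Y t ω := by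
      refine (mul_le_mul_of_nonneg_left (Finset.sum_le_sum fun i _ => hEi i)
        (show 0 ≤ 1 / (n : ℝ) by positivity)).trans_eq ?_
      rw [Finset.sum_add_distrib, ← Finset.mul_sum, Finset.sum_const, Finset.card_univ,
        Fintype.card_fin, nsmul_eq_mul]
      simp only [hY]
      field_simp
    linarith
  -- integration
  have hCY : ∀ t, Integrable (fun ω => C + ρ * Y t ω) P := fun t =>
    (integrable_const C).add ((hYI t).1.const_mul ρ)
  have hterm : ∀ t, Integrable (fun ω => 2 * (C + ρ * Y t ω) + L * η / 2) P := fun t =>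
    ((hCY t).const_mul 2).add (integrable_const _)
  have hBint : Integrable (fun ω =>
      r₀ / η + ∑ t ∈ Finset.range (R * K), (2 * (C + ρ * Y t ω) + L * η / 2)) P :=
    (integrable_const _).add (integrable_finsetSum _ fun t _ => hterm t)
  have hσ₀0 : 0 ≤ σ₀ := by rw [hσ₀]; exact Real.sqrt_nonneg _
  have hval : ∫ ω, (r₀ / η + ∑ t ∈ Finset.range (R * K), (2 * (C + ρ * Y t ω) + L * η / 2)) ∂P
      ≤ R * K * (r₀ / (η * R * K) + 17 * (L * η * (K + 1 / α))
        + ρ * (4 * (σ * (α * √K)) + 2 * (σ * √(α / n)) + 4 * σ₀ * (1 / R + 1 / (α * R * K)))) := by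
    rw [integral_add (integrable_const _) (integrable_finsetSum _ fun t _ => hterm t),
      integral_finsetSum _ fun t _ => hterm t, integral_const, probReal_univ, one_smul]
    have ht : ∀ t, ∫ ω, (2 * (C + ρ * Y t ω) + L * η / 2) ∂P
        ≤ (2 * C + L * η / 2 + 2 * ρ * (2 * (σ * (α * √K)) + σ * √(α / n)))
          + 4 * ρ * σ₀ * (1 - α) ^ (t / K * K) := by
      intro t
      rw [integral_add ((hCY t).const_mul 2) (integrable_const _),
        integral_const_mul, integral_add (integrable_const _) ((hYI t).1.const_mul ρ),
        integral_const_mul, integral_const, integral_const, probReal_univ, one_smul, one_smul]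
      have := mul_le_mul_of_nonneg_left (hYI t).2 hρ0
      linarith
    have hsum := Finset.sum_le_sum fun t (_ : t ∈ Finset.range (R * K)) => ht t
    rw [Finset.sum_add_distrib, Finset.sum_const, Finset.card_range, nsmul_eq_mul, ← Finset.mul_sum]
      at hsum
    have hgeo := mul_le_mul_of_nonneg_left (sum_pow_round_le hα hα1 R hK)
      (show 0 ≤ 4 * ρ * σ₀ by positivity)
    have hCle : 2 * C + L * η / 2 ≤ 17 * (L * η * (K + 1 / α)) := by
      have e1 : 17 * (L * η * (K + 1 / α)) - (2 * C + L * η / 2)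
          = L * η * (K - 1 / 2) + 11 * (L * η / α) := by
        simp only [hC]; field_simp; ring
      have : 0 ≤ L * η * (K - 1 / 2) + 11 * (L * η / α) := by
        have : 0 ≤ (K : ℝ) - 1 / 2 := by linarith
        positivity
      linarith
    have hRK : (0 : ℝ) ≤ R * K := by positivity
    have hCle' := mul_le_mul_of_nonneg_left hCle hRK
    have e2 : (R : ℝ) * K * (r₀ / (η * R * K) + 17 * (L * η * (K + 1 / α))
        + ρ * (4 * (σ * (α * √K)) + 2 * (σ * √(α / n)) + 4 * σ₀ * (1 / R + 1 / (α * R * K))))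
        = r₀ / η + (R * K * (17 * (L * η * (K + 1 / α)))
          + R * K * (2 * ρ * (2 * (σ * (α * √K)) + σ * √(α / n)))
          + 4 * ρ * σ₀ * (K * (1 + 1 / (α * K)))) := by
      field_simp
      ring
    rw [e2]
    push_cast at hsum
    linarith
  have hflat : ∀ r ∈ Finset.range R, ∀ k ∈ Finset.range K, ∀ ω,
      avgIterate lmo η α K (sampleGrad F fun q => ξ q ω) X₀ (M₀ ω) r k
        = flatAvg lmo η α K (sampleGrad F fun q => ξ q ω) X₀ (M₀ ω) (r * K + k) := by
    intro r _ k hk ω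
    have hk' := Finset.mem_range.mp hk
    rw [flatAvg, mul_add_div_of_lt hk', Nat.mul_add_mod_of_lt hk']
  have hRK0 : (0 : ℝ) < R * K := by positivity
  have hRKe : (R : ENNReal) * (K : ENNReal) = ENNReal.ofReal (R * K) := by
    rw [ENNReal.ofReal_mul hR'.le, ENNReal.ofReal_natCast, ENNReal.ofReal_natCast]
  rw [hRKe]
  refine ENNReal.div_le_of_le_mul ?_
  rw [mul_comm, ← ENNReal.ofReal_mul hRK0.le]
  calc _ ≤ ∑ r ∈ Finset.range R, ∫⁻ ω, ∑ k ∈ Finset.range K, ENNReal.ofReal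
        (schattenNorm (nsExponent (κ ω) T) (grad f
          (avgIterate lmo η α K (sampleGrad F fun q => ξ q ω) X₀ (M₀ ω) r k))) ∂P :=
        Finset.sum_le_sum fun r _ => sum_lintegral_le _ _
    _ ≤ ∫⁻ ω, ∑ r ∈ Finset.range R, ∑ k ∈ Finset.range K, ENNReal.ofReal
        (schattenNorm (nsExponent (κ ω) T) (grad f
          (avgIterate lmo η α K (sampleGrad F fun q => ξ q ω) X₀ (M₀ ω) r k))) ∂P :=
        sum_lintegral_le _ _
    _ ≤ ∫⁻ ω, ENNReal.ofReal (r₀ / η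
        + ∑ t ∈ Finset.range (R * K), (2 * (C + ρ * Y t ω) + L * η / 2)) ∂P := by
        refine lintegral_mono_ae ?_
        filter_upwards [hpath] with ω hω
        refine le_trans (le_of_eq ?_) (ENNReal.ofReal_le_ofReal hω)
        rw [sum_range_mul, ENNReal.ofReal_sum_of_nonneg fun r _ =>
          Finset.sum_nonneg fun k _ => schattenNorm_nonneg _ _]
        refine Finset.sum_congr rfl fun r hr => ?_
        rw [ENNReal.ofReal_sum_of_nonneg fun k _ => schattenNorm_nonneg _ _]
        exact Finset.sum_congr rfl fun k hk => by rw [hflat r hr k hk]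
    _ = ENNReal.ofReal (∫ ω, (r₀ / η
        + ∑ t ∈ Finset.range (R * K), (2 * (C + ρ * Y t ω) + L * η / 2)) ∂P) := by
        refine (ofReal_integral_eq_lintegral_ofReal hBint ?_).symm
        filter_upwards [hpath] with ω hω
        exact (Finset.sum_nonneg fun t _ => schattenNorm_nonneg _ _).trans hω
    _ ≤ _ := ENNReal.ofReal_le_ofReal hval

end Expectation

/-! ### Choice of the parameters -/

section Parameters

lemma le_rpow_one_div_of_pow_le {x y : ℝ} (hx : 0 ≤ x) {m : ℕ} (hm : m ≠ 0) (h : x ^ m ≤ y) :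
    x ≤ y ^ (1 / (m : ℝ)) := by
  rw [one_div, ← Real.pow_rpow_inv_natCast hx hm]
  exact Real.rpow_le_rpow (pow_nonneg hx m) h (by positivity)

/-- The choice of the momentum parameter. It is the largest `α ≤ 1` for which the noise terms, which
increase with `α`, are at most the first two terms of the rate. -/
lemma exists_momentum_parameter {n R K : ℕ} (hn : 0 < n) (hR : 0 < R) (hK : 0 < K) {D s : ℝ}
    (hD : 0 < D) (hs : 0 ≤ s) :
    ∃ α : ℝ, 0 < α ∧ α ≤ 1 ∧ s * (α * √K) ≤ (D * s / (R * √K)) ^ (1 / 3 : ℝ) ∧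
      s * √(α / n) ≤ (D * s ^ 2 / (n * R * K)) ^ (1 / 4 : ℝ) ∧
      √(D / (α * R * K)) ≤ (D * s ^ 2 / (n * R * K)) ^ (1 / 4 : ℝ)
        + (D * s / (R * √K)) ^ (1 / 3 : ℝ) + (D / R) ^ (1 / 2 : ℝ) ∧
      1 / (α * R * K) ≤ 1 / R + (s ^ 2 * K / (D * R * n)) ^ (1 / 2 : ℝ)
        + (s ^ 2 * K ^ 2 / (D * R ^ 2)) ^ (1 / 3 : ℝ) := by
  have hn' : (0 : ℝ) < n := by exact_mod_cast hn
  have hR' : (0 : ℝ) < R := by exact_mod_cast hR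
  have hK1 : (1 : ℝ) ≤ K := by exact_mod_cast hK
  have hK' : (0 : ℝ) < K := by linarith
  have h1 : 0 ≤ (D * s ^ 2 / (n * R * K)) ^ (1 / 4 : ℝ) := by positivity
  have h2 : 0 ≤ (D * s / (R * √K)) ^ (1 / 3 : ℝ) := by positivity
  have h3 : 0 ≤ (D / R) ^ (1 / 2 : ℝ) := by positivity
  have h4 : 0 ≤ (s ^ 2 * K / (D * R * n)) ^ (1 / 2 : ℝ) := by positivity
  have h5 : 0 ≤ (s ^ 2 * K ^ 2 / (D * R ^ 2)) ^ (1 / 3 : ℝ) := by positivity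
  have hq : √(K : ℝ) ^ 2 = K := Real.sq_sqrt hK'.le
  have hq0 : 0 < √(K : ℝ) := Real.sqrt_pos.mpr hK'
  -- the two bounds that hold for `α = 1`
  have hone : √(D / (1 * R * K)) ≤ (D / R) ^ (1 / 2 : ℝ) := by
    rw [← Real.sqrt_eq_rpow]
    refine Real.sqrt_le_sqrt ?_
    rw [one_mul]
    exact div_le_div_of_nonneg_left hD.le hR' (by nlinarith)
  have hone' : 1 / (1 * R * K) ≤ 1 / (R : ℝ) := by
    rw [one_mul]
    exact one_div_le_one_div_of_le hR' (by nlinarith)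
  rcases hs.eq_or_lt with rfl | hs
  · refine ⟨1, one_pos, le_rfl, ?_, ?_, ?_, ?_⟩
    · rw [zero_mul]; exact h2
    · rw [zero_mul]; exact h1
    · linarith
    · linarith
  -- for `α = b` the bound on `s α √K` is an equality, and for `α = a` that on `s √(α / n)`
  set a := √(D * n / (s ^ 2 * R * K)) with ha
  set b := (D / (R * K ^ 2 * s ^ 2)) ^ (1 / 3 : ℝ) with hb
  have ha0 : 0 < a := Real.sqrt_pos.mpr (by positivity)
  have hb0 : 0 < b := by positivity
  have ha2 : a ^ 2 = D * n / (s ^ 2 * R * K) := Real.sq_sqrt (by positivity)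
  have hb3 : b ^ 3 = D / (R * K ^ 2 * s ^ 2) := by
    rw [hb, ← Real.rpow_mul_natCast (by positivity)]
    norm_num
  refine ⟨min 1 (min a b), lt_min one_pos (lt_min ha0 hb0), min_le_left _ _, ?_, ?_, ?_⟩
  · have hle : min 1 (min a b) ≤ b := (min_le_right _ _).trans (min_le_right _ _)
    have : s * (b * √K) ≤ (D * s / (R * √K)) ^ (1 / 3 : ℝ) := by
      refine le_rpow_one_div_of_pow_le (m := 3) (by positivity) (by norm_num) (le_of_eq ?_)
      rw [mul_pow, mul_pow, hb3]
      nth_rewrite 1 [← hq]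
      field_simp
    exact le_trans (by gcongr) this
  · have hle : min 1 (min a b) ≤ a := (min_le_right _ _).trans (min_le_left _ _)
    have : s * √(a / n) ≤ (D * s ^ 2 / (n * R * K)) ^ (1 / 4 : ℝ) := by
      refine le_rpow_one_div_of_pow_le (m := 4) (by positivity) (by norm_num) (le_of_eq ?_)
      rw [mul_pow, show √(a / n) ^ 4 = (√(a / n) ^ 2) ^ 2 by ring,
        Real.sq_sqrt (by positivity), div_pow, ha2]
      field_simp
    exact le_trans (by gcongr) this
  · have hcases : min 1 (min a b) = 1 ∨ min 1 (min a b) = a ∨ min 1 (min a b) = b := by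
      rcases min_choice 1 (min a b) with h | h <;> rw [h]
      · exact Or.inl rfl
      · exact Or.inr (min_choice a b)
    rcases hcases with h | h | h <;> rw [h]
    · exact ⟨by linarith, by linarith⟩
    · have e1 : √(D / (a * R * K)) ≤ (D * s ^ 2 / (n * R * K)) ^ (1 / 4 : ℝ) := by
        refine le_rpow_one_div_of_pow_le (m := 4) (by positivity) (by norm_num) (le_of_eq ?_)
        rw [show √(D / (a * R * K)) ^ 4 = (√(D / (a * R * K)) ^ 2) ^ 2 by ring,
          Real.sq_sqrt (by positivity), div_pow, mul_pow, mul_pow, ha2]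
        field_simp
      have e2 : 1 / (a * R * K) ≤ (s ^ 2 * K / (D * R * n)) ^ (1 / 2 : ℝ) := by
        refine le_rpow_one_div_of_pow_le (m := 2) (by positivity) (by norm_num) ?_
        rw [div_pow, mul_pow, mul_pow, ha2]
        calc _ = s ^ 2 * (1 / K) / (D * R * n) := by field_simp
          _ ≤ _ := by
            have : 1 / (K : ℝ) ≤ K := by rw [div_le_iff₀ hK']; nlinarith
            gcongr
      have : 0 ≤ 1 / (R : ℝ) := by positivity
      exact ⟨by linarith, by linarith⟩
    · have e1 : √(D / (b * R * K)) ≤ (D * s / (R * √K)) ^ (1 / 3 : ℝ) := by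
        refine le_rpow_one_div_of_pow_le (m := 3) (by positivity) (by norm_num) ?_
        rw [← pow_le_pow_iff_left₀ (by positivity) (by positivity) two_ne_zero]
        refine le_of_eq ?_
        rw [show (√(D / (b * R * K)) ^ 3) ^ 2 = (√(D / (b * R * K)) ^ 2) ^ 3 by ring,
          Real.sq_sqrt (by positivity), div_pow, mul_pow, mul_pow, hb3, div_pow,
          mul_pow (R : ℝ), hq]
        field_simp
      have e2 : 1 / (b * R * K) ≤ (s ^ 2 * K ^ 2 / (D * R ^ 2)) ^ (1 / 3 : ℝ) := by
        refine le_rpow_one_div_of_pow_le (m := 3) (by positivity) (by norm_num) ?_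
        rw [div_pow, mul_pow, mul_pow, hb3]
        calc _ = s ^ 2 * (1 / K) / (D * R ^ 2) := by field_simp
          _ ≤ _ := by
            have : 1 / (K : ℝ) ≤ K ^ 2 := by
              rw [div_le_iff₀ hK']
              exact one_le_mul_of_one_le_of_one_le (one_le_pow₀ hK1) hK1
            gcongr
      have : 0 ≤ 1 / (R : ℝ) := by positivity
      exact ⟨by linarith, by linarith⟩

/-- The choice of the step size: it balances the two terms in which it occurs. -/
lemma exists_step_size {R K L r α : ℝ} (hR : 0 < R) (hK : 0 < K) (hL : 0 < L) (hr : 0 < r)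
    (hα : 0 < α) :
    ∃ η : ℝ, 0 < η ∧ r / (η * R * K) + 17 * (L * η * (K + 1 / α))
      ≤ 18 * (√(L * r / R) + √(L * r / (α * R * K))) := by
  set a := r / (R * K) with ha
  set b := L * (K + 1 / α) with hb
  have ha0 : 0 < a := by positivity
  have hb0 : 0 < b := by positivity
  refine ⟨√a / √b, by positivity, ?_⟩
  have hsa := Real.sq_sqrt ha0.le
  have hsb := Real.sq_sqrt hb0.le
  have hsa0 := Real.sqrt_pos.mpr ha0
  have hsb0 := Real.sqrt_pos.mpr hb0
  have e1 : r / (√a / √b * R * K) = √a * √b := by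
    have : r / (√a / √b * R * K) = a * √b / √a := by rw [ha]; field_simp
    rw [this, div_eq_iff hsa0.ne']
    nth_rewrite 1 [← hsa]
    ring
  have e2 : L * (√a / √b) * (K + 1 / α) = √a * √b := by
    have : L * (√a / √b) * (K + 1 / α) = b * √a / √b := by rw [hb]; ring
    rw [this, div_eq_iff hsb0.ne']
    nth_rewrite 1 [← hsb]
    ring
  have e3 : √a * √b = √(L * r / R + L * r / (α * R * K)) := by
    rw [← Real.sqrt_mul ha0.le, ha, hb]
    congr 1
    field_simp
  rw [e1, e2, e3]
  have : √(L * r / R + L * r / (α * R * K)) ≤ √(L * r / R) + √(L * r / (α * R * K)) := by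
    refine Real.sqrt_le_iff.mpr ⟨by positivity, ?_⟩
    have h1 := Real.sq_sqrt (show 0 ≤ L * r / R by positivity)
    have h2 := Real.sq_sqrt (show 0 ≤ L * r / (α * R * K) by positivity)
    have h3 : 0 ≤ √(L * r / R) * √(L * r / (α * R * K)) := by positivity
    linarith [add_sq (√(L * r / R)) (√(L * r / (α * R * K)))]
  linarith

/-- The bound for general parameters becomes the convergence rate. The factor `100` is not
optimized. -/
lemma exists_parameters {n R K : ℕ} (hn : 0 < n) (hR : 0 < R) (hK : 0 < K) {L r s s₀ : ℝ}
    (hL : 0 < L) (hr : 0 < r) (hs : 0 ≤ s) (hs₀ : 0 ≤ s₀) :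
    ∃ η α : ℝ, 0 < η ∧ 0 < α ∧ α ≤ 1 ∧
      r / (η * R * K) + 17 * (L * η * (K + 1 / α))
          + (4 * (s * (α * √K)) + 2 * (s * √(α / n)) + 4 * s₀ * (1 / R + 1 / (α * R * K)))
        ≤ 100 * convRate n R K L r s s₀ := by
  have hR' : (0 : ℝ) < R := by exact_mod_cast hR
  have hK' : (0 : ℝ) < K := by exact_mod_cast hK
  obtain ⟨α, hα, hα1, h1, h2, h3, h4⟩ := exists_momentum_parameter hn hR hK (mul_pos hL hr) hs
  obtain ⟨η, hη, h5⟩ := exists_step_size hR' hK' hL hr hα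
  refine ⟨η, α, hη, hα, hα1, ?_⟩
  rw [Real.sqrt_eq_rpow (L * r / R)] at h5
  have h6 := mul_le_mul_of_nonneg_left h4 hs₀
  have p1 : 0 ≤ (L * r * s ^ 2 / (n * R * K)) ^ (1 / 4 : ℝ) := by positivity
  have p2 : 0 ≤ (L * r * s / (R * √K)) ^ (1 / 3 : ℝ) := by positivity
  have p3 : 0 ≤ (L * r / R) ^ (1 / 2 : ℝ) := by positivity
  have p4 : 0 ≤ s₀ * (s ^ 2 * K / (L * r * R * n)) ^ (1 / 2 : ℝ) := by positivity
  have p5 : 0 ≤ s₀ * (s ^ 2 * K ^ 2 / (L * r * R ^ 2)) ^ (1 / 3 : ℝ) := by positivity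
  have p6 : 0 ≤ s₀ * (1 / R) := by positivity
  rw [convRate]
  linarith

end Parameters

end FedMuon

end

open FedMuon

theorem theorem3 :
    -- the exponent is `2` for `T = 0` and decreases to `1` as `T` grows
    (∀ κ : ℝ, 0 < κ → κ ≤ 1 →
      nsExponent κ 0 = 2 ∧ Antitone (nsExponent κ) ∧ (κ < 1 → StrictAnti (nsExponent κ)) ∧
        Tendsto (nsExponent κ) atTop (𝓝 1)) ∧
    -- the convergence rate, with an absolute constant `c`
    ∃ c : ℝ, 0 < c ∧
      ∀ (n d₁ d₂ R K : ℕ), 0 < n → 0 < R → 0 < K →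
      -- the clients' data distributions and sample losses
      ∀ (Ξ : Type*) [MeasurableSpace Ξ] (𝒟 : Fin n → Measure Ξ) [∀ i, IsProbabilityMeasure (𝒟 i)]
        (F : Fin n → Mat d₁ d₂ → Ξ → ℝ) (L σ : ℝ),
      0 ≤ L → 0 ≤ σ → RegularLoss 𝒟 F → SmoothLoss 𝒟 F L → BoundedNoise 𝒟 F σ →
      BddBelow (Set.range (globalLoss 𝒟 F)) →
      -- the initial parameter, with `r₀ = f X₀ - f⋆ > 0`
      ∀ (X₀ : Mat d₁ d₂) (r₀ : ℝ), r₀ = globalLoss 𝒟 F X₀ - ⨅ X, globalLoss 𝒟 F X → 0 < r₀ →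
      -- the initial momenta and the samples: independent, the sample `ξ r k i` with law `𝒟 i`
      ∀ (Ω : Type*) [MeasurableSpace Ω] (P : Measure Ω) [IsProbabilityMeasure P]
        (M₀ : Fin n → Ω → Mat d₁ d₂) (ξ : ℕ → ℕ → Fin n → Ω → Ξ),
      (∀ i, Measurable (M₀ i)) →
      (∀ i, Integrable (fun ω => frobNorm (M₀ i ω - grad (clientLoss 𝒟 F i) X₀) ^ 2) P) →
      (∀ r k i, Measurable (ξ r k i) ∧ P.map (ξ r k i) = 𝒟 i) →
      iIndepFun (fun q : ℕ × ℕ × Fin n => ξ q.1 q.2.1 q.2.2) P →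
      IndepFun (fun ω i => M₀ i ω) (fun ω (q : ℕ × ℕ × Fin n) => ξ q.1 q.2.1 q.2.2 ω) P →
      ∀ (ρ σ₀ : ℝ), ρ = √(min d₁ d₂ : ℕ) →
      σ₀ = √((1 / (n : ℝ)) *
        ∑ i, ∫ ω, frobNorm (M₀ i ω - grad (clientLoss 𝒟 F i) X₀) ^ 2 ∂P) →
      -- the number of Newton-Schulz steps
      ∀ T : ℕ, ∃ η α : ℝ, 0 < η ∧ 0 < α ∧ α ≤ 1 ∧
        ∀ (lmo : Mat d₁ d₂ → Mat d₁ d₂) (g : Ω → ℕ → ℕ → Fin n → Mat d₁ d₂ → Mat d₁ d₂)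
          (X : ℕ → ℕ → Ω → Mat d₁ d₂) (κ : Ω → ℝ),
        lmo = nsOutput (15 / 8) (-5 / 4) (3 / 8) T →
        (g = fun ω r k i Y => stochGrad F i Y (ξ r k i ω)) →
        (X = fun r k ω => avgIterate lmo η α K (g ω) X₀ (fun i => M₀ i ω) r k) →
        (κ = fun ω => kappa R K (lmoInput lmo η α K (g ω) X₀ (fun i => M₀ i ω))) →
        (∀ ω, 0 < κ ω ∧ κ ω ≤ 1) ∧
        -- `κ` and `p` taken along each realization
        (∑ r ∈ Finset.range R, ∑ k ∈ Finset.range K,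
            ∫⁻ ω, ENNReal.ofReal
              (schattenNorm (nsExponent (κ ω) T) (grad (globalLoss 𝒟 F) (X r k ω))) ∂P)
            / ((R : ENNReal) * (K : ENNReal))
          ≤ ENNReal.ofReal (c * convRate n R K L r₀ (ρ * σ) (ρ * σ₀)) ∧
        -- a constant `κ₀` that bounds `κ` from below over all realizations, and its constant `p`
        (∀ κ₀ : ℝ, 0 < κ₀ → (∀ᵐ ω ∂P, κ₀ ≤ κ ω) →
          (∑ r ∈ Finset.range R, ∑ k ∈ Finset.range K,
              ∫⁻ ω, ENNReal.ofReal
                (schattenNorm (nsExponent κ₀ T) (grad (globalLoss 𝒟 F) (X r k ω))) ∂P)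
              / ((R : ENNReal) * (K : ENNReal))
            ≤ ENNReal.ofReal (c * convRate n R K L r₀ (ρ * σ) (ρ * σ₀))) := by
  refine ⟨fun κ h0 h1 => ⟨nsExponent_zero h0 h1, nsExponent_antitone h0 h1,
    fun h => nsExponent_strictAnti h0 h, nsExponent_tendsto h0 h1⟩, 100, by norm_num, ?_⟩
  intro n d₁ d₂ R K hn hR0 hK Ξ _ 𝒟 _ F L σ hL0 hσ hR hL hB hb X₀ r₀ hr₀ hr₀' Ω _ P _ M₀ ξ hM hM2
    hξ hind hMξ ρ σ₀ hρ hσ₀ T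
  have hLpos : 0 < L := pos_of_iInf_lt hL0 (differentiable_globalLoss hR)
    (smooth_globalLoss hL0 hR hL) hb (X₀ := X₀) (by linarith)
  have hρ0 : 0 ≤ ρ := by rw [hρ]; exact Real.sqrt_nonneg _
  have hσ₀0 : 0 ≤ σ₀ := by rw [hσ₀]; exact Real.sqrt_nonneg _
  obtain ⟨η, α, hη, hα, hα1, hrate⟩ := exists_parameters hn hR0 hK hLpos hr₀'
    (mul_nonneg hρ0 hσ) (mul_nonneg hρ0 hσ₀0)
  refine ⟨η, α, hη, hα, hα1, ?_⟩
  intro lmo g X κ hlmo hg hX hκ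
  have hκm : ∀ ω, 0 < κ ω ∧ κ ω ≤ 1 := fun ω => by rw [hκ]; exact kappa_mem R K _
  have key : ∀ κ' : Ω → ℝ, (∀ᵐ ω ∂P, 0 < κ' ω ∧ κ' ω ≤ κ ω) →
      (∑ r ∈ Finset.range R, ∑ k ∈ Finset.range K, ∫⁻ ω, ENNReal.ofReal
        (schattenNorm (nsExponent (κ' ω) T) (grad (globalLoss 𝒟 F) (X r k ω))) ∂P)
        / ((R : ENNReal) * (K : ENNReal))
      ≤ ENNReal.ofReal (100 * convRate n R K L r₀ (ρ * σ) (ρ * σ₀)) := by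
    intro κ' hκ'
    subst hX hκ hg
    refine (lintegral_schattenNorm_le (M₀ := fun ω i => M₀ i ω)
      (ξ := fun q => ξ q.1 q.2.1 q.2.2) hn hR0 hK hL0 hσ hR hL hB hb X₀
      (measurable_pi_iff.mpr hM) hM2 (fun q => (hξ _ _ _).1) (fun q => (hξ _ _ _).2) hind hMξ hσ₀
      hη hα hα1 T hlmo hκ').trans (ENNReal.ofReal_le_ofReal (le_trans (le_of_eq ?_) hrate))
    rw [← hρ, ← hr₀]
    ring
  exact ⟨hκm, key κ (ae_of_all _ fun ω => ⟨(hκm ω).1, le_rfl⟩),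
    fun κ₀ h0 hle => key (fun _ => κ₀) (hle.mono fun ω hω => ⟨h0, hω⟩)⟩
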